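/- **Setting.** All functions are real valued. Consider on a domain $\Omega$, with points $(y,z)$, the system $$\partial_z v+z\partial_y v-\tfrac12\partial_y^4\psi=s_\psi,\qquad \partial_z\psi+z\partial_y\psi+\tfrac12\partial_y^2 v=s_v$$ in one of two cases: (I) $\Omega=\{y>0,\ z>0\}$ with $\psi|_{z=0}=0$; (II) $\Omega=\{y>0,\ 0<z<H\}$ for some $H>0$, with $\psi|_{z=0}=0$ and $\psi|_{z=H}=\Lambda v|_{z=H}$, where $\Lambda:H^{1/2}_0\to H^{-1/2}$ is a bounded linear operator with $\langle\Lambda f,f\rangle\le 0$ for all $f$. Here $H^{1/2}_0=\{f\in H^{1/2}(0,\infty):\int_0^\infty |f|^2\,dy/y<\infty\}$ and $H^{-1/2}$ is its dual; $\Lambda^*:H^{1/2}_0\to H^{-1/2}$ is the adjoint. Let $E_0$ and $E_{0,0}$ be the spaces of pairs $u=(v,\psi)$ (with weak derivatives in $y$) for which the norms $$\|u\|_{E_0}^2=\int_\Omega|\partial_y v|^2+\Big|\frac{v}{1+y}\Big|^2+|\partial_y^2\psi|^2+\Big|\frac{\psi}{1+y^2}\Big|^2,\qquad \|u\|_{E_{0,0}}^2=\int_\Omega|\partial_y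 v|^2+\Big|\frac{v}{y}\Big|^2+|\partial_y^2\psi|^2+\Big|\frac{\psi}{y^2}\Big|^2$$ are finite; thus $E_{0,0}\subset E_0$. Let $T(v,\psi)=((\partial_z+z\partial_y)\psi,(\partial_z+z\partial_y)v)$ in the sense of distributions on $\Omega$, and $E_1=\{u\in E_{0,0}:Tu\in E_{0,0}'\}$ with $\|u\|_{E_1}=\|u\|_{E_{0,0}}+\|Tu\|_{E_{0,0}'}$. The space $\mathcal D\subset E_1$ of test functions $\varpi=(w,\phi)$ consists, in case (I), of all $w\in C_c^\infty((0,\infty)\times[0,\infty))$, $\phi\in C_c^\infty((0,\infty)\times(0,\infty))$, and in case (II) of all $w\in C_c^\infty((0,\infty)\times[0,H])$, $\phi\in C_c^\infty((0,\infty)\times(0,H])$ with $\phi|_{z=H}=-\Lambda^*w|_{z=H}$. For $s\in E_1'$ write $\langle s,\varpi\rangle$ for the pairing, formally $\int_\Omega s_\psi\phi+\int_\Omega s_v w$. A *weak solution* with source $s$ is a pair $u=(v,\psi)$ in $E_0$ such that for all $\varpi=(w,\phi)\in\mathcal D$ $$\int_\Omega\Big(-v\,\partial_z\phi-zv\,\partial_y\phi-\tfrac12\partial_y^2\psi\,\partial_y^2\phi\Big)+\int_\Omega\Big(-\psi\,\partial_z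 w-z\psi\,\partial_y w-\tfrac12\partial_y v\,\partial_y w\Big)=\langle s,\varpi\rangle .$$ **Theorem.** (i) There is a numerical constant $C$ (independent of the case, of $H$, $\Lambda$ and $s$) such that for every $s\in E_1'$ there is a weak solution $u\in E_{0,0}$ with $\|u\|_{E_{0,0}}\le C\|s\|_{E_1'}$. (ii) Let $s\in E_1'$ have no part concentrated on the horizontal boundaries: on $\mathcal D$, $s$ is the sum of an element of $E_{0,0}'$ and of a functional $\varpi\mapsto\int_\Omega\sigma_\psi\phi+\int_\Omega\sigma_v w$ with $\sigma_v,\sigma_\psi$ integrable on $\Omega\cap K$ for every compact $K\subset\{y>0\}$. Let $u\in E_0$ be a weak solution with source $s$ such that $v$ and $\psi$ are $H^2$ on $\Omega\cap K$ for every such $K$. Then $\psi|_{z=0}=0$. In case (II), moreover, $v$ and $\psi$ have traces $v_H$, $\psi_H$ at $z=H$, and $\psi_H=\Lambda v_H$ weakly: for every $g\in C_c^\infty(0,\infty)$ with $\Lambda^*g\in C_c^\infty(0,\infty)$ (i.e. for every trace at $z=H$ of the component $w$ of some $(w,\phi)\in\mathcal D$) $$\int_0^\infty\psi_H\,g\,dy=\int_0^\infty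 v_H\,\Lambda^*g\,dy,$$ and, if $v_H\in H^{1/2}_0$, both sides equal $\langle\Lambda v_H,g\rangle$. (iii) For all $y_0>0$ and $0<z_1<z_2$ there is a constant $C$, depending only on $y_0,z_1,z_2$, with the following property in case (I), and in case (II) if $z_2\le H$. If $s\in E_1'$ satisfies $\partial_y^2s\in E_0'$ and $u\in E_0$ is a weak solution with source $s$, then the weak derivatives $\partial_y^4\psi$ and $\partial_y^3v$ exist in $L^2((y_0,\infty)\times(0,z_1))$ and $$\int_{(y_0,\infty)\times(0,z_1)}|\partial_y^4\psi|^2+|\partial_y^3v|^2\le C\left(\|u\|_{E_0}^2+\|\partial_y^2s\|_{E_0'}^2\right).$$ Here $\partial_y^2s\in E_0'$ means that some $\ell\in E_0'$ satisfies $\langle s,\partial_y^2\varpi\rangle=\langle\ell,\varpi\rangle$ for all $\varpi\in\mathcal D$ vanishing near $z=H$ (for all $\varpi\in\mathcal D$ in case (I)), and the estimate holds with $\|\ell\|_{E_0'}$ in place of $\|\partial_y^2s\|_{E_0'}$ for every such $\ell$. -/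

import Mathlib

open MeasureTheory Set Filter Topology
open scoped ContDiff

noncomputable section

namespace EquatorialLayer

/-! ### Domains, partial derivatives, test functions.
Points are `p = (y, z)`, so `p.1 = y` and `p.2 = z`. -/

/-- The domain `{y > 0, 0 < z < h}`; the quarter plane is `h = ⊤`. -/
def Dom (h : EReal) : Set (ℝ × ℝ) := {p | 0 < p.1 ∧ 0 < p.2 ∧ (p.2 : EReal) < h}

/-- Lebesgue measure on `Dom h`. -/
def mu (h : EReal) : Measure (ℝ × ℝ) := volume.restrict (Dom h)

/-- `∂_y f` (classical). -/
def dy (f : ℝ × ℝ → ℝ) : ℝ × ℝ → ℝ := fun p => fderiv ℝ f p (1, 0)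

/-- `∂_z f` (classical). -/
def dz (f : ℝ × ℝ → ℝ) : ℝ × ℝ → ℝ := fun p => fderiv ℝ f p (0, 1)

/-- The transport operator `(∂_z + z ∂_y) f`. -/
def transport (f : ℝ × ℝ → ℝ) : ℝ × ℝ → ℝ := fun p => dz f p + p.2 * dy f p

/-- `f` is smooth with compact support, and the support lies in `Q`. If `Q` is open this is
`C_c^∞(Q)`. The restrictions to `Dom h` of such `f` with `Q = {y > 0}` form
`C_c^∞((0,∞) × [0,h])` (smooth up to the horizontal boundaries). -/
structure IsTest {V : Type*} [NormedAddCommGroup V] [NormedSpace ℝ V] (Q : Set V) (f : V → ℝ) :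
    Prop where
  smooth : ContDiff ℝ ∞ f
  compact : HasCompactSupport f
  supp : tsupport f ⊆ Q

/-- `g` is the `n`-th weak derivative of `f` with respect to `y` in `Q`. -/
def HasWeakDy (n : ℕ) (Q : Set (ℝ × ℝ)) (f g : ℝ × ℝ → ℝ) : Prop :=
  ∀ φ, IsTest Q φ → ∫ p in Q, f p * (dy^[n] φ) p = (-1) ^ n * ∫ p in Q, g p * φ p

/-- `g` is the weak derivative of `f` with respect to `z` in `Q`. -/
def HasWeakDz (Q : Set (ℝ × ℝ)) (f g : ℝ × ℝ → ℝ) : Prop :=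
  ∀ φ, IsTest Q φ → ∫ p in Q, f p * dz φ p = -∫ p in Q, g p * φ p

/-! Elementary facts that make the spaces below linear. -/

theorem smooth_dy {f : ℝ × ℝ → ℝ} (hf : ContDiff ℝ ∞ f) : ContDiff ℝ ∞ (dy f) :=
  (hf.fderiv_right (m := ∞) (by simp)).clm_apply contDiff_const

theorem smooth_dz {f : ℝ × ℝ → ℝ} (hf : ContDiff ℝ ∞ f) : ContDiff ℝ ∞ (dz f) :=
  (hf.fderiv_right (m := ∞) (by simp)).clm_apply contDiff_const

theorem compact_dy {f : ℝ × ℝ → ℝ} (hf : HasCompactSupport f) : HasCompactSupport (dy f) :=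
  hf.fderiv_apply (𝕜 := ℝ) (1, 0)

theorem compact_dz {f : ℝ × ℝ → ℝ} (hf : HasCompactSupport f) : HasCompactSupport (dz f) :=
  hf.fderiv_apply (𝕜 := ℝ) (0, 1)

theorem continuous_transport {f : ℝ × ℝ → ℝ} (hf : ContDiff ℝ ∞ f) :
    Continuous (transport f) :=
  (smooth_dz hf).continuous.add (continuous_snd.mul (smooth_dy hf).continuous)

theorem compact_transport {f : ℝ × ℝ → ℝ} (hf : HasCompactSupport f) :
    HasCompactSupport (transport f) :=
  (compact_dz hf).add (compact_dy hf).mul_left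

theorem pair_integrable (h : EReal) {a F : ℝ × ℝ → ℝ} (ha : Continuous a) (hF : Continuous F)
    (hc : HasCompactSupport F) (x : Lp ℝ 2 (mu h)) :
    Integrable (fun p => a p * x p * F p) (mu h) := by
  have h1 : MemLp (fun p => a p * F p) 2 (mu h) :=
    ((ha.mul hF).memLp_of_hasCompactSupport (μ := volume) hc.mul_left).restrict _
  refine (h1.integrable_mul (Lp.memLp x)).congr (Eventually.of_forall fun p => ?_)
  simp only [Pi.mul_apply]; ring

theorem pair_add (h : EReal) {a F : ℝ × ℝ → ℝ} (ha : Continuous a) (hF : Continuous F)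
    (hc : HasCompactSupport F) (x x' : Lp ℝ 2 (mu h)) :
    ∫ p, a p * (x + x') p * F p ∂mu h
      = ∫ p, a p * x p * F p ∂mu h + ∫ p, a p * x' p * F p ∂mu h := by
  rw [← integral_add (pair_integrable h ha hF hc x) (pair_integrable h ha hF hc x')]
  refine integral_congr_ae ?_
  filter_upwards [Lp.coeFn_add x x'] with p hp
  rw [hp, Pi.add_apply]; ring

theorem pair_smul (h : EReal) (a F : ℝ × ℝ → ℝ) (r : ℝ) (x : Lp ℝ 2 (mu h)) :
    ∫ p, a p * (r • x) p * F p ∂mu h = r * ∫ p, a p * x p * F p ∂mu h := by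
  rw [← integral_const_mul]
  refine integral_congr_ae ?_
  filter_upwards [Lp.coeFn_smul r x] with p hp
  rw [hp, Pi.smul_apply, smul_eq_mul]; ring

theorem pair_zero (h : EReal) (a F : ℝ × ℝ → ℝ) :
    ∫ p, a p * (0 : Lp ℝ 2 (mu h)) p * F p ∂mu h = 0 := by
  have := pair_smul h a F 0 (0 : Lp ℝ 2 (mu h))
  simpa using this

theorem smooth_dy_iter {f : ℝ × ℝ → ℝ} (hf : ContDiff ℝ ∞ f) (n : ℕ) :
    ContDiff ℝ ∞ (dy^[n] f) := by
  induction n with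
  | zero => exact hf
  | succ n ih => rw [Function.iterate_succ_apply']; exact smooth_dy ih

theorem compact_dy_iter {f : ℝ × ℝ → ℝ} (hf : HasCompactSupport f) (n : ℕ) :
    HasCompactSupport (dy^[n] f) := by
  induction n with
  | zero => exact hf
  | succ n ih => rw [Function.iterate_succ_apply']; exact compact_dy ih

/-- For an `L²` function `x` and a weight `a`, the `n`-th weak `y`-derivative of `a x` is `x'`:
this relation is linear in `(x, x')`. -/
def weakDyRel (n : ℕ) (h : EReal) (a : ℝ × ℝ → ℝ) (ha : Continuous a) :
    Submodule ℝ (Lp ℝ 2 (mu h) × Lp ℝ 2 (mu h)) where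
  carrier := {x | HasWeakDy n (Dom h) (fun p => a p * x.1 p) x.2}
  add_mem' := by
    intro x x' hx hx' φ hφ
    have e1 := hx φ hφ
    have e2 := hx' φ hφ
    have hs := (smooth_dy_iter hφ.smooth n).continuous
    have hc := compact_dy_iter hφ.compact n
    have k1 := pair_add h ha hs hc x.1 x'.1
    have k2 := pair_add h (a := fun _ => 1) continuous_const hφ.smooth.continuous hφ.compact
      x.2 x'.2
    simp only [one_mul] at k2
    change ∫ p, a p * (x.1 + x'.1) p * (dy^[n] φ) p ∂mu h
      = (-1) ^ n * ∫ p, (x.2 + x'.2) p * φ p ∂mu h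
    change ∫ p, _ ∂mu h = (-1) ^ n * ∫ p, _ ∂mu h at e1 e2
    rw [k1, k2, e1, e2]; ring
  zero_mem' := by
    intro φ hφ
    have k1 := pair_zero h a (dy^[n] φ)
    have k2 := pair_zero h (fun _ => 1) φ
    simp only [one_mul] at k2
    change ∫ p, a p * (0 : Lp ℝ 2 (mu h)) p * (dy^[n] φ) p ∂mu h
      = (-1) ^ n * ∫ p, (0 : Lp ℝ 2 (mu h)) p * φ p ∂mu h
    rw [k1, k2, mul_zero]
  smul_mem' := by
    intro r x hx φ hφ
    have e1 := hx φ hφ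
    have k1 := pair_smul h a (dy^[n] φ) r x.1
    have k2 := pair_smul h (fun _ => 1) φ r x.2
    simp only [one_mul] at k2
    change ∫ p, a p * (r • x.1) p * (dy^[n] φ) p ∂mu h
      = (-1) ^ n * ∫ p, (r • x.2) p * φ p ∂mu h
    change ∫ p, _ ∂mu h = (-1) ^ n * ∫ p, _ ∂mu h at e1
    rw [k1, k2, e1]; ring

/-! ### The energy spaces -/

/-- The Hilbert space of pairs `u = (v, ψ)` with norm
`‖u‖² = ∫ |v/(c+y)|² + |∂_y v|² + |ψ/(c+y²)|² + |∂_y²ψ|²` over `Dom h`, encoded isometrically by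
the four `L²` functions `(v/(c+y), ∂_y v, ψ/(c+y²), ∂_y²ψ)`, the derivatives being weak ones. -/
def energySubmodule (c : ℝ) (h : EReal) : Submodule ℝ (PiLp 2 fun _ : Fin 4 => Lp ℝ 2 (mu h)) where
  carrier := {U |
    (U 0, U 1) ∈ weakDyRel 1 h (fun p => c + p.1) (by fun_prop) ∧
    (U 2, U 3) ∈ weakDyRel 2 h (fun p => c + p.1 ^ 2) (by fun_prop)}
  add_mem' := fun hx hx' =>
    ⟨Submodule.add_mem _ hx.1 hx'.1, Submodule.add_mem _ hx.2 hx'.2⟩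
  zero_mem' := ⟨Submodule.zero_mem _, Submodule.zero_mem _⟩
  smul_mem' := fun r _ hx => ⟨Submodule.smul_mem _ r hx.1, Submodule.smul_mem _ r hx.2⟩

/-- The type of elements of `energySubmodule c h`, a Hilbert space. -/
def Energy (c : ℝ) (h : EReal) : Type := energySubmodule c h

instance (c : ℝ) (h : EReal) : NormedAddCommGroup (Energy c h) :=
  inferInstanceAs (NormedAddCommGroup (energySubmodule c h))

instance (c : ℝ) (h : EReal) : InnerProductSpace ℝ (Energy c h) :=
  inferInstanceAs (InnerProductSpace ℝ (energySubmodule c h))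

/-- `E_0`, with weights `1 + y` and `1 + y²`. -/
abbrev E0 (h : EReal) := Energy 1 h

/-- `E_{0,0}`, with weights `y` and `y²`. -/
abbrev E00 (h : EReal) := Energy 0 h

variable {c : ℝ} {h : EReal}

/-- The component `v` of `u = (v, ψ)`. -/
def vOf (u : Energy c h) : ℝ × ℝ → ℝ := fun p => (c + p.1) * u.1 0 p

/-- `∂_y v`. -/
def dyvOf (u : Energy c h) : ℝ × ℝ → ℝ := u.1 1

/-- The component `ψ` of `u = (v, ψ)`. -/
def psiOf (u : Energy c h) : ℝ × ℝ → ℝ := fun p => (c + p.1 ^ 2) * u.1 2 p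

/-- `∂_y²ψ`. -/
def dyypsiOf (u : Energy c h) : ℝ × ℝ → ℝ := u.1 3

/-- `u` is (the class of) the pair of functions `(f, g)`, i.e. `v = f` and `ψ = g` a.e. -/
def Represents (u : Energy c h) (f g : ℝ × ℝ → ℝ) : Prop :=
  vOf u =ᵐ[mu h] f ∧ psiOf u =ᵐ[mu h] g

/-- Pairs `(u, τ)` of an element and a functional, with norm `‖u‖ + ‖τ‖`. -/
def WithDual (X : Type) [NormedAddCommGroup X] [NormedSpace ℝ X] : Type :=
  WithLp 1 (X × StrongDual ℝ X)

instance (X : Type) [NormedAddCommGroup X] [NormedSpace ℝ X] : NormedAddCommGroup (WithDual X) :=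
  inferInstanceAs (NormedAddCommGroup (WithLp 1 (X × StrongDual ℝ X)))

instance (X : Type) [NormedAddCommGroup X] [NormedSpace ℝ X] : NormedSpace ℝ (WithDual X) :=
  inferInstanceAs (NormedSpace ℝ (WithLp 1 (X × StrongDual ℝ X)))

theorem WithDual.norm_def {X : Type} [NormedAddCommGroup X] [NormedSpace ℝ X] (x : WithDual X) :
    ‖x‖ = ‖WithLp.fst x‖ + ‖WithLp.snd x‖ :=
  WithLp.prod_norm_eq_of_L1 x

/-- `E_1`: all `u ∈ E_{0,0}` with `T u ∈ E_{0,0}'`, where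
`T (v, ψ) = ((∂_z + z∂_y) ψ, (∂_z + z∂_y) v)` in the sense of distributions on `Dom h`, with norm
`‖u‖ + ‖T u‖`. The elements are the pairs `(u, T u)`: the functional `T u` is given on the (dense)
pairs of `C_c^∞(Dom h)` functions by transposition. -/
def E1 (h : EReal) : Submodule ℝ (WithDual (E00 h)) where
  carrier := {x | ∀ f g, IsTest (Dom h) f → IsTest (Dom h) g → ∀ e : E00 h, Represents e f g →
    WithLp.snd x e = -∫ p, psiOf x.fst p * transport f p ∂mu h
      - ∫ p, vOf x.fst p * transport g p ∂mu h}
  add_mem' := by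
    intro x x' hx hx' f g hf hg e he
    have e1 := hx f g hf hg e he
    have e2 := hx' f g hf hg e he
    have k1 := pair_add h (a := fun p => (0 : ℝ) + p.1 ^ 2) (by fun_prop)
      (continuous_transport hf.smooth) (compact_transport hf.compact) (x.fst.1 2) (x'.fst.1 2)
    have k2 := pair_add h (a := fun p => (0 : ℝ) + p.1) (by fun_prop)
      (continuous_transport hg.smooth) (compact_transport hg.compact) (x.fst.1 0) (x'.fst.1 0)
    change x.snd e + x'.snd e
      = -∫ p, ((0 : ℝ) + p.1 ^ 2) * (x.fst.1 2 + x'.fst.1 2) p * transport f p ∂mu h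
      - ∫ p, ((0 : ℝ) + p.1) * (x.fst.1 0 + x'.fst.1 0) p * transport g p ∂mu h
    rw [k1, k2, e1, e2]
    simp only [psiOf, vOf]; ring
  zero_mem' := by
    intro f g hf hg e he
    have k1 := pair_zero h (fun p => (0 : ℝ) + p.1 ^ 2) (transport f)
    have k2 := pair_zero h (fun p => (0 : ℝ) + p.1) (transport g)
    change (0 : ℝ) = -∫ p, ((0 : ℝ) + p.1 ^ 2) * (0 : Lp ℝ 2 (mu h)) p * transport f p ∂mu h
      - ∫ p, ((0 : ℝ) + p.1) * (0 : Lp ℝ 2 (mu h)) p * transport g p ∂mu h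
    rw [k1, k2]; simp
  smul_mem' := by
    intro r x hx f g hf hg e he
    have e1 := hx f g hf hg e he
    have k1 := pair_smul h (fun p => (0 : ℝ) + p.1 ^ 2) (transport f) r (x.fst.1 2)
    have k2 := pair_smul h (fun p => (0 : ℝ) + p.1) (transport g) r (x.fst.1 0)
    change r * x.snd e
      = -∫ p, ((0 : ℝ) + p.1 ^ 2) * (r • x.fst.1 2) p * transport f p ∂mu h
      - ∫ p, ((0 : ℝ) + p.1) * (r • x.fst.1 0) p * transport g p ∂mu h
    rw [k1, k2, e1]
    simp only [psiOf, vOf]; ring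

/-! ### The space `H^{1/2}_0(0,∞)` -/

/-- The function `f` encoded by `f₀ = (1 + 1/y)^{1/2} f`. -/
def unweight (f₀ : ℝ → ℝ) : ℝ → ℝ := fun y => f₀ y / √(1 + 1 / y)

/-- `H^{1/2}_0(0,∞)`, with norm
`‖f‖² = ∫ |f|² (1 + 1/y) dy + ∬ |f(y) - f(y')|² / |y - y'|² dy dy'`, encoded isometrically by the
`L²` functions `(1 + 1/y)^{1/2} f` and `(f(y) - f(y')) / (y - y')`. -/
def HHalf : Submodule ℝ (WithLp 2 (Lp ℝ 2 (volume.restrict (Ioi (0 : ℝ))) ×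
    Lp ℝ 2 ((volume.restrict (Ioi (0 : ℝ))).prod (volume.restrict (Ioi (0 : ℝ)))))) where
  carrier := {x | ∀ᵐ q ∂((volume.restrict (Ioi (0 : ℝ))).prod (volume.restrict (Ioi (0 : ℝ)))),
    x.snd q = (unweight x.fst q.1 - unweight x.fst q.2) / (q.1 - q.2)}
  add_mem' := by
    intro x x' hx hx'
    have k := Lp.coeFn_add x.fst x'.fst
    filter_upwards [hx, hx', Lp.coeFn_add x.snd x'.snd,
      Measure.quasiMeasurePreserving_fst.ae k, Measure.quasiMeasurePreserving_snd.ae k]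
      with q h1 h2 h3 h4 h5
    change (x.snd + x'.snd) q = (unweight (x.fst + x'.fst : Lp ℝ 2 _) q.1
      - unweight (x.fst + x'.fst : Lp ℝ 2 _) q.2) / (q.1 - q.2)
    simp only [unweight] at *
    rw [h3, h4, h5, Pi.add_apply, h1, h2, Pi.add_apply, Pi.add_apply]; ring
  zero_mem' := by
    have k := Lp.coeFn_zero ℝ 2 (volume.restrict (Ioi (0 : ℝ)))
    filter_upwards [Lp.coeFn_zero ℝ 2
      ((volume.restrict (Ioi (0 : ℝ))).prod (volume.restrict (Ioi (0 : ℝ)))),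
      Measure.quasiMeasurePreserving_fst.ae k, Measure.quasiMeasurePreserving_snd.ae k]
      with q h3 h4 h5
    change (0 : Lp ℝ 2 _) q = (unweight (0 : Lp ℝ 2 _) q.1
      - unweight (0 : Lp ℝ 2 _) q.2) / (q.1 - q.2)
    simp only [unweight] at *
    rw [h3, h4, h5]; simp
  smul_mem' := by
    intro r x hx
    have k := Lp.coeFn_smul r x.fst
    filter_upwards [hx, Lp.coeFn_smul r x.snd,
      Measure.quasiMeasurePreserving_fst.ae k, Measure.quasiMeasurePreserving_snd.ae k]
      with q h1 h3 h4 h5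
    change (r • x.snd) q = (unweight (r • x.fst : Lp ℝ 2 _) q.1
      - unweight (r • x.fst : Lp ℝ 2 _) q.2) / (q.1 - q.2)
    simp only [unweight] at *
    rw [h3, h4, h5, Pi.smul_apply, h1, Pi.smul_apply, Pi.smul_apply]
    simp only [smul_eq_mul]; ring

/-- The function on `(0,∞)` given by an element of `H^{1/2}_0`. -/
def hFn (f : HHalf) : ℝ → ℝ := unweight f.1.fst

/-- `f ∈ H^{1/2}_0` is (the class of) the function `g`. -/
def HIs (f : HHalf) (g : ℝ → ℝ) : Prop := hFn f =ᵐ[volume.restrict (Ioi (0 : ℝ))] g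

/-- `Λ^* g = k` in `H^{-1/2} = (H^{1/2}_0)'`, for functions `g` (in `H^{1/2}_0`) and `k`, where `k`
acts by integration. -/
def AdjointEq (Λ : HHalf →L[ℝ] StrongDual ℝ HHalf) (g k : ℝ → ℝ) : Prop :=
  ∃ G : HHalf, HIs G g ∧ ∀ f : HHalf, Λ.flip G f = ∫ y in Ioi (0 : ℝ), k y * hFn f y

/-! ### The boundary value problems and their weak formulation -/

/-- The two problems: (I) the quarter plane `y > 0, z > 0` with `ψ = 0` at `z = 0`; (II) the half
strip `y > 0, 0 < z < H` with `ψ = 0` at `z = 0` and `ψ = Λ v` at `z = H`, where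
`Λ : H^{1/2}_0 → H^{-1/2}` is a bounded non-positive operator. -/
inductive Problem : Type
  | quarterPlane : Problem
  | strip (H : ℝ) (hH : 0 < H) (Λ : HHalf →L[ℝ] StrongDual ℝ HHalf) (hΛ : ∀ f, Λ f f ≤ 0) :
      Problem

/-- The upper end of the range of `z`. -/
def Problem.height : Problem → EReal
  | quarterPlane => ⊤
  | strip H _ _ _ => (H : EReal)

/-- The condition on test functions at the upper boundary: none in (I), and
`φ = -Λ^* w` at `z = H` in (II). -/
def Problem.TopCondition : Problem → (ℝ × ℝ → ℝ) → (ℝ × ℝ → ℝ) → Prop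
  | quarterPlane, _, _ => True
  | strip H _ Λ _, w, φ => AdjointEq Λ (fun y => w (y, H)) (fun y => -φ (y, H))

/-- The space `𝒟` of test functions `(w, φ)`: `w` is smooth up to the horizontal boundaries, `φ`
also, but `φ` vanishes near `z = 0`; both have compact support in `y > 0`. -/
structure Problem.IsTestPair (P : Problem) (w φ : ℝ × ℝ → ℝ) : Prop where
  w_test : IsTest {p : ℝ × ℝ | 0 < p.1} w
  phi_test : IsTest {p : ℝ × ℝ | 0 < p.1 ∧ 0 < p.2} φ
  top : P.TopCondition w φ

/-- The left-hand side of the weak formulation. -/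
def weakForm (u : Energy c h) (w φ : ℝ × ℝ → ℝ) : ℝ :=
  (∫ p, (-(vOf u p * dz φ p) - p.2 * vOf u p * dy φ p
      - 1 / 2 * dyypsiOf u p * dy (dy φ) p) ∂mu h)
    + ∫ p, (-(psiOf u p * dz w p) - p.2 * psiOf u p * dy w p
      - 1 / 2 * dyvOf u p * dy w p) ∂mu h

/-- `u` is a weak solution with source `s ∈ E_1'`. The right-hand side `∫ s_ψ φ + ∫ s_v w` is the
duality pairing of `s` with the (unique) element of `E_1` given by `(w, φ)`. -/
def Problem.IsWeakSolution (P : Problem) (s : StrongDual ℝ (E1 P.height))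
    (u : Energy c P.height) : Prop :=
  ∀ w φ, P.IsTestPair w φ → ∃ x : E1 P.height, Represents x.1.fst w φ ∧ weakForm u w φ = s x

/-- The source has no part concentrated on the horizontal boundaries: on `𝒟` it is the sum of an
element `ρ` of `E_{0,0}'` and of a pair `(σ_v, σ_ψ)` of functions on the domain which are locally
integrable up to the horizontal boundaries. -/
def Problem.IsRegularSource (P : Problem) (s : StrongDual ℝ (E1 P.height)) : Prop :=
  ∃ (ρ : StrongDual ℝ (E00 P.height)) (σv σψ : ℝ × ℝ → ℝ),
    LocallyIntegrableOn σv {p : ℝ × ℝ | 0 < p.1} (mu P.height) ∧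
    LocallyIntegrableOn σψ {p : ℝ × ℝ | 0 < p.1} (mu P.height) ∧
    ∀ w φ, P.IsTestPair w φ → ∀ x : E1 P.height, Represents x.1.fst w φ →
      s x = ρ x.1.fst + ((∫ p, σψ p * φ p ∂mu P.height) + ∫ p, σv p * w p ∂mu P.height)

/-- `∂_y² s = ℓ ∈ E_0'`: one has `⟨s, ∂_y² ϖ⟩ = ⟨ℓ, ϖ⟩` for all `ϖ = (w, φ) ∈ 𝒟` which vanish
near the upper boundary (in the quarter plane: for all `ϖ ∈ 𝒟`). -/
def IsDyyOfSource (s : StrongDual ℝ (E1 h)) (l : StrongDual ℝ (E0 h)) : Prop :=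
  ∀ w φ, IsTest {p : ℝ × ℝ | 0 < p.1 ∧ (p.2 : EReal) < h} w → IsTest (Dom h) φ →
    ∃ (x : E1 h) (e : E0 h), Represents x.1.fst (dy (dy w)) (dy (dy φ)) ∧ Represents e w φ ∧
      s x = l e

/-! ### Local Sobolev spaces and traces -/

/-- `L²_loc` in `y > 0`, up to the horizontal boundaries. -/
def L2Loc (h : EReal) (f : ℝ × ℝ → ℝ) : Prop :=
  ∀ K : Set (ℝ × ℝ), IsCompact K → K ⊆ {p | 0 < p.1} → MemLp f 2 ((mu h).restrict K)

/-- `H¹_loc` in `y > 0`, up to the horizontal boundaries. -/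
def H1Loc (h : EReal) (f : ℝ × ℝ → ℝ) : Prop :=
  L2Loc h f ∧ ∃ fy fz, HasWeakDy 1 (Dom h) f fy ∧ HasWeakDz (Dom h) f fz ∧
    L2Loc h fy ∧ L2Loc h fz

/-- `H²_loc` in `y > 0`, up to the horizontal boundaries. -/
def H2Loc (h : EReal) (f : ℝ × ℝ → ℝ) : Prop :=
  L2Loc h f ∧ ∃ fy fz, HasWeakDy 1 (Dom h) f fy ∧ HasWeakDz (Dom h) f fz ∧
    H1Loc h fy ∧ H1Loc h fz

/-- The trace of `f` on the horizontal boundary `z = z₀` is `t`: the mean of `|f(y,z) - t(y)|` over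
a layer of thickness `η` at `z = z₀` tends to `0` with `η`, locally in `y > 0`. -/
def HasTrace (h : EReal) (f : ℝ × ℝ → ℝ) (z₀ : ℝ) (t : ℝ → ℝ) : Prop :=
  LocallyIntegrableOn t (Ioi 0) ∧ ∀ a b : ℝ, 0 < a → a < b →
    Tendsto (fun η : ℝ => (ENNReal.ofReal η)⁻¹ *
      ∫⁻ p in {p : ℝ × ℝ | a < p.1 ∧ p.1 < b ∧ |p.2 - z₀| < η}, ‖f p - t p.1‖ₑ ∂mu h)
      (𝓝[>] 0) (𝓝 0)

end EquatorialLayer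

end

open EquatorialLayer

/-!
Existence of weak solutions, their boundary conditions, and interior regularity in `y`.

*Existence.* For a test pair `ϖ = (w, φ)` the weak form `u ↦ weakForm u w φ` is represented by an
element `formVector ϖ` of `E_{0,0}`. Inserting `u = ϖ`, the transport terms become `-∫ T(wφ)`, where
`T = ∂_z + z ∂_y`, and this has the sign of `⟨Λ w, w⟩ ≤ 0` because `φ = -Λ^* w` at the top. The
diffusion terms control the norm of `E_{0,0}` by Hardy's and Rellich's inequalities. Hence
`‖ϖ‖_{E_{0,0}}` is bounded by a multiple of `‖formVector ϖ‖`; since `Tϖ` differs from `-formVector ϖ`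
by the diffusion terms, so is `‖ϖ‖_{E_1}` (`norm_le_formVector`). The functional
`formVector ϖ ↦ ⟨s, ϖ⟩` is therefore bounded, and the Riesz representation theorem yields the
solution (`exists_inner_eq_of_le`, `exists_weakSolution`).

*Density.* Pairs of `C_c^∞` functions on the domain are dense in `E_{0,0}`
(`closure_domTests_eq_top`), so that an element of `E_1` is determined by its pair of functions and
the pairing `⟨s, ϖ⟩` is well defined (`weakForm_eq_apply`). By the Lax–Milgram theorem density
follows once an element that is orthogonal to all such pairs for the diffusion form vanishes. This
is a Liouville property of `L²` functions with vanishing derivatives in `y`. Such a function has the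
same pairing with a test as with a suitable combination of dilates of that test, and the latter
pairing tends to zero with the dilation parameter going to infinity or to zero.

*Boundary conditions.* A function in `H²_loc` is a primitive in `z` of its weak derivative up to a
function of `y`, and so has traces. Testing the weak formulation with `g(y) η((z - z₀)/δ)` and letting
`δ → 0`, every term vanishes in the limit except those with a `z`-derivative of the test functions,
and these produce the boundary terms (`Problem.IsRegularSource.trace_pairing`).

*Interior regularity.* The functions `p = ∂_y v` and `Ψ = ∂_y² ψ` solve a system with square
integrable data (`WeakSystem`, `Problem.IsWeakSolution.weakSystem`), in which the condition `Ψ = 0`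
at `z = 0` is kept in weak form by tests that do not vanish there. The system is mollified in `y`
only, which commutes with `∂_z + z ∂_y`; a kernel supported on the negative axis keeps the tests away
from the boundary `y = 0`. The mollified functions are smooth in `y` and have weak `z`-derivatives in
`L²`, so that the equations may be multiplied by `η⁴ Ψ` and `η⁴ ∂_y p` with a cut-off function `η`,
added, and integrated. The boundary term at `z = 0` vanishes together with the trace of `Ψ`, and the
result controls `η² ∂_y² p` and `η² ∂_y² Ψ` in `L²`. The terms of intermediate order that `η` gives
rise to are absorbed by the interpolation identity `∫ ∂_y (η² (p ∂_y p + Ψ ∂_y Ψ)) = 0`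
(`WeakSystem.energy_estimate`). The bound does not depend on the kernel, and passes to the limit by
duality (`WeakSystem.exists_dyy`).
-/

noncomputable section

namespace EquatorialLayer

section

/-! ### Calculus of the partial derivatives -/

theorem hasDerivAt_fst {f : ℝ × ℝ → ℝ} (hf : Differentiable ℝ f) (y z : ℝ) :
    HasDerivAt (fun y => f (y, z)) (dy f (y, z)) y := by
  have h1 : HasDerivAt (fun y : ℝ => ((y, z) : ℝ × ℝ)) (1, 0) y :=
    (hasDerivAt_id y).prodMk (hasDerivAt_const y z)
  exact (hf (y, z)).hasFDerivAt.comp_hasDerivAt y h1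

theorem hasDerivAt_snd {f : ℝ × ℝ → ℝ} (hf : Differentiable ℝ f) (y z : ℝ) :
    HasDerivAt (fun z => f (y, z)) (dz f (y, z)) z := by
  have h1 : HasDerivAt (fun z : ℝ => ((y, z) : ℝ × ℝ)) (0, 1) z :=
    (hasDerivAt_const z y).prodMk (hasDerivAt_id z)
  exact (hf (y, z)).hasFDerivAt.comp_hasDerivAt z h1

theorem dy_eq {f : ℝ × ℝ → ℝ} (hf : Differentiable ℝ f) {y z d : ℝ}
    (h : HasDerivAt (fun y => f (y, z)) d y) : dy f (y, z) = d :=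
  (hasDerivAt_fst hf y z).unique h

theorem dz_eq {f : ℝ × ℝ → ℝ} (hf : Differentiable ℝ f) {y z d : ℝ}
    (h : HasDerivAt (fun z => f (y, z)) d z) : dz f (y, z) = d :=
  (hasDerivAt_snd hf y z).unique h

theorem dy_add {f g : ℝ × ℝ → ℝ} (hf : Differentiable ℝ f) (hg : Differentiable ℝ g) :
    dy (fun p => f p + g p) = fun p => dy f p + dy g p := by
  funext p; simp only [dy]
  rw [fderiv_fun_add (hf p) (hg p)]; rfl

theorem dz_add {f g : ℝ × ℝ → ℝ} (hf : Differentiable ℝ f) (hg : Differentiable ℝ g) :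
    dz (fun p => f p + g p) = fun p => dz f p + dz g p := by
  funext p; simp only [dz]
  rw [fderiv_fun_add (hf p) (hg p)]; rfl

theorem dy_mul {f g : ℝ × ℝ → ℝ} (hf : Differentiable ℝ f) (hg : Differentiable ℝ g) :
    dy (fun p => f p * g p) = fun p => dy f p * g p + f p * dy g p := by
  funext p; simp only [dy]
  rw [fderiv_fun_mul (hf p) (hg p)]; simp; ring

theorem dz_mul {f g : ℝ × ℝ → ℝ} (hf : Differentiable ℝ f) (hg : Differentiable ℝ g) :
    dz (fun p => f p * g p) = fun p => dz f p * g p + f p * dz g p := by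
  funext p; simp only [dz]
  rw [fderiv_fun_mul (hf p) (hg p)]; simp; ring

theorem dy_const_mul {f : ℝ × ℝ → ℝ} (hf : Differentiable ℝ f) (a : ℝ) :
    dy (fun p => a * f p) = fun p => a * dy f p := by
  funext p; simp only [dy]
  rw [fderiv_const_mul (hf p)]; rfl

theorem dz_const_mul {f : ℝ × ℝ → ℝ} (hf : Differentiable ℝ f) (a : ℝ) :
    dz (fun p => a * f p) = fun p => a * dz f p := by
  funext p; simp only [dz]
  rw [fderiv_const_mul (hf p)]; rfl

theorem dy_zero : dy (fun _ => 0) = fun _ => 0 := by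
  funext p; simp [dy]

theorem dz_zero : dz (fun _ => 0) = fun _ => 0 := by
  funext p; simp [dz]

theorem transport_zero : transport (fun _ => 0) = fun _ => 0 := by
  funext p; simp [transport, dy_zero, dz_zero]

theorem dy_snd_mul {f : ℝ × ℝ → ℝ} (hf : Differentiable ℝ f) (b : ℝ → ℝ)
    (hb : Differentiable ℝ b) : dy (fun p => b p.2 * f p) = fun p => b p.2 * dy f p := by
  funext ⟨y, z⟩
  exact dy_eq ((hb.comp differentiable_snd).mul hf) ((hasDerivAt_fst hf y z).const_mul (b z))

theorem dy_dz_comm {f : ℝ × ℝ → ℝ} (hf : ContDiff ℝ ∞ f) : dy (dz f) = dz (dy f) := by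
  funext p
  have hd : DifferentiableAt ℝ (fderiv ℝ f) p :=
    ((hf.fderiv_right (m := ∞) (by simp)).differentiable (by simp)) p
  have e1 : dy (dz f) p = fderiv ℝ (fderiv ℝ f) p (1, 0) (0, 1) := by
    simp only [dy]
    change fderiv ℝ (fun p => fderiv ℝ f p (0, 1)) p (1, 0) = _
    rw [fderiv_clm_apply hd (differentiableAt_const _)]
    simp
  have e2 : dz (dy f) p = fderiv ℝ (fderiv ℝ f) p (0, 1) (1, 0) := by
    simp only [dz]
    change fderiv ℝ (fun p => fderiv ℝ f p (1, 0)) p (0, 1) = _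
    rw [fderiv_clm_apply hd (differentiableAt_const _)]
    simp
  rw [e1, e2]
  have : IsSymmSndFDerivAt ℝ f p := hf.contDiffAt.isSymmSndFDerivAt (by
    simp only [minSmoothness_of_isRCLikeNormedField]; exact WithTop.coe_le_coe.2 le_top)
  exact this _ _

theorem smooth_transport {f : ℝ × ℝ → ℝ} (hf : ContDiff ℝ ∞ f) : ContDiff ℝ ∞ (transport f) :=
  (smooth_dz hf).add (contDiff_snd.mul (smooth_dy hf))

theorem dy_transport {f : ℝ × ℝ → ℝ} (hf : ContDiff ℝ ∞ f) :
    dy (transport f) = transport (dy f) := by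
  have h1 := (smooth_dz hf).differentiable (by simp)
  have h2 := (smooth_dy hf).differentiable (by simp)
  have h3 := dy_add (g := fun p => p.2 * dy f p) h1 ((differentiable_snd).mul h2)
  rw [dy_snd_mul h2 (fun t => t) differentiable_id, dy_dz_comm hf] at h3
  exact h3

theorem transport_mul {f g : ℝ × ℝ → ℝ} (hf : Differentiable ℝ f) (hg : Differentiable ℝ g) :
    transport (fun p => f p * g p) = fun p => transport f p * g p + f p * transport g p := by
  funext p
  simp only [transport, dy_mul hf hg, dz_mul hf hg]; ring

theorem tsupport_dy_subset (f : ℝ × ℝ → ℝ) : tsupport (dy f) ⊆ tsupport f :=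
  tsupport_fderiv_apply_subset ℝ (1, 0)

theorem tsupport_dz_subset (f : ℝ × ℝ → ℝ) : tsupport (dz f) ⊆ tsupport f :=
  tsupport_fderiv_apply_subset ℝ (0, 1)

namespace IsTest

variable {Q : Set (ℝ × ℝ)} {f g : ℝ × ℝ → ℝ}

theorem differentiable {V : Type*} [NormedAddCommGroup V] [NormedSpace ℝ V] {Q : Set V}
    {f : V → ℝ} (hf : IsTest Q f) : Differentiable ℝ f :=
  hf.smooth.differentiable (by simp)

theorem continuous {V : Type*} [NormedAddCommGroup V] [NormedSpace ℝ V] {Q : Set V}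
    {f : V → ℝ} (hf : IsTest Q f) : Continuous f := hf.smooth.continuous

theorem mono {V : Type*} [NormedAddCommGroup V] [NormedSpace ℝ V] {Q Q' : Set V}
    {f : V → ℝ} (hf : IsTest Q f) (h : Q ⊆ Q') : IsTest Q' f :=
  ⟨hf.smooth, hf.compact, hf.supp.trans h⟩

theorem eq_zero {V : Type*} [NormedAddCommGroup V] [NormedSpace ℝ V] {Q : Set V}
    {f : V → ℝ} (hf : IsTest Q f) {x : V} (hx : x ∉ Q) : f x = 0 :=
  image_eq_zero_of_notMem_tsupport fun h => hx (hf.supp h)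

theorem zero {V : Type*} [NormedAddCommGroup V] [NormedSpace ℝ V] {Q : Set V} :
    IsTest Q (fun _ => 0) :=
  ⟨contDiff_const, HasCompactSupport.zero, by
    rw [show (fun _ : V => (0 : ℝ)) = 0 from rfl, tsupport_zero]; exact empty_subset _⟩

theorem mul_left {V : Type*} [NormedAddCommGroup V] [NormedSpace ℝ V] {Q : Set V}
    {f g : V → ℝ} (hf : IsTest Q f) (hg : ContDiff ℝ ∞ g) : IsTest Q (fun p => g p * f p) :=
  ⟨hg.mul hf.smooth, hf.compact.mul_left, (tsupport_mul_subset_right).trans hf.supp⟩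

theorem add {V : Type*} [NormedAddCommGroup V] [NormedSpace ℝ V] {Q : Set V}
    {f g : V → ℝ} (hf : IsTest Q f) (hg : IsTest Q g) : IsTest Q (fun p => f p + g p) :=
  ⟨hf.smooth.add hg.smooth, hf.compact.add hg.compact,
    (tsupport_add f g).trans (union_subset hf.supp hg.supp)⟩

theorem const_mul {V : Type*} [NormedAddCommGroup V] [NormedSpace ℝ V] {Q : Set V}
    {f : V → ℝ} (hf : IsTest Q f) (a : ℝ) : IsTest Q (fun p => a * f p) :=
  hf.mul_left contDiff_const

theorem dy (hf : IsTest Q f) : IsTest Q (dy f) :=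
  ⟨smooth_dy hf.smooth, compact_dy hf.compact, (tsupport_dy_subset f).trans hf.supp⟩

theorem dz (hf : IsTest Q f) : IsTest Q (dz f) :=
  ⟨smooth_dz hf.smooth, compact_dz hf.compact, (tsupport_dz_subset f).trans hf.supp⟩

theorem transport (hf : IsTest Q f) : IsTest Q (transport f) :=
  hf.dz.add (hf.dy.mul_left contDiff_snd)

theorem dy_iter (hf : IsTest Q f) (n : ℕ) : IsTest Q (EquatorialLayer.dy^[n] f) := by
  induction n with
  | zero => exact hf
  | succ n ih => rw [Function.iterate_succ_apply']; exact ih.dy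

theorem integrable (hf : IsTest Q f) : Integrable f :=
  hf.continuous.integrable_of_hasCompactSupport hf.compact

theorem memLp (hf : IsTest Q f) : MemLp f 2 :=
  hf.continuous.memLp_of_hasCompactSupport hf.compact

end IsTest

/-! ### The domains, and integration by parts on them -/

/-- The range of `z` in `Dom h`. -/
def zRange (h : EReal) : Set ℝ := {z | 0 < z ∧ (z : EReal) < h}

theorem isOpen_zRange (h : EReal) : IsOpen (zRange h) :=
  (isOpen_lt continuous_const continuous_id).inter
    (isOpen_lt continuous_coe_real_ereal continuous_const)

theorem dom_eq (h : EReal) : Dom h = Ioi 0 ×ˢ zRange h := by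
  ext p; simp [Dom, zRange]

theorem isOpen_dom (h : EReal) : IsOpen (Dom h) := by
  rw [dom_eq]; exact isOpen_Ioi.prod (isOpen_zRange h)

theorem measurableSet_dom (h : EReal) : MeasurableSet (Dom h) := (isOpen_dom h).measurableSet

theorem mu_eq (h : EReal) :
    mu h = (volume.restrict (Ioi (0 : ℝ))).prod (volume.restrict (zRange h)) := by
  rw [mu, dom_eq, Measure.prod_restrict]; rfl

theorem zRange_top : zRange ⊤ = Ioi 0 := by
  ext z; simp [zRange, EReal.coe_lt_top]

theorem zRange_coe (H : ℝ) : zRange (H : EReal) = Ioo 0 H := by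
  ext z; simp [zRange]

theorem ae_mem_dom (h : EReal) : ∀ᵐ p ∂mu h, p ∈ Dom h :=
  ae_restrict_mem (measurableSet_dom h)

theorem hasCompactSupport_slice_fst {f : ℝ × ℝ → ℝ} (hf : HasCompactSupport f) (z : ℝ) :
    HasCompactSupport (fun y => f (y, z)) :=
  HasCompactSupport.intro (hf.isCompact.image continuous_fst) fun _ hy =>
    image_eq_zero_of_notMem_tsupport fun h => hy ⟨_, h, rfl⟩

theorem hasCompactSupport_slice_snd {f : ℝ × ℝ → ℝ} (hf : HasCompactSupport f) (y : ℝ) :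
    HasCompactSupport (fun z => f (y, z)) :=
  HasCompactSupport.intro (hf.isCompact.image continuous_snd) fun _ hz =>
    image_eq_zero_of_notMem_tsupport fun h => hz ⟨_, h, rfl⟩

theorem IsTest.integrable_mu {Q : Set (ℝ × ℝ)} {f : ℝ × ℝ → ℝ} (hf : IsTest Q f) (h : EReal) :
    Integrable f (mu h) := hf.integrable.restrict

theorem integral_mu_dy {G : ℝ × ℝ → ℝ} (hG : IsTest {p : ℝ × ℝ | 0 < p.1} G) (h : EReal) :
    ∫ p, dy G p ∂mu h = 0 := by
  have hi := hG.dy.integrable_mu h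
  rw [mu_eq] at hi ⊢
  rw [integral_prod_symm _ hi]
  refine integral_eq_zero_of_ae (Eventually.of_forall fun z => ?_)
  have hd : ∀ y, HasDerivAt (fun y => G (y, z)) (dy G (y, z)) y :=
    fun y => hasDerivAt_fst hG.differentiable y z
  have hc : ContDiff ℝ 1 (fun y => G (y, z)) :=
    (hG.smooth.of_le (by simp)).comp (contDiff_id.prodMk contDiff_const)
  have := HasCompactSupport.integral_Ioi_deriv_eq hc (hasCompactSupport_slice_fst hG.compact z) 0
  rw [hG.eq_zero (by simp)] at this
  simp only [Pi.zero_apply]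
  simpa [(hd _).deriv] using this

theorem integral_mu_transport {G : ℝ × ℝ → ℝ} (hG : IsTest {p : ℝ × ℝ | 0 < p.1} G)
    (h : EReal) : ∫ p, transport G p ∂mu h = ∫ p, dz G p ∂mu h := by
  have h1 := integral_mu_dy (hG.mul_left (g := fun p => p.2) contDiff_snd) h
  rw [dy_snd_mul hG.differentiable (fun t => t) differentiable_id] at h1
  simp only [transport]
  rw [integral_add (hG.dz.integrable_mu h)
    ((hG.dy.mul_left (g := fun p => p.2) contDiff_snd).integrable_mu h), h1, add_zero]

theorem integral_mu_dz_top {G : ℝ × ℝ → ℝ} (hG : IsTest {p : ℝ × ℝ | 0 < p.1 ∧ 0 < p.2} G) :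
    ∫ p, dz G p ∂mu ⊤ = 0 := by
  have hi := hG.dz.integrable_mu ⊤
  rw [mu_eq] at hi ⊢
  rw [integral_prod _ hi]
  refine integral_eq_zero_of_ae (Eventually.of_forall fun y => ?_)
  have hd : ∀ z, HasDerivAt (fun z => G (y, z)) (dz G (y, z)) z :=
    fun z => hasDerivAt_snd hG.differentiable y z
  have hc : ContDiff ℝ 1 (fun z => G (y, z)) :=
    (hG.smooth.of_le (by simp)).comp (contDiff_const.prodMk contDiff_id)
  have := HasCompactSupport.integral_Ioi_deriv_eq hc (hasCompactSupport_slice_snd hG.compact y) 0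
  rw [hG.eq_zero (by simp)] at this
  simp only [Pi.zero_apply, zRange_top]
  simpa [(hd _).deriv] using this

theorem integral_mu_dz_coe {G : ℝ × ℝ → ℝ} (hG : IsTest {p : ℝ × ℝ | 0 < p.1 ∧ 0 < p.2} G)
    {H : ℝ} (hH : 0 < H) :
    ∫ p, dz G p ∂mu (H : EReal) = ∫ y in Ioi (0 : ℝ), G (y, H) := by
  have hi := hG.dz.integrable_mu H
  rw [mu_eq] at hi ⊢
  rw [integral_prod _ hi]
  refine integral_congr_ae (Eventually.of_forall fun y => ?_)
  simp only [zRange_coe]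
  rw [← integral_Ioc_eq_integral_Ioo, ← intervalIntegral.integral_of_le hH.le,
    intervalIntegral.integral_eq_sub_of_hasDerivAt
      (fun z _ => hasDerivAt_snd hG.differentiable y z), hG.eq_zero (x := (y, 0)) (by simp),
    sub_zero]
  exact (hG.dz.continuous.comp (by fun_prop)).intervalIntegrable _ _

theorem integral_mu_dz_of_dom {h : EReal} {G : ℝ × ℝ → ℝ} (hG : IsTest (Dom h) G) :
    ∫ p, dz G p ∂mu h = 0 := by
  have e : ∫ p, dz G p ∂mu h = ∫ p, dz G p ∂mu ⊤ := by
    simp only [mu]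
    rw [setIntegral_eq_integral_of_forall_compl_eq_zero (fun p hp => hG.dz.eq_zero hp)]
    rw [setIntegral_eq_integral_of_forall_compl_eq_zero]
    intro p hp
    exact hG.dz.eq_zero fun hp' => hp ⟨hp'.1, hp'.2.1, EReal.coe_lt_top _⟩
  rw [e]
  exact integral_mu_dz_top (hG.mono fun p hp => ⟨hp.1, hp.2.1⟩)

/-- Integration by parts in `y`: no boundary terms, as the supports lie in `y > 0`. -/
theorem integral_mu_mul_dy {f g : ℝ × ℝ → ℝ} (hf : ContDiff ℝ ∞ f)
    (hg : IsTest {p : ℝ × ℝ | 0 < p.1} g) (h : EReal) :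
    ∫ p, f p * dy g p ∂mu h = -∫ p, dy f p * g p ∂mu h := by
  have h1 := integral_mu_dy (hg.mul_left hf) h
  rw [dy_mul (hf.differentiable (by simp)) hg.differentiable,
    integral_add ((hg.mul_left (smooth_dy hf)).integrable_mu h)
      ((hg.dy.mul_left hf).integrable_mu h)] at h1
  linarith

theorem integral_mu_mul_transport {h : EReal} {f g : ℝ × ℝ → ℝ} (hf : ContDiff ℝ ∞ f)
    (hg : IsTest (Dom h) g) :
    ∫ p, f p * transport g p ∂mu h = -∫ p, transport f p * g p ∂mu h := by
  have h1 := integral_mu_transport ((hg.mul_left hf).mono fun p hp => hp.1) h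
  rw [integral_mu_dz_of_dom (hg.mul_left hf),
    transport_mul (hf.differentiable (by simp)) hg.differentiable,
    integral_add ((hg.mul_left (smooth_transport hf)).integrable_mu h)
      ((hg.transport.mul_left hf).integrable_mu h)] at h1
  linarith

end

section

/-! ### Elements of the energy spaces -/

theorem integrable_mul_test {h : EReal} {f φ : ℝ × ℝ → ℝ} {Q : Set (ℝ × ℝ)}
    (hf : MemLp f 2 (mu h)) (hφ : IsTest Q φ) : Integrable (fun p => f p * φ p) (mu h) :=
  hf.integrable_mul (hφ.memLp.restrict _)

/-- A locally integrable function on `Dom h` is determined by its integrals against tests. -/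
theorem ae_eq_of_test {h : EReal} {f g : ℝ × ℝ → ℝ} (hf : LocallyIntegrableOn f (Dom h))
    (hg : LocallyIntegrableOn g (Dom h))
    (H : ∀ φ, IsTest (Dom h) φ → ∫ p, f p * φ p ∂mu h = ∫ p, g p * φ p ∂mu h) :
    f =ᵐ[mu h] g := by
  have key := (isOpen_dom h).ae_eq_zero_of_integral_contDiff_smul_eq_zero (μ := volume)
    (f := fun p => f p - g p) (hf.sub hg) (by
      intro φ h1 h2 h3
      have ht : IsTest (Dom h) φ := ⟨h1, h2, h3⟩
      have i1 : ∀ {f : ℝ × ℝ → ℝ}, LocallyIntegrableOn f (Dom h) →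
          Integrable (fun p => f p * φ p) := by
        intro f hf
        have : Integrable (fun p => φ p • f p) := by
          have h4 : IntegrableOn f (tsupport φ) := hf.integrableOn_compact_subset h3 h2
          rw [← integrableOn_iff_integrable_of_support_subset (s := tsupport φ)]
          · exact h4.continuousOn_smul h1.continuous.continuousOn h2
          · exact (Function.support_smul_subset_left φ f).trans (subset_tsupport φ)
        simpa [mul_comm] using this
      have e := H φ ht
      simp only [smul_eq_mul]
      have e2 : ∀ p, φ p * (f p - g p) = f p * φ p - g p * φ p := fun p => by ring
      simp only [e2]
      rw [integral_sub (i1 hf) (i1 hg)]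
      simp only [mu] at e
      rw [setIntegral_eq_integral_of_forall_compl_eq_zero (fun p hp => by rw [ht.eq_zero hp, mul_zero]),
        setIntegral_eq_integral_of_forall_compl_eq_zero (fun p hp => by rw [ht.eq_zero hp, mul_zero])] at e
      rw [e, sub_self])
  rw [EventuallyEq, mu, ae_restrict_iff' (measurableSet_dom h)]
  filter_upwards [key] with p hp hpd
  linarith [hp hpd]

theorem locallyIntegrableOn_of_memLp {h : EReal} {f : ℝ × ℝ → ℝ} (hf : MemLp f 2 (mu h)) :
    LocallyIntegrableOn f (Dom h) := by
  refine (locallyIntegrableOn_iff (isOpen_dom h).isLocallyClosed).2 fun K hK hc => ?_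
  have : MemLp f 2 (volume.restrict K) := hf.mono_measure (Measure.restrict_mono hK le_rfl)
  have hfin : IsFiniteMeasure (volume.restrict K) := ⟨by simpa using hc.measure_lt_top⟩
  exact MemLp.integrable (q := 2) (by norm_num) this

theorem ae_eq_of_test_memLp {h : EReal} {f g : ℝ × ℝ → ℝ} (hf : MemLp f 2 (mu h))
    (hg : MemLp g 2 (mu h))
    (H : ∀ φ, IsTest (Dom h) φ → ∫ p, f p * φ p ∂mu h = ∫ p, g p * φ p ∂mu h) :
    f =ᵐ[mu h] g :=
  ae_eq_of_test (locallyIntegrableOn_of_memLp hf) (locallyIntegrableOn_of_memLp hg) H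

variable {c : ℝ} {h : EReal}

theorem Energy.hasWeakDy_v (u : Energy c h) : HasWeakDy 1 (Dom h) (vOf u) (dyvOf u) := u.2.1

theorem Energy.hasWeakDy_psi (u : Energy c h) : HasWeakDy 2 (Dom h) (psiOf u) (dyypsiOf u) :=
  u.2.2

theorem Energy.memLp (u : Energy c h) (i : Fin 4) : MemLp (u.1 i) 2 (mu h) := Lp.memLp _

theorem Energy.ext {u u' : Energy c h} (H : ∀ i, u.1 i =ᵐ[mu h] u'.1 i) : u = u' :=
  Subtype.ext (by ext i : 1; exact Lp.ext (H i))

theorem Energy.inner_def (u u' : Energy c h) :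
    inner ℝ u u' = ∑ i, inner ℝ (u.1 i) (u'.1 i) := rfl

theorem Energy.norm_sq (u : Energy c h) : ‖u‖ ^ 2 = ∑ i, ‖u.1 i‖ ^ 2 :=
  PiLp.norm_sq_eq_of_L2 _ u.1

theorem Energy.norm_apply_le (u : Energy c h) (i : Fin 4) : ‖u.1 i‖ ≤ ‖u‖ :=
  PiLp.norm_apply_le u.1 i

theorem norm_sq_lp (x : Lp ℝ 2 (mu h)) : ‖x‖ ^ 2 = ∫ p, x p ^ 2 ∂mu h := by
  rw [← real_inner_self_eq_norm_sq, L2.inner_def]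
  refine integral_congr_ae (Eventually.of_forall fun p => ?_)
  simp [sq]

theorem inner_lp (x y : Lp ℝ 2 (mu h)) : inner ℝ x y = ∫ p, x p * y p ∂mu h := by
  rw [L2.inner_def]
  refine integral_congr_ae (Eventually.of_forall fun p => ?_)
  simp [mul_comm]

/-- The functions `v, ψ` determine the element of the energy space. -/
theorem Represents.unique (hc : 0 ≤ c) {u u' : Energy c h} {f g : ℝ × ℝ → ℝ}
    (hu : Represents u f g) (hu' : Represents u' f g) : u = u' := by
  have k0 : u.1 0 =ᵐ[mu h] u'.1 0 := by
    filter_upwards [hu.1, hu'.1, ae_mem_dom h] with p h1 h2 h3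
    have : c + p.1 ≠ 0 := by have := h3.1; positivity
    exact mul_left_cancel₀ this (h1.trans h2.symm)
  have k2 : u.1 2 =ᵐ[mu h] u'.1 2 := by
    filter_upwards [hu.2, hu'.2, ae_mem_dom h] with p h1 h2 h3
    have : c + p.1 ^ 2 ≠ 0 := by have := h3.1; positivity
    exact mul_left_cancel₀ this (h1.trans h2.symm)
  have k1 : u.1 1 =ᵐ[mu h] u'.1 1 := by
    refine ae_eq_of_test_memLp (u.memLp 1) (u'.memLp 1) fun φ hφ => ?_
    have e1 := u.hasWeakDy_v φ hφ
    have e2 := u'.hasWeakDy_v φ hφ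
    have e3 : ∫ p in Dom h, vOf u p * (dy^[1] φ) p = ∫ p in Dom h, vOf u' p * (dy^[1] φ) p :=
      integral_congr_ae (by filter_upwards [hu.1, hu'.1] with p h1 h2; rw [h1, h2])
    rw [e1, e2] at e3
    simpa [mu, dyvOf] using e3
  have k3 : u.1 3 =ᵐ[mu h] u'.1 3 := by
    refine ae_eq_of_test_memLp (u.memLp 3) (u'.memLp 3) fun φ hφ => ?_
    have e1 := u.hasWeakDy_psi φ hφ
    have e2 := u'.hasWeakDy_psi φ hφ
    have e3 : ∫ p in Dom h, psiOf u p * (dy^[2] φ) p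
        = ∫ p in Dom h, psiOf u' p * (dy^[2] φ) p :=
      integral_congr_ae (by filter_upwards [hu.2, hu'.2] with p h1 h2; rw [h1, h2])
    rw [e1, e2] at e3
    simpa [mu, dyypsiOf] using e3
  refine Energy.ext fun i => ?_
  fin_cases i
  exacts [k0, k1, k2, k3]

/-- The tests of `y > 0`: smooth functions with compact support which need not vanish on the
horizontal boundaries. -/
abbrev HalfTest (f : ℝ × ℝ → ℝ) : Prop := IsTest {p : ℝ × ℝ | 0 < p.1} f

theorem IsTest.half {f : ℝ × ℝ → ℝ} (hf : IsTest (Dom h) f) : HalfTest f :=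
  hf.mono fun _ hp => hp.1

/-- Division by a function that is smooth and nonzero for `y > 0` preserves tests. -/
theorem IsTest.div_fst {Q : Set (ℝ × ℝ)} {f : ℝ × ℝ → ℝ} (hf : IsTest Q f)
    (hQ : Q ⊆ {p | 0 < p.1}) {a : ℝ × ℝ → ℝ} (ha : ContDiff ℝ ∞ a)
    (ha0 : ∀ p : ℝ × ℝ, 0 < p.1 → a p ≠ 0) : IsTest Q (fun p => f p / a p) := by
  have e : (fun p => f p / a p) = fun p => f p * (a p)⁻¹ := by funext p; rw [div_eq_mul_inv]
  have hs : tsupport (fun p => f p / a p) ⊆ tsupport f := by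
    rw [e]; exact tsupport_mul_subset_left
  refine ⟨?_, ?_, hs.trans hf.supp⟩
  · refine contDiff_iff_contDiffAt.2 fun p => ?_
    by_cases hp : 0 < p.1
    · exact hf.smooth.contDiffAt.div ha.contDiffAt (ha0 p hp)
    · have : p ∉ tsupport f := fun hh => hp (hQ (hf.supp hh))
      rw [notMem_tsupport_iff_eventuallyEq] at this
      refine (contDiffAt_const (c := (0 : ℝ))).congr_of_eventuallyEq ?_
      filter_upwards [this] with q hq
      rw [hq]; simp
  · rw [e]; exact hf.compact.mul_right

theorem IsTest.hasWeakDy_one {w : ℝ × ℝ → ℝ} (hw : HalfTest w) :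
    HasWeakDy 1 (Dom h) w (EquatorialLayer.dy w) := by
  intro φ hφ
  have := integral_mu_mul_dy hw.smooth hφ.half h
  simpa [mu] using this

theorem IsTest.hasWeakDy_two {w : ℝ × ℝ → ℝ} (hw : HalfTest w) :
    HasWeakDy 2 (Dom h) w (EquatorialLayer.dy (EquatorialLayer.dy w)) := by
  intro φ hφ
  have e1 := integral_mu_mul_dy hw.smooth hφ.half.dy h
  have e2 := integral_mu_mul_dy hw.dy.smooth hφ.half h
  rw [e2] at e1
  simpa [mu] using e1

theorem weight_one_ne (hc : 0 ≤ c) (p : ℝ × ℝ) (hp : 0 < p.1) : c + p.1 ≠ 0 := by positivity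

theorem weight_two_ne (hc : 0 ≤ c) (p : ℝ × ℝ) (hp : 0 < p.1) : c + p.1 ^ 2 ≠ 0 := by positivity

theorem IsTest.memLp_mu {Q : Set (ℝ × ℝ)} {w : ℝ × ℝ → ℝ} (hw : IsTest Q w) (h : EReal) :
    MemLp w 2 (mu h) := hw.memLp.restrict _

theorem IsTest.div_one (hc : 0 ≤ c) {w : ℝ × ℝ → ℝ} (hw : HalfTest w) :
    HalfTest (fun p => w p / (c + p.1)) :=
  hw.div_fst subset_rfl (contDiff_const.add contDiff_fst) (weight_one_ne hc)

theorem IsTest.div_two (hc : 0 ≤ c) {w : ℝ × ℝ → ℝ} (hw : HalfTest w) :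
    HalfTest (fun p => w p / (c + p.1 ^ 2)) :=
  hw.div_fst subset_rfl (contDiff_const.add (contDiff_fst.pow 2)) (weight_two_ne hc)

/-- The element of the energy space given by a pair of smooth functions. -/
def testEnergy (hc : 0 ≤ c) (h : EReal) {w φ : ℝ × ℝ → ℝ} (hw : HalfTest w) (hφ : HalfTest φ) :
    Energy c h :=
  ⟨WithLp.toLp 2 ![((hw.div_one hc).memLp_mu h).toLp, (hw.dy.memLp_mu h).toLp,
      ((hφ.div_two hc).memLp_mu h).toLp, (hφ.dy.dy.memLp_mu h).toLp], by
    constructor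
    · intro η hη
      have := hw.hasWeakDy_one (h := h) η hη
      have e1 := ((hw.div_one hc).memLp_mu h).coeFn_toLp
      have e2 := (hw.dy.memLp_mu h).coeFn_toLp
      refine (integral_congr_ae ?_).trans (this.trans (congrArg _ (integral_congr_ae ?_)))
      · filter_upwards [e1, ae_mem_dom h] with p h1 h2
        simp only [Matrix.cons_val_zero]
        rw [h1, mul_div_cancel₀ _ (weight_one_ne hc p h2.1)]
      · filter_upwards [e2] with p h1
        simp only [Matrix.cons_val_one]
        rw [← h1]; rfl
    · intro η hη
      have := hφ.hasWeakDy_two (h := h) η hη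
      have e1 := ((hφ.div_two hc).memLp_mu h).coeFn_toLp
      have e2 := (hφ.dy.dy.memLp_mu h).coeFn_toLp
      refine (integral_congr_ae ?_).trans (this.trans (congrArg _ (integral_congr_ae ?_)))
      · filter_upwards [e1, ae_mem_dom h] with p h1 h2
        simp only [Matrix.cons_val]
        rw [h1, mul_div_cancel₀ _ (weight_two_ne hc p h2.1)]
      · filter_upwards [e2] with p h1
        simp only [Matrix.cons_val]
        rw [← h1]⟩

section testEnergy
variable (hc : 0 ≤ c) {w φ : ℝ × ℝ → ℝ} (hw : HalfTest w) (hφ : HalfTest φ)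

theorem testEnergy_zero : (testEnergy hc h hw hφ).1 0 =ᵐ[mu h] fun p => w p / (c + p.1) :=
  ((hw.div_one hc).memLp_mu h).coeFn_toLp

theorem testEnergy_one : (testEnergy hc h hw hφ).1 1 =ᵐ[mu h] dy w :=
  (hw.dy.memLp_mu h).coeFn_toLp

theorem testEnergy_two : (testEnergy hc h hw hφ).1 2 =ᵐ[mu h] fun p => φ p / (c + p.1 ^ 2) :=
  ((hφ.div_two hc).memLp_mu h).coeFn_toLp

theorem testEnergy_three : (testEnergy hc h hw hφ).1 3 =ᵐ[mu h] dy (dy φ) :=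
  (hφ.dy.dy.memLp_mu h).coeFn_toLp

theorem represents_testEnergy : Represents (testEnergy hc h hw hφ) w φ := by
  constructor
  · filter_upwards [testEnergy_zero hc hw hφ, ae_mem_dom h] with p h1 h2
    simp only [vOf]
    rw [h1, mul_div_cancel₀ _ (weight_one_ne hc p h2.1)]
  · filter_upwards [testEnergy_two hc hw hφ, ae_mem_dom h] with p h1 h2
    simp only [psiOf]
    rw [h1, mul_div_cancel₀ _ (weight_two_ne hc p h2.1)]

theorem norm_sq_testEnergy : ‖testEnergy hc h hw hφ‖ ^ 2 =
    ∫ p, (w p / (c + p.1)) ^ 2 ∂mu h + ∫ p, dy w p ^ 2 ∂mu h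
      + ∫ p, (φ p / (c + p.1 ^ 2)) ^ 2 ∂mu h + ∫ p, dy (dy φ) p ^ 2 ∂mu h := by
  rw [Energy.norm_sq, Fin.sum_univ_four]
  simp only [norm_sq_lp]
  congr 1; congr 1; congr 1
  · exact integral_congr_ae (by
      filter_upwards [testEnergy_zero (h := h) hc hw hφ] with p hp; rw [hp])
  · exact integral_congr_ae (by
      filter_upwards [testEnergy_one (h := h) hc hw hφ] with p hp; rw [hp])
  · exact integral_congr_ae (by
      filter_upwards [testEnergy_two (h := h) hc hw hφ] with p hp; rw [hp])
  · exact integral_congr_ae (by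
      filter_upwards [testEnergy_three (h := h) hc hw hφ] with p hp; rw [hp])

theorem inner_testEnergy (u : Energy c h) : inner ℝ u (testEnergy hc h hw hφ) =
    ∫ p, u.1 0 p * (w p / (c + p.1)) ∂mu h + ∫ p, u.1 1 p * dy w p ∂mu h
      + ∫ p, u.1 2 p * (φ p / (c + p.1 ^ 2)) ∂mu h + ∫ p, u.1 3 p * dy (dy φ) p ∂mu h := by
  rw [Energy.inner_def, Fin.sum_univ_four]
  simp only [inner_lp]
  congr 1; congr 1; congr 1
  · exact integral_congr_ae (by
      filter_upwards [testEnergy_zero (h := h) hc hw hφ] with p hp; rw [hp])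
  · exact integral_congr_ae (by
      filter_upwards [testEnergy_one (h := h) hc hw hφ] with p hp; rw [hp])
  · exact integral_congr_ae (by
      filter_upwards [testEnergy_two (h := h) hc hw hφ] with p hp; rw [hp])
  · exact integral_congr_ae (by
      filter_upwards [testEnergy_three (h := h) hc hw hφ] with p hp; rw [hp])

end testEnergy

/-! ### Completeness -/

theorem continuous_integral_mul {G : ℝ × ℝ → ℝ} (hG : MemLp G 2 (mu h)) :
    Continuous fun x : Lp ℝ 2 (mu h) => ∫ p, x p * G p ∂mu h := by
  have : (fun x : Lp ℝ 2 (mu h) => ∫ p, x p * G p ∂mu h) = fun x => inner ℝ x hG.toLp := by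
    funext x
    rw [inner_lp]
    exact integral_congr_ae (by filter_upwards [hG.coeFn_toLp] with p hp; rw [hp])
  rw [this]
  exact continuous_id.inner continuous_const

theorem isClosed_weakDyRel (n : ℕ) (h : EReal) (a : ℝ × ℝ → ℝ) (ha : Continuous a) :
    IsClosed (weakDyRel n h a ha : Set (Lp ℝ 2 (mu h) × Lp ℝ 2 (mu h))) := by
  have : (weakDyRel n h a ha : Set (Lp ℝ 2 (mu h) × Lp ℝ 2 (mu h))) =
      ⋂ (φ : ℝ × ℝ → ℝ) (_ : IsTest (Dom h) φ), {x | ∫ p, x.1 p * (a p * (dy^[n] φ) p) ∂mu h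
        = (-1) ^ n * ∫ p, x.2 p * φ p ∂mu h} := by
    ext x
    simp only [mem_iInter, mem_ofPred_eq]
    refine forall₂_congr fun φ hφ => ?_
    have : ∀ p, a p * x.1 p * (dy^[n] φ) p = x.1 p * (a p * (dy^[n] φ) p) := fun p => by ring
    simp only [this]; rfl
  rw [this]
  refine isClosed_iInter fun φ => isClosed_iInter fun hφ => isClosed_eq ?_ ?_
  · have hc : HasCompactSupport fun p => a p * (dy^[n] φ) p :=
      (compact_dy_iter hφ.compact n).mul_left
    have hm : MemLp (fun p => a p * (dy^[n] φ) p) 2 (mu h) :=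
      ((ha.mul (smooth_dy_iter hφ.smooth n).continuous).memLp_of_hasCompactSupport hc
        (μ := volume)).restrict _
    exact (continuous_integral_mul hm).comp continuous_fst
  · exact continuous_const.mul
      ((continuous_integral_mul (hφ.memLp.restrict _)).comp continuous_snd)

instance (c : ℝ) (h : EReal) : CompleteSpace (Energy c h) := by
  have hc : IsClosed (energySubmodule c h : Set (PiLp 2 fun _ : Fin 4 => Lp ℝ 2 (mu h))) := by
    have e : ∀ i, Continuous fun U : PiLp 2 (fun _ : Fin 4 => Lp ℝ 2 (mu h)) => U i :=
      fun i => PiLp.continuous_apply 2 _ i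
    exact ((isClosed_weakDyRel 1 h _ _).preimage ((e 0).prodMk (e 1))).inter
      ((isClosed_weakDyRel 2 h _ _).preimage ((e 2).prodMk (e 3)))
  exact hc.completeSpace_coe

end

section

/-! ### Hardy inequalities -/

variable {c : ℝ} {h : EReal}

theorem dy_fst_mul {q : ℝ × ℝ → ℝ} (hq : Differentiable ℝ q) :
    dy (fun p => p.1 * q p) = fun p => q p + p.1 * dy q p := by
  funext ⟨y, z⟩
  refine dy_eq (differentiable_fst.mul hq) ?_
  have := (hasDerivAt_id' y).fun_mul (hasDerivAt_fst hq y z)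
  simpa using this

theorem integral_fst_mul_dy_mul_self {q : ℝ × ℝ → ℝ} (hq : HalfTest q) :
    ∫ p, p.1 * dy q p * q p ∂mu h = -(1 / 2) * ∫ p, q p ^ 2 ∂mu h := by
  have hq2 : HalfTest fun p => q p * q p := hq.mul_left hq.smooth
  have h1 := integral_mu_dy (hq2.mul_left contDiff_fst) h
  rw [dy_fst_mul hq2.differentiable, dy_mul hq.differentiable hq.differentiable] at h1
  have i1 : Integrable (fun p => q p ^ 2) (mu h) := by
    simpa [sq] using hq2.integrable_mu h
  have i2 : Integrable (fun p => p.1 * dy q p * q p) (mu h) := by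
    have := (hq.mul_left (contDiff_fst.mul hq.dy.smooth)).integrable_mu h
    exact this
  have e : ∀ p : ℝ × ℝ, q p * q p + p.1 * (dy q p * q p + q p * dy q p)
      = q p ^ 2 + 2 * (p.1 * dy q p * q p) := fun p => by ring
  simp only [e] at h1
  rw [integral_add i1 (i2.const_mul 2), integral_const_mul] at h1
  linarith

/-- The square of `a q + y ∂_y q` is estimated from below by expanding
`0 ≤ ∫ (a q + y ∂_y q - (a - 1/2) q)²`. -/
theorem hardy_aux {q : ℝ × ℝ → ℝ} (hq : HalfTest q) (a : ℝ) :
    (a - 1 / 2) ^ 2 * ∫ p, q p ^ 2 ∂mu h ≤ ∫ p, (a * q p + p.1 * dy q p) ^ 2 ∂mu h := by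
  have i1 : Integrable (fun p => q p ^ 2) (mu h) := by
    simpa [sq] using (hq.mul_left hq.smooth).integrable_mu h
  have i2 : Integrable (fun p => p.1 * dy q p * q p) (mu h) :=
    (hq.mul_left (contDiff_fst.mul hq.dy.smooth)).integrable_mu h
  have i3 : Integrable (fun p => (p.1 * dy q p) ^ 2) (mu h) := by
    have := ((hq.dy.mul_left contDiff_fst).mul_left
      (contDiff_fst.mul hq.dy.smooth)).integrable_mu h
    simpa [sq] using this
  have e : ∀ p : ℝ × ℝ, (a * q p + p.1 * dy q p) ^ 2
      = a ^ 2 * q p ^ 2 + 2 * a * (p.1 * dy q p * q p) + (p.1 * dy q p) ^ 2 := fun p => by ring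
  have e' : ∀ p : ℝ × ℝ, (1 / 2 * q p + p.1 * dy q p) ^ 2
      = (1 / 2) ^ 2 * q p ^ 2 + p.1 * dy q p * q p + (p.1 * dy q p) ^ 2 := fun p => by ring
  have h0 : 0 ≤ ∫ p, (1 / 2 * q p + p.1 * dy q p) ^ 2 ∂mu h :=
    integral_nonneg fun p => sq_nonneg _
  simp only [e]
  simp only [e'] at h0
  rw [integral_add ((i1.const_mul _).fun_add i2) i3, integral_add (i1.const_mul _) i2,
    integral_const_mul, integral_fst_mul_dy_mul_self hq] at h0
  rw [integral_add ((i1.const_mul _).fun_add (i2.const_mul _)) i3,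
    integral_add (i1.const_mul _) (i2.const_mul _),
    integral_const_mul, integral_const_mul, integral_fst_mul_dy_mul_self hq]
  nlinarith

theorem IsTest.eq_fst_mul {w : ℝ × ℝ → ℝ} (hw : HalfTest w) :
    w = fun p => p.1 * (w p / (0 + p.1)) := by
  funext p
  by_cases hp : 0 < p.1
  · rw [zero_add, mul_div_cancel₀ _ hp.ne']
  · rw [hw.eq_zero (x := p) hp]; simp

/-- Hardy's inequality for `w = y q`, where `q = w / y` is again a test. -/
theorem hardy_one {w : ℝ × ℝ → ℝ} (hw : HalfTest w) :
    ∫ p, (w p / (0 + p.1)) ^ 2 ∂mu h ≤ 4 * ∫ p, dy w p ^ 2 ∂mu h := by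
  have hq := hw.div_one le_rfl
  have h1 := hardy_aux (h := h) hq 1
  have e : dy w = fun p => w p / (0 + p.1) + p.1 * dy (fun p => w p / (0 + p.1)) p := by
    conv_lhs => rw [hw.eq_fst_mul]
    rw [dy_fst_mul hq.differentiable]
  have e2 : ∫ p, dy w p ^ 2 ∂mu h = ∫ p, (1 * (w p / (0 + p.1))
      + p.1 * dy (fun p => w p / (0 + p.1)) p) ^ 2 ∂mu h := by
    rw [e]; simp
  rw [e2]
  linarith

/-- Rellich's inequality, from `hardy_aux` for `q = φ / y²` and `hardy_one` for `∂_y φ`. -/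
theorem hardy_two {φ : ℝ × ℝ → ℝ} (hφ : HalfTest φ) :
    ∫ p, (φ p / (0 + p.1 ^ 2)) ^ 2 ∂mu h ≤ 2 * ∫ p, dy (dy φ) p ^ 2 ∂mu h := by
  have hq := hφ.div_two (c := 0) le_rfl
  set q : ℝ × ℝ → ℝ := fun p => φ p / (0 + p.1 ^ 2) with hqd
  have h1 := hardy_aux (h := h) hq 2
  have h2 := hardy_one (h := h) hφ.dy
  have e : φ = fun p => p.1 * (p.1 * q p) := by
    funext p
    by_cases hp : 0 < p.1
    · simp only [hqd]; field_simp; simp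
    · simp only [hqd]; rw [hφ.eq_zero (x := p) hp]; simp
  have e2 : ∫ p, (dy φ p / (0 + p.1)) ^ 2 ∂mu h
      = ∫ p, (2 * q p + p.1 * dy q p) ^ 2 ∂mu h := by
    refine integral_congr_ae ?_
    filter_upwards [ae_mem_dom h] with p hp
    have hp1 : p.1 ≠ 0 := ne_of_gt hp.1
    rw [e, dy_fst_mul (differentiable_fst.fun_mul hq.differentiable), dy_fst_mul hq.differentiable]
    rw [zero_add]
    congr 1
    field_simp
    ring
  rw [e2] at h2
  have h3 : 0 ≤ ∫ p, dy (dy φ) p ^ 2 ∂mu h := integral_nonneg fun p => sq_nonneg _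
  change ∫ p, q p ^ 2 ∂mu h ≤ _
  linarith

/-- On pairs of tests the norm of `E_{0,0}` is controlled by `‖∂_y w‖` and `‖∂_y² φ‖`. -/
theorem norm_sq_testEnergy_le {w φ : ℝ × ℝ → ℝ} (hw : HalfTest w) (hφ : HalfTest φ) :
    ‖testEnergy le_rfl h hw hφ‖ ^ 2
      ≤ 5 * (∫ p, dy w p ^ 2 ∂mu h + ∫ p, dy (dy φ) p ^ 2 ∂mu h) := by
  rw [norm_sq_testEnergy]
  have h1 := hardy_one (h := h) hw
  have h2 := hardy_two (h := h) hφ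
  have h3 : 0 ≤ ∫ p, dy (dy φ) p ^ 2 ∂mu h := integral_nonneg fun p => sq_nonneg _
  linarith

end

section

/-! ### Existence of weak solutions -/

/-- A form of the Lax–Milgram–Lions theorem: a functional `S` with `|S x| ≤ C ‖R x‖` is represented
as `S x = ⟪u, R x⟫` with `‖u‖ ≤ C`. -/
theorem exists_inner_eq_of_le {M E : Type*} [AddCommGroup M] [Module ℝ M] [NormedAddCommGroup E]
    [InnerProductSpace ℝ E] [CompleteSpace E] (R : M →ₗ[ℝ] E) (S : M →ₗ[ℝ] ℝ) {C : ℝ}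
    (hC : 0 ≤ C) (hS : ∀ m, |S m| ≤ C * ‖R m‖) :
    ∃ u : E, ‖u‖ ≤ C ∧ ∀ m, S m = inner ℝ u (R m) := by
  have hker : LinearMap.ker R ≤ LinearMap.ker S := fun m hm => by
    have := hS m
    rw [LinearMap.mem_ker.1 hm, norm_zero, mul_zero] at this
    exact LinearMap.mem_ker.2 (abs_nonpos_iff.1 this)
  let f₀ : LinearMap.range R →ₗ[ℝ] ℝ :=
    ((LinearMap.ker R).liftQ S hker).comp R.quotKerEquivRange.symm.toLinearMap
  have hf₀ : ∀ m, f₀ ⟨R m, LinearMap.mem_range_self R m⟩ = S m := fun m => by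
    have : R.quotKerEquivRange.symm ⟨R m, LinearMap.mem_range_self R m⟩
        = (LinearMap.ker R).mkQ m := by
      rw [LinearEquiv.symm_apply_eq]
      exact Subtype.ext (by simp)
    simp only [f₀, LinearMap.comp_apply, LinearEquiv.coe_coe, this]
    simp
  let f : StrongDual ℝ (LinearMap.range R) := f₀.mkContinuous C (by
    rintro ⟨_, m, rfl⟩
    rw [hf₀ m]
    exact hS m)
  obtain ⟨g, hg, hgn⟩ := exists_extension_norm_eq (LinearMap.range R) f
  refine ⟨(InnerProductSpace.toDual ℝ E).symm g, ?_, fun m => ?_⟩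
  · rw [LinearIsometryEquiv.norm_map, hgn]
    exact LinearMap.mkContinuous_norm_le _ hC _
  · rw [InnerProductSpace.toDual_symm_apply, ← hf₀ m]
    exact (hg ⟨R m, LinearMap.mem_range_self R m⟩).symm

variable {c : ℝ} {h : EReal}

/-- The components of the four-tuple of `L²` functions that encodes an element. -/
def coord (c : ℝ) (h : EReal) (i : Fin 4) : Energy c h →L[ℝ] Lp ℝ 2 (mu h) :=
  (PiLp.proj 2 (fun _ : Fin 4 => Lp ℝ 2 (mu h)) i : _ →L[ℝ] _).comp
    (energySubmodule c h).subtypeL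

theorem coord_apply (i : Fin 4) (u : Energy c h) : coord c h i u = u.1 i := rfl

/-- The functional `e ↦ ∫ e_i G` for an `L²` function `G`. -/
def coordPair (c : ℝ) (h : EReal) (i : Fin 4) {G : ℝ × ℝ → ℝ} (hG : MemLp G 2 (mu h)) :
    StrongDual ℝ (Energy c h) :=
  (innerSL ℝ hG.toLp).comp (coord c h i)

theorem coordPair_apply (i : Fin 4) {G : ℝ × ℝ → ℝ} (hG : MemLp G 2 (mu h)) (u : Energy c h) :
    coordPair c h i hG u = ∫ p, u.1 i p * G p ∂mu h := by
  change inner ℝ hG.toLp (u.1 i) = _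
  rw [inner_lp]
  exact integral_congr_ae (by filter_upwards [hG.coeFn_toLp] with p hp; rw [hp, mul_comm])

theorem vOf_mul_integrable (u : Energy c h) {G : ℝ × ℝ → ℝ} {Q : Set (ℝ × ℝ)} (hG : IsTest Q G) :
    Integrable (fun p => vOf u p * G p) (mu h) :=
  pair_integrable h (a := fun p => c + p.1) (by fun_prop) hG.continuous hG.compact (u.1 0)

theorem psiOf_mul_integrable (u : Energy c h) {G : ℝ × ℝ → ℝ} {Q : Set (ℝ × ℝ)}
    (hG : IsTest Q G) : Integrable (fun p => psiOf u p * G p) (mu h) :=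
  pair_integrable h (a := fun p => c + p.1 ^ 2) (by fun_prop) hG.continuous hG.compact (u.1 2)

/-- The functional `T (w, φ)` on the energy space, for smooth `w` and `φ`. -/
def transportDual (c : ℝ) (h : EReal) {w φ : ℝ × ℝ → ℝ} (hw : HalfTest w) (hφ : HalfTest φ) :
    StrongDual ℝ (Energy c h) :=
  coordPair c h 0 ((hφ.transport.mul_left
      (g := fun p : ℝ × ℝ => c + p.1) (contDiff_const.add contDiff_fst)).memLp_mu h)
    + coordPair c h 2 ((hw.transport.mul_left
      (g := fun p : ℝ × ℝ => c + p.1 ^ 2) (contDiff_const.add (contDiff_fst.pow 2))).memLp_mu h)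

theorem transportDual_apply {w φ : ℝ × ℝ → ℝ} (hw : HalfTest w) (hφ : HalfTest φ)
    (u : Energy c h) : transportDual c h hw hφ u
      = ∫ p, vOf u p * transport φ p ∂mu h + ∫ p, psiOf u p * transport w p ∂mu h := by
  simp only [transportDual, add_apply, coordPair_apply]
  congr 1 <;> refine integral_congr_ae (Eventually.of_forall fun p => ?_) <;>
    simp only [vOf, psiOf] <;> ring

/-- The pair `(ϖ, Tϖ)` belongs to `E_1` for every pair `ϖ` of tests of `y > 0`. -/
theorem mem_E1_of_test {w φ : ℝ × ℝ → ℝ} (hw : HalfTest w) (hφ : HalfTest φ) :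
    (WithLp.toLp 1 (testEnergy le_rfl h hw hφ, transportDual 0 h hw hφ) : WithDual (E00 h))
      ∈ E1 h := by
  intro f g hf hg e he
  have hr := represents_testEnergy (h := h) le_rfl hw hφ
  change transportDual 0 h hw hφ e = _
  rw [transportDual_apply]
  have e1 : ∫ p, vOf e p * transport φ p ∂mu h = -∫ p, φ p * transport f p ∂mu h := by
    rw [integral_mu_mul_transport hφ.smooth hf, neg_neg]
    exact integral_congr_ae (by filter_upwards [he.1] with p hp; rw [hp, mul_comm])
  have e2 : ∫ p, psiOf e p * transport w p ∂mu h = -∫ p, w p * transport g p ∂mu h := by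
    rw [integral_mu_mul_transport hw.smooth hg, neg_neg]
    exact integral_congr_ae (by filter_upwards [he.2] with p hp; rw [hp, mul_comm])
  rw [e1, e2, ← sub_eq_add_neg]
  congr 1
  · congr 1
    exact integral_congr_ae (by
      filter_upwards [hr.2] with p hp; rw [← hp]; rfl)
  · exact integral_congr_ae (by
      filter_upwards [hr.1] with p hp; rw [← hp]; rfl)

/-- The element `(ϖ, Tϖ)` of `E_1` for a pair `ϖ` of tests of `y > 0`. -/
def testE1 (h : EReal) {w φ : ℝ × ℝ → ℝ} (hw : HalfTest w) (hφ : HalfTest φ) : E1 h :=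
  ⟨_, mem_E1_of_test hw hφ⟩

theorem represents_testE1 {w φ : ℝ × ℝ → ℝ} (hw : HalfTest w) (hφ : HalfTest φ) :
    Represents (testE1 h hw hφ).1.fst w φ :=
  represents_testEnergy le_rfl hw hφ

theorem testE1_snd {w φ : ℝ × ℝ → ℝ} (hw : HalfTest w) (hφ : HalfTest φ) (e : E00 h) :
    (testE1 h hw hφ).1.snd e
      = ∫ p, vOf e p * transport φ p ∂mu h + ∫ p, psiOf e p * transport w p ∂mu h :=
  transportDual_apply hw hφ e

theorem Represents.add {u u' : Energy c h} {f g f' g' : ℝ × ℝ → ℝ}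
    (hu : Represents u f g) (hu' : Represents u' f' g') :
    Represents (u + u') (fun p => f p + f' p) (fun p => g p + g' p) := by
  constructor
  · filter_upwards [hu.1, hu'.1, Lp.coeFn_add (u.1 0) (u'.1 0)] with p h1 h2 h3
    change (c + p.1) * (u.1 0 + u'.1 0) p = _
    rw [h3, ← h1, ← h2, Pi.add_apply, mul_add]; rfl
  · filter_upwards [hu.2, hu'.2, Lp.coeFn_add (u.1 2) (u'.1 2)] with p h1 h2 h3
    change (c + p.1 ^ 2) * (u.1 2 + u'.1 2) p = _
    rw [h3, ← h1, ← h2, Pi.add_apply, mul_add]; rfl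

theorem Represents.smul {u : Energy c h} {f g : ℝ × ℝ → ℝ} (hu : Represents u f g) (r : ℝ) :
    Represents (r • u) (fun p => r * f p) (fun p => r * g p) := by
  constructor
  · filter_upwards [hu.1, Lp.coeFn_smul r (u.1 0)] with p h1 h3
    change (c + p.1) * (r • u.1 0) p = _
    rw [h3, ← h1, Pi.smul_apply, smul_eq_mul]; simp only [vOf]; ring
  · filter_upwards [hu.2, Lp.coeFn_smul r (u.1 2)] with p h1 h3
    change (c + p.1 ^ 2) * (r • u.1 2) p = _
    rw [h3, ← h1, Pi.smul_apply, smul_eq_mul]; simp only [psiOf]; ring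

theorem Represents.zero : Represents (0 : Energy c h) (fun _ => 0) (fun _ => 0) := by
  have := (represents_testEnergy (c := 0) (h := h) le_rfl IsTest.zero IsTest.zero)
  constructor
  · filter_upwards [Lp.coeFn_zero ℝ 2 (mu h)] with p h1
    change (c + p.1) * (0 : Lp ℝ 2 (mu h)) p = 0
    rw [h1]; simp
  · filter_upwards [Lp.coeFn_zero ℝ 2 (mu h)] with p h1
    change (c + p.1 ^ 2) * (0 : Lp ℝ 2 (mu h)) p = 0
    rw [h1]; simp

/-! ### The adjoint relation at the upper boundary -/

theorem hFn_memLp (f : HHalf) : MemLp (hFn f) 2 (volume.restrict (Ioi (0 : ℝ))) := by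
  refine (Lp.memLp f.1.fst).mono ?_ ?_
  · have : AEStronglyMeasurable (fun y : ℝ => (√(1 + 1 / y))⁻¹) (volume.restrict (Ioi (0 : ℝ))) :=
      (by fun_prop : Measurable fun y : ℝ => (√(1 + 1 / y))⁻¹).aestronglyMeasurable
    exact ((Lp.memLp f.1.fst).1.mul this).congr (Eventually.of_forall fun y => by
      simp [hFn, unweight, div_eq_mul_inv])
  · filter_upwards [ae_restrict_mem measurableSet_Ioi] with y hy
    have hy : (0 : ℝ) < y := hy
    simp only [hFn, unweight, norm_div, Real.norm_eq_abs]
    refine div_le_self (abs_nonneg _) ?_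
    rw [abs_of_nonneg (Real.sqrt_nonneg _), Real.one_le_sqrt]
    have : 0 ≤ 1 / y := by positivity
    linarith

theorem HIs.add {f f' : HHalf} {g g' : ℝ → ℝ} (hf : HIs f g) (hf' : HIs f' g') :
    HIs (f + f') (fun y => g y + g' y) := by
  filter_upwards [hf, hf', Lp.coeFn_add f.1.fst f'.1.fst] with y h1 h2 h3
  change (f.1.fst + f'.1.fst) y / _ = _
  rw [h3, ← h1, ← h2, Pi.add_apply, add_div]; rfl

theorem HIs.smul {f : HHalf} {g : ℝ → ℝ} (hf : HIs f g) (r : ℝ) :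
    HIs (r • f) (fun y => r * g y) := by
  filter_upwards [hf, Lp.coeFn_smul r f.1.fst] with y h1 h3
  change (r • f.1.fst) y / _ = _
  rw [h3, ← h1, Pi.smul_apply, smul_eq_mul, mul_div_assoc]; rfl

theorem HIs.zero : HIs 0 (fun _ => 0) := by
  filter_upwards [Lp.coeFn_zero ℝ 2 (volume.restrict (Ioi (0 : ℝ)))] with y h1
  change (0 : Lp ℝ 2 _) y / _ = _
  rw [h1]; simp

theorem AdjointEq.add {Λ : HHalf →L[ℝ] StrongDual ℝ HHalf} {g k g' k' : ℝ → ℝ}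
    (h1 : AdjointEq Λ g k) (h2 : AdjointEq Λ g' k')
    (hk : MemLp k 2 (volume.restrict (Ioi (0 : ℝ))))
    (hk' : MemLp k' 2 (volume.restrict (Ioi (0 : ℝ)))) :
    AdjointEq Λ (fun y => g y + g' y) (fun y => k y + k' y) := by
  obtain ⟨G, hG, e⟩ := h1
  obtain ⟨G', hG', e'⟩ := h2
  refine ⟨G + G', hG.add hG', fun f => ?_⟩
  rw [map_add, add_apply, e, e']
  refine (integral_add (hk.integrable_mul (hFn_memLp f))
    (hk'.integrable_mul (hFn_memLp f))).symm.trans ?_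
  refine integral_congr_ae (Eventually.of_forall fun y => ?_)
  simp only [Pi.mul_apply]; ring

theorem AdjointEq.smul {Λ : HHalf →L[ℝ] StrongDual ℝ HHalf} {g k : ℝ → ℝ}
    (h1 : AdjointEq Λ g k) (r : ℝ) : AdjointEq Λ (fun y => r * g y) (fun y => r * k y) := by
  obtain ⟨G, hG, e⟩ := h1
  refine ⟨r • G, hG.smul r, fun f => ?_⟩
  rw [map_smul, smul_apply, e, smul_eq_mul, ← integral_const_mul]
  refine integral_congr_ae (Eventually.of_forall fun y => ?_)
  simp only; ring

theorem AdjointEq.zero (Λ : HHalf →L[ℝ] StrongDual ℝ HHalf) :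
    AdjointEq Λ (fun _ => 0) (fun _ => 0) :=
  ⟨0, HIs.zero, fun f => by simp⟩

theorem IsTest.slice_memLp {Q : Set (ℝ × ℝ)} {f : ℝ × ℝ → ℝ} (hf : IsTest Q f) (z : ℝ) :
    MemLp (fun y => f (y, z)) 2 (volume.restrict (Ioi (0 : ℝ))) :=
  ((hf.continuous.comp (by fun_prop : Continuous fun y : ℝ => (y, z))).memLp_of_hasCompactSupport
    (hasCompactSupport_slice_fst hf.compact z)).restrict _

namespace Problem.IsTestPair

variable {P : Problem} {w φ w' φ' : ℝ × ℝ → ℝ}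

theorem phi_half (hp : P.IsTestPair w φ) : HalfTest φ := hp.phi_test.mono fun _ h => h.1

theorem add (hp : P.IsTestPair w φ) (hp' : P.IsTestPair w' φ') :
    P.IsTestPair (fun p => w p + w' p) (fun p => φ p + φ' p) := by
  refine ⟨hp.w_test.add hp'.w_test, hp.phi_test.add hp'.phi_test, ?_⟩
  have h1 := hp.top
  have h2 := hp'.top
  cases P with
  | quarterPlane => trivial
  | strip H hH Λ hΛ =>
    have := AdjointEq.add h1 h2 (hp.phi_test.slice_memLp H).neg (hp'.phi_test.slice_memLp H).neg
    simp only [Problem.TopCondition, neg_add]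
    exact this

theorem smul (hp : P.IsTestPair w φ) (r : ℝ) :
    P.IsTestPair (fun p => r * w p) (fun p => r * φ p) := by
  refine ⟨hp.w_test.const_mul r, hp.phi_test.const_mul r, ?_⟩
  have h1 := hp.top
  cases P with
  | quarterPlane => trivial
  | strip H hH Λ hΛ =>
    have := AdjointEq.smul h1 r
    simp only [Problem.TopCondition, ← mul_neg]
    exact this

theorem zero (P : Problem) : P.IsTestPair (fun _ => 0) (fun _ => 0) := by
  refine ⟨IsTest.zero, IsTest.zero, ?_⟩
  cases P with
  | quarterPlane => trivial
  | strip H hH Λ hΛ =>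
    simp only [Problem.TopCondition, neg_zero]
    exact AdjointEq.zero Λ

/-- The boundary term of the energy identity has a sign: `∫ T(wφ) = -⟨Λ w, w⟩ ≥ 0` at `z = H`. -/
theorem integral_transport_nonneg (hp : P.IsTestPair w φ) :
    0 ≤ ∫ p, transport (fun p => w p * φ p) p ∂mu P.height := by
  have hG : IsTest {p : ℝ × ℝ | 0 < p.1 ∧ 0 < p.2} (fun p => w p * φ p) :=
    hp.phi_test.mul_left hp.w_test.smooth
  rw [integral_mu_transport (hG.mono fun _ h => h.1)]
  have h1 := hp.top
  cases P with
  | quarterPlane => exact (integral_mu_dz_top hG).ge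
  | strip H hH Λ hΛ =>
    refine le_of_le_of_eq ?_ (integral_mu_dz_coe hG hH).symm
    obtain ⟨G, hG, e⟩ := h1
    have e1 := e G
    have e2 : ∫ y in Ioi (0 : ℝ), -φ (y, H) * hFn G y = -∫ y in Ioi (0 : ℝ), w (y, H) * φ (y, H) := by
      rw [← integral_neg]
      exact integral_congr_ae (by filter_upwards [hG] with y hy; rw [hy]; ring)
    rw [e2, ContinuousLinearMap.flip_apply] at e1
    have := hΛ G
    linarith

end Problem.IsTestPair

/-- The elements of `E_1` given by the test pairs of a problem. -/
def Problem.testSubmodule (P : Problem) : Submodule ℝ (E1 P.height) where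
  carrier := {x | ∃ w φ, P.IsTestPair w φ ∧ Represents x.1.fst w φ ∧
    ∀ e, x.1.snd e = ∫ p, vOf e p * transport φ p ∂mu P.height
      + ∫ p, psiOf e p * transport w p ∂mu P.height}
  add_mem' := by
    rintro x x' ⟨w, φ, hp, hr, hs⟩ ⟨w', φ', hp', hr', hs'⟩
    refine ⟨_, _, hp.add hp', hr.add hr', fun e => ?_⟩
    change x.1.snd e + x'.1.snd e = _
    rw [hs, hs']
    have a1 : transport (fun p => φ p + φ' p) = fun p => transport φ p + transport φ' p := by
      funext p
      simp only [transport, dy_add hp.phi_test.differentiable hp'.phi_test.differentiable,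
        dz_add hp.phi_test.differentiable hp'.phi_test.differentiable]; ring
    have a2 : transport (fun p => w p + w' p) = fun p => transport w p + transport w' p := by
      funext p
      simp only [transport, dy_add hp.w_test.differentiable hp'.w_test.differentiable,
        dz_add hp.w_test.differentiable hp'.w_test.differentiable]; ring
    simp only [a1, a2, mul_add]
    rw [integral_add (vOf_mul_integrable e hp.phi_test.transport)
      (vOf_mul_integrable e hp'.phi_test.transport),
      integral_add (psiOf_mul_integrable e hp.w_test.transport)
      (psiOf_mul_integrable e hp'.w_test.transport)]
    ring
  zero_mem' := by
    refine ⟨_, _, Problem.IsTestPair.zero P, Represents.zero, fun e => ?_⟩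
    simp only [transport_zero, mul_zero, integral_zero, add_zero]
    rfl
  smul_mem' := by
    rintro r x ⟨w, φ, hp, hr, hs⟩
    refine ⟨_, _, hp.smul r, hr.smul r, fun e => ?_⟩
    change r * x.1.snd e = _
    rw [hs]
    have a1 : transport (fun p => r * φ p) = fun p => r * transport φ p := by
      funext p
      simp only [transport, dy_const_mul hp.phi_test.differentiable,
        dz_const_mul hp.phi_test.differentiable]; ring
    have a2 : transport (fun p => r * w p) = fun p => r * transport w p := by
      funext p
      simp only [transport, dy_const_mul hp.w_test.differentiable,
        dz_const_mul hp.w_test.differentiable]; ring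
    simp only [a1, a2, mul_left_comm _ r, integral_const_mul]
    ring

/-- The weak form in terms of the transport operator and of the encoding of `u` by four functions. -/
theorem weakForm_eq (u : Energy c h) {w φ : ℝ × ℝ → ℝ} (hw : HalfTest w) (hφ : HalfTest φ) :
    weakForm u w φ = -(∫ p, vOf u p * transport φ p ∂mu h + ∫ p, psiOf u p * transport w p ∂mu h)
      - 1 / 2 * (∫ p, u.1 1 p * dy w p ∂mu h + ∫ p, u.1 3 p * dy (dy φ) p ∂mu h) := by
  have e1 : ∀ p : ℝ × ℝ, -(vOf u p * dz φ p) - p.2 * vOf u p * dy φ p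
      - 1 / 2 * dyypsiOf u p * dy (dy φ) p
      = -(vOf u p * transport φ p) - 1 / 2 * (u.1 3 p * dy (dy φ) p) := fun p => by
    simp only [transport, dyypsiOf]; ring
  have e2 : ∀ p : ℝ × ℝ, -(psiOf u p * dz w p) - p.2 * psiOf u p * dy w p
      - 1 / 2 * dyvOf u p * dy w p
      = -(psiOf u p * transport w p) - 1 / 2 * (u.1 1 p * dy w p) := fun p => by
    simp only [transport, dyvOf]; ring
  simp only [weakForm, e1, e2]
  have i1 : Integrable (fun p => -(vOf u p * transport φ p)) (mu h) :=
    (vOf_mul_integrable u hφ.transport).neg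
  have i2 : Integrable (fun p => -(psiOf u p * transport w p)) (mu h) :=
    (psiOf_mul_integrable u hw.transport).neg
  have i3 : Integrable (fun p => u.1 3 p * dy (dy φ) p) (mu h) :=
    integrable_mul_test (u.memLp 3) hφ.dy.dy
  have i4 : Integrable (fun p => u.1 1 p * dy w p) (mu h) :=
    integrable_mul_test (u.memLp 1) hw.dy
  rw [integral_sub i1 (i3.const_mul _), integral_sub i2 (i4.const_mul _), integral_neg, integral_neg, integral_const_mul, integral_const_mul]
  ring

/-- The energy inequality for test pairs: the transport terms combine to `-∫ T(wφ) ≤ 0`, and the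
diffusion terms control the norm by Hardy's inequality. -/
theorem weakForm_testEnergy_le {P : Problem} {w φ : ℝ × ℝ → ℝ} (hp : P.IsTestPair w φ) :
    weakForm (testEnergy le_rfl P.height hp.w_test hp.phi_half) w φ
      ≤ -(1 / 10) * ‖testEnergy le_rfl P.height hp.w_test hp.phi_half‖ ^ 2 := by
  have h0 := norm_sq_testEnergy_le (h := P.height) hp.w_test hp.phi_half
  have hr := represents_testEnergy (h := P.height) le_rfl hp.w_test hp.phi_half
  have h1 := hp.integral_transport_nonneg
  rw [weakForm_eq _ hp.w_test hp.phi_half]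
  have e1 : ∫ p, vOf (testEnergy le_rfl P.height hp.w_test hp.phi_half) p * transport φ p
      ∂mu P.height = ∫ p, w p * transport φ p ∂mu P.height :=
    integral_congr_ae (by filter_upwards [hr.1] with p hp; rw [hp])
  have e2 : ∫ p, psiOf (testEnergy le_rfl P.height hp.w_test hp.phi_half) p * transport w p
      ∂mu P.height = ∫ p, transport w p * φ p ∂mu P.height :=
    integral_congr_ae (by filter_upwards [hr.2] with p hp; rw [hp, mul_comm])
  have e3 : ∫ p, (testEnergy le_rfl P.height hp.w_test hp.phi_half).1 1 p * dy w p ∂mu P.height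
      = ∫ p, dy w p ^ 2 ∂mu P.height :=
    integral_congr_ae (by
      filter_upwards [testEnergy_one le_rfl hp.w_test hp.phi_half] with p hp; rw [hp, sq])
  have e4 : ∫ p, (testEnergy le_rfl P.height hp.w_test hp.phi_half).1 3 p * dy (dy φ) p
      ∂mu P.height = ∫ p, dy (dy φ) p ^ 2 ∂mu P.height :=
    integral_congr_ae (by
      filter_upwards [testEnergy_three le_rfl hp.w_test hp.phi_half] with p hp; rw [hp, sq])
  rw [transport_mul hp.w_test.differentiable hp.phi_test.differentiable,
    integral_add ((hp.phi_half.mul_left hp.w_test.transport.smooth).integrable_mu _)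
      ((hp.phi_half.transport.mul_left hp.w_test.smooth).integrable_mu _)] at h1
  rw [e1, e2, e3, e4]
  linarith

/-- The operator on `E_{0,0}` with `⟪A e, u⟫ = ∫ ∂_y v_e ∂_y v_u + ∫ ∂_y² ψ_e ∂_y² ψ_u`. -/
def diffusion (c : ℝ) (h : EReal) : Energy c h →L[ℝ] Energy c h :=
  (coord c h 1).adjoint.comp (coord c h 1) + (coord c h 3).adjoint.comp (coord c h 3)

theorem inner_diffusion (e u : Energy c h) :
    inner ℝ (diffusion c h e) u = ∫ p, u.1 1 p * e.1 1 p ∂mu h + ∫ p, u.1 3 p * e.1 3 p ∂mu h := by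
  simp only [diffusion, add_apply, inner_add_left,
    ContinuousLinearMap.comp_apply, ContinuousLinearMap.adjoint_inner_left, coord_apply, inner_lp]
  congr 1 <;> exact integral_congr_ae (Eventually.of_forall fun p => mul_comm _ _)

theorem norm_diffusion_le (e : Energy c h) : ‖diffusion c h e‖ ≤ 2 * ‖e‖ := by
  by_contra! hlt
  have h1 : ‖diffusion c h e‖ ^ 2 ≤ 2 * ‖e‖ * ‖diffusion c h e‖ := by
    rw [← real_inner_self_eq_norm_sq]
    nth_rewrite 1 [diffusion]
    simp only [add_apply, inner_add_left,
      ContinuousLinearMap.comp_apply, ContinuousLinearMap.adjoint_inner_left, coord_apply]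
    have a : ∀ i, inner ℝ (e.1 i) ((diffusion c h e).1 i) ≤ ‖e‖ * ‖diffusion c h e‖ := fun i =>
      (real_inner_le_norm _ _).trans (mul_le_mul (e.norm_apply_le i) (Energy.norm_apply_le _ i)
        (norm_nonneg _) (norm_nonneg _))
    linarith [a 1, a 3]
  have h2 : 0 ≤ ‖e‖ := norm_nonneg e
  nlinarith

/-- The element of `E_{0,0}` that represents `u ↦ weakForm u w φ`, as a linear function of the
element of `E_1` given by `(w, φ)`. -/
def formVector (h : EReal) : WithDual (E00 h) →ₗ[ℝ] E00 h where
  toFun x := -(InnerProductSpace.toDual ℝ (E00 h)).symm x.snd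
    - (1 / 2 : ℝ) • diffusion 0 h x.fst
  map_add' x x' := by
    change -(InnerProductSpace.toDual ℝ (E00 h)).symm (x.snd + x'.snd)
      - (1 / 2 : ℝ) • diffusion 0 h (x.fst + x'.fst) = _
    rw [map_add, map_add, smul_add]; abel
  map_smul' r x := by
    change -(InnerProductSpace.toDual ℝ (E00 h)).symm (r • x.snd)
      - (1 / 2 : ℝ) • diffusion 0 h (r • x.fst) = _
    rw [map_smulₛₗ, map_smul, RingHom.id_apply]
    simp only [conj_trivial]
    module

theorem inner_formVector {P : Problem} {x : E1 P.height} {w φ : ℝ × ℝ → ℝ}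
    (hp : P.IsTestPair w φ) (hr : Represents x.1.fst w φ)
    (hs : ∀ e, x.1.snd e = ∫ p, vOf e p * transport φ p ∂mu P.height
      + ∫ p, psiOf e p * transport w p ∂mu P.height) (u : E00 P.height) :
    inner ℝ u (formVector P.height x.1) = weakForm u w φ := by
  have he : x.1.fst = testEnergy le_rfl P.height hp.w_test hp.phi_half :=
    hr.unique le_rfl (represents_testEnergy _ _ _)
  rw [real_inner_comm, weakForm_eq u hp.w_test hp.phi_half, ← hs]
  change inner ℝ (-(InnerProductSpace.toDual ℝ (E00 P.height)).symm x.1.snd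
    - (1 / 2 : ℝ) • diffusion 0 P.height x.1.fst) u = _
  rw [inner_sub_left, inner_neg_left, InnerProductSpace.toDual_symm_apply, inner_smul_left,
    inner_diffusion, he]
  congr 2
  congr 1
  · exact integral_congr_ae (by
      filter_upwards [testEnergy_one le_rfl hp.w_test hp.phi_half] with p hp; rw [hp])
  · exact integral_congr_ae (by
      filter_upwards [testEnergy_three le_rfl hp.w_test hp.phi_half] with p hp; rw [hp])

/-- The inf-sup condition: on test pairs, the norm of `E_1` is controlled by the norm of
`u ↦ weakForm u w φ`. -/
theorem norm_le_formVector {P : Problem} {x : E1 P.height} (hx : x ∈ P.testSubmodule) :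
    ‖x‖ ≤ 21 * ‖formVector P.height x.1‖ := by
  obtain ⟨w, φ, hp, hr, hs⟩ := hx
  have he : x.1.fst = testEnergy le_rfl P.height hp.w_test hp.phi_half :=
    hr.unique le_rfl (represents_testEnergy _ _ _)
  have h1 := weakForm_testEnergy_le hp
  rw [← he, ← inner_formVector hp hr hs] at h1
  have h2 := abs_real_inner_le_norm x.1.fst (formVector P.height x.1)
  have h3 : ‖x.1.fst‖ ≤ 10 * ‖formVector P.height x.1‖ := by
    have h4 := neg_abs_le (inner ℝ x.1.fst (formVector P.height x.1))
    by_contra! hlt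
    have h5 : 0 ≤ ‖formVector P.height x.1‖ := norm_nonneg _
    nlinarith
  have h4 : ‖x.1.snd‖ ≤ ‖formVector P.height x.1‖ + ‖x.1.fst‖ := by
    rw [← LinearIsometryEquiv.norm_map (InnerProductSpace.toDual ℝ (E00 P.height)).symm]
    have e : (InnerProductSpace.toDual ℝ (E00 P.height)).symm x.1.snd
        = -(formVector P.height x.1 + (1 / 2 : ℝ) • diffusion 0 P.height x.1.fst) := by
      change _ = -((-(InnerProductSpace.toDual ℝ (E00 P.height)).symm x.1.snd
        - (1 / 2 : ℝ) • diffusion 0 P.height x.1.fst)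
        + (1 / 2 : ℝ) • diffusion 0 P.height x.1.fst)
      abel
    rw [e, norm_neg]
    refine (norm_add_le _ _).trans ?_
    rw [norm_smul]
    have := norm_diffusion_le x.1.fst
    norm_num
    linarith
  have h5 : ‖x‖ = ‖x.1.fst‖ + ‖x.1.snd‖ := WithDual.norm_def x.1
  linarith

/-- Existence: on test pairs `|s x| ≤ ‖s‖ ‖x‖ ≤ 21 ‖s‖ ‖formVector x‖`, so that the functional
`formVector x ↦ s x` is represented by an element of `E_{0,0}`. -/
theorem exists_weakSolution (P : Problem) (s : StrongDual ℝ (E1 P.height)) :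
    ∃ u : E00 P.height, P.IsWeakSolution s u ∧ ‖u‖ ≤ 21 * ‖s‖ := by
  obtain ⟨u, hu, hs⟩ := exists_inner_eq_of_le
    ((formVector P.height).comp ((E1 P.height).subtype.comp P.testSubmodule.subtype))
    (s.toLinearMap.comp P.testSubmodule.subtype) (C := 21 * ‖s‖) (by positivity) (by
      intro x
      have h1 := s.le_opNorm x.1
      have h2 := norm_le_formVector x.2
      calc |s x.1| ≤ ‖s‖ * ‖x.1‖ := h1
        _ ≤ ‖s‖ * (21 * ‖formVector P.height x.1.1‖) := by gcongr
        _ = 21 * ‖s‖ * ‖formVector P.height x.1.1‖ := by ring)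
  refine ⟨u, fun w φ hp => ?_, hu⟩
  have hr := represents_testE1 (h := P.height) hp.w_test hp.phi_half
  have hx := testE1_snd (h := P.height) hp.w_test hp.phi_half
  refine ⟨_, hr, ?_⟩
  rw [← inner_formVector hp hr hx]
  exact (hs ⟨_, w, φ, hp, hr, hx⟩).symm

end

section

/-! ### Primitives in `y` -/

/-- The primitive `∫_0^y F(t, z) dt`. -/
def primY (F : ℝ × ℝ → ℝ) : ℝ × ℝ → ℝ := fun p => ∫ t in (0 : ℝ)..p.1, F (t, p.2)

/-- Near a given point a primitive in `y` is a difference of convolutions with the Heaviside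
function. -/
theorem smooth_primY {F : ℝ × ℝ → ℝ} (hF : ContDiff ℝ ∞ F) : ContDiff ℝ ∞ (primY F) := by
  refine contDiff_iff_contDiffAt.2 fun p₀ => ?_
  let χ : ContDiffBump (0 : ℝ) :=
    ⟨|p₀.1| + 1, |p₀.1| + 2, by positivity, by linarith⟩
  let G : ℝ → ℝ → ℝ := fun z y => χ y * F (y, z)
  have hG : ContDiff ℝ ∞ (fun q : ℝ × ℝ => G q.1 q.2) :=
    (χ.contDiff.comp contDiff_snd).mul (hF.comp (contDiff_snd.prodMk contDiff_fst))
  let E : ℝ → ℝ := indicator (Ioi 0) 1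
  have hE : LocallyIntegrable E := by
    refine LocallyIntegrable.indicator ?_ measurableSet_Ioi
    exact (continuous_const (y := (1 : ℝ))).locallyIntegrable
  have hconv := contDiffOn_convolution_right_with_param (μ := volume) (n := ⊤)
    (ContinuousLinearMap.mul ℝ ℝ) (g := G) (f := E) (s := univ)
    (k := Metric.closedBall 0 (|p₀.1| + 2)) isOpen_univ (isCompact_closedBall _ _)
    (fun z y _ hy => by
      have : χ y = 0 := χ.zero_of_le_dist (by
        simp only [Metric.mem_closedBall, not_le] at hy; exact hy.le)
      simp [G, this]) hE hG.contDiffOn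
  rw [univ_prod_univ, contDiffOn_univ] at hconv
  have hcv : ∀ z y, (convolution E (G z) (ContinuousLinearMap.mul ℝ ℝ) volume) y
      = ∫ t in Iic y, G z t := by
    intro z y
    rw [convolution_def]
    simp only [ContinuousLinearMap.mul_apply', E]
    have e1 : ∀ t, indicator (Ioi 0) (1 : ℝ → ℝ) t * G z (y - t)
        = (fun s => indicator (Iio y) (G z) s) (y - t) := fun t => by
      by_cases ht : 0 < t
      · simp [indicator, ht]
      · simp [indicator, ht]
    simp only [e1]
    rw [integral_sub_left_eq_self (fun s => indicator (Iio y) (G z) s) volume y,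
      integral_indicator measurableSet_Iio, integral_Iic_eq_integral_Iio]
  have hi : ∀ z, Integrable (G z) := fun z =>
    ((χ.continuous).mul (hF.continuous.comp (by fun_prop))).integrable_of_hasCompactSupport
      χ.hasCompactSupport.mul_right
  have hS : ContDiff ℝ ∞ fun p : ℝ × ℝ =>
      (convolution E (G p.2) (ContinuousLinearMap.mul ℝ ℝ) volume) p.1
        - (convolution E (G p.2) (ContinuousLinearMap.mul ℝ ℝ) volume) 0 :=
    (hconv.comp (contDiff_snd.prodMk contDiff_fst)).sub
      (hconv.comp (contDiff_snd.prodMk contDiff_const))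
  refine hS.contDiffAt.congr_of_eventuallyEq ?_
  have hnhds : ∀ᶠ p : ℝ × ℝ in 𝓝 p₀, |p.1| < |p₀.1| + 1 :=
    (continuous_fst.abs).continuousAt.eventually_lt continuousAt_const (by simp)
  filter_upwards [hnhds] with p hp
  rw [hcv, hcv, primY, intervalIntegral.integral_Iic_sub_Iic (hi _).integrableOn (hi _).integrableOn]
  refine intervalIntegral.integral_congr fun t ht => ?_
  have h1 : |t| ≤ |p.1| := by
    rcases le_total 0 p.1 with h0 | h0
    · rw [uIcc_of_le h0] at ht
      rw [abs_of_nonneg ht.1, abs_of_nonneg h0]; exact ht.2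
    · rw [uIcc_of_ge h0] at ht
      rw [abs_of_nonpos ht.2, abs_of_nonpos h0]; linarith [ht.1]
  have : χ t = 1 := χ.one_of_mem_closedBall (by
    rw [mem_closedBall_zero_iff, Real.norm_eq_abs]; exact h1.trans hp.le)
  simp [G, this]

theorem dy_primY {F : ℝ × ℝ → ℝ} (hF : ContDiff ℝ ∞ F) : dy (primY F) = F := by
  funext ⟨y, z⟩
  refine dy_eq ((smooth_primY hF).differentiable (by simp)) ?_
  have hc : Continuous fun t => F (t, z) := hF.continuous.comp (by fun_prop)
  exact intervalIntegral.integral_hasDerivAt_right (hc.intervalIntegrable _ _)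
    hc.aestronglyMeasurable.stronglyMeasurableAtFilter hc.continuousAt

theorem differentiable_comp_div {f : ℝ × ℝ → ℝ} (hf : Differentiable ℝ f) (δ : ℝ) :
    Differentiable ℝ fun p : ℝ × ℝ => f (p.1 / δ, p.2) :=
  hf.comp (by fun_prop : Differentiable ℝ fun p : ℝ × ℝ => (p.1 / δ, p.2))

theorem dy_comp_div {f : ℝ × ℝ → ℝ} (hf : Differentiable ℝ f) (δ : ℝ) :
    dy (fun p => f (p.1 / δ, p.2)) = fun p => δ⁻¹ * dy f (p.1 / δ, p.2) := by
  funext ⟨y, z⟩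
  refine dy_eq (differentiable_comp_div hf δ) ?_
  have := (hasDerivAt_fst hf (y / δ) z).comp y ((hasDerivAt_id' y).div_const δ)
  rw [mul_comm]
  simpa [Function.comp_def] using this

theorem abs_integral_mul_le {α : Type*} [MeasurableSpace α] {μ : Measure α} {f g : α → ℝ}
    (hf : MemLp f 2 μ) (hg : MemLp g 2 μ) :
    |∫ x, f x * g x ∂μ| ≤ √(∫ x, f x ^ 2 ∂μ) * √(∫ x, g x ^ 2 ∂μ) := by
  have key : ∀ {f g : α → ℝ} (hf : MemLp f 2 μ) (hg : MemLp g 2 μ),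
      inner ℝ hf.toLp hg.toLp = ∫ x, f x * g x ∂μ := fun hf hg => by
    rw [L2.inner_def]
    refine integral_congr_ae ?_
    filter_upwards [hf.coeFn_toLp, hg.coeFn_toLp] with x h1 h2
    rw [h1, h2]; simp [mul_comm]
  have hn : ∀ {f : α → ℝ} (hf : MemLp f 2 μ), ‖hf.toLp‖ = √(∫ x, f x ^ 2 ∂μ) := fun hf => by
    rw [norm_eq_sqrt_real_inner, key hf hf]; simp only [sq]
  rw [← key hf hg, ← hn hf, ← hn hg]
  exact abs_real_inner_le_norm _ _

/-- A compact subset of `Dom h` lies in a rectangle `[a, b] × K` that is contained in `Dom h`. -/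
theorem exists_rectangle {h : EReal} {S : Set (ℝ × ℝ)} (hS : IsCompact S) (hd : S ⊆ Dom h) :
    ∃ a b : ℝ, 0 < a ∧ a < b ∧ S ⊆ Icc a b ×ˢ (Prod.snd '' S) ∧ IsCompact (Prod.snd '' S) ∧
      Prod.snd '' S ⊆ zRange h := by
  have hc := hS.image continuous_snd
  have hz : Prod.snd '' S ⊆ zRange h := by
    rintro _ ⟨p, hp, rfl⟩; exact (hd hp).2
  rcases S.eq_empty_or_nonempty with rfl | hne
  · exact ⟨1, 2, by norm_num, by norm_num, empty_subset _, hc, hz⟩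
  · obtain ⟨p, hp, hmin⟩ := hS.exists_isMinOn hne continuous_fst.continuousOn
    obtain ⟨q, hq, hmax⟩ := hS.exists_isMaxOn hne continuous_fst.continuousOn
    refine ⟨p.1, max q.1 p.1 + 1, (hd hp).1, by linarith [le_max_right q.1 p.1], ?_, hc, hz⟩
    intro x hx
    exact ⟨⟨hmin hx, by
      have : x.1 ≤ q.1 := hmax hx
      linarith [le_max_left q.1 p.1]⟩, ⟨x, hx, rfl⟩⟩

theorem isTest_dom_of_rectangle {h : EReal} {f : ℝ × ℝ → ℝ} (hf : ContDiff ℝ ∞ f) {a b : ℝ}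
    {Z : Set ℝ} (ha : 0 < a) (hZ : IsCompact Z) (hZd : Z ⊆ zRange h)
    (h0 : ∀ y z, y < a → f (y, z) = 0) (h1 : ∀ y z, b < y → f (y, z) = 0)
    (h2 : ∀ y z, z ∉ Z → f (y, z) = 0) : IsTest (Dom h) f := by
  have hK : IsCompact (Icc a b ×ˢ Z) := isCompact_Icc.prod hZ
  have hz : ∀ p, p ∉ Icc a b ×ˢ Z → f p = 0 := by
    rintro ⟨y, z⟩ hp
    by_cases h3 : z ∈ Z
    · by_cases h4 : a ≤ y
      · exact h1 y z (not_le.1 fun h5 => hp ⟨⟨h4, h5⟩, h3⟩)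
      · exact h0 y z (not_le.1 h4)
    · exact h2 y z h3
  have hs : tsupport f ⊆ Icc a b ×ˢ Z := closure_minimal
    (fun p hp => by by_contra hn; exact hp (hz p hn)) hK.isClosed
  refine ⟨hf, HasCompactSupport.intro hK hz, hs.trans ?_⟩
  rw [dom_eq]
  exact prod_mono (fun y hy => ha.trans_le hy.1) hZd

section primitives

variable {h : EReal} {F : ℝ × ℝ → ℝ}

theorem primY_eq_zero_left {a : ℝ} (ha : 0 < a) (hF : ∀ y z, y < a → F (y, z) = 0) (y z : ℝ)
    (hy : y ≤ a) : primY F (y, z) = 0 := by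
  have : EqOn (fun t => F (t, z)) (fun _ => 0) (uIoo 0 y) := fun t ht => hF t z (by
    rcases le_total 0 y with h0 | h0
    · rw [uIoo_of_le h0] at ht; linarith [ht.2]
    · rw [uIoo_of_ge h0] at ht; linarith [ht.2])
  rw [primY, intervalIntegral.integral_congr_uIoo this]
  simp

theorem primY_of_const {b m z : ℝ} (hc : Continuous F) (hF : ∀ y, b < y → F (y, z) = m)
    (y : ℝ) (hy : b ≤ y) : primY F (y, z) = primY F (b, z) + m * (y - b) := by
  have hi : ∀ u v : ℝ, IntervalIntegrable (fun t => F (t, z)) volume u v :=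
    fun u v => (hc.comp (by fun_prop)).intervalIntegrable _ _
  simp only [primY]
  rw [← intervalIntegral.integral_add_adjacent_intervals (hi 0 b) (hi b y)]
  congr 1
  have : EqOn (fun t => F (t, z)) (fun _ => m) (uIoo b y) := fun t ht => hF t (by
    rw [uIoo_of_le hy] at ht; exact ht.1)
  rw [intervalIntegral.integral_congr_uIoo this]
  simp [mul_comm]

theorem primY_eq_zero_slice {z : ℝ} (hF : ∀ y, F (y, z) = 0) (y : ℝ) : primY F (y, z) = 0 := by
  simp [primY, hF]

theorem IsTest.exists_bounds (hF : IsTest (Dom h) F) :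
    ∃ (a b : ℝ) (Z : Set ℝ), 0 < a ∧ a < b ∧ IsCompact Z ∧ Z ⊆ zRange h ∧
      (∀ y z, y < a → F (y, z) = 0) ∧ (∀ y z, b < y → F (y, z) = 0) ∧
      (∀ y z, z ∉ Z → F (y, z) = 0) := by
  obtain ⟨a, b, ha, hab, hS, hc, hz⟩ := exists_rectangle hF.compact.isCompact hF.supp
  have key : ∀ p, p ∉ Icc a b ×ˢ (Prod.snd '' tsupport F) → F p = 0 := fun p hp =>
    image_eq_zero_of_notMem_tsupport fun hh => hp (hS hh)
  exact ⟨a, b, _, ha, hab, hc, hz, fun y z hy => key _ fun hh => (hh.1.1.trans_lt hy).false,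
    fun y z hy => key _ fun hh => (hy.trans_le hh.1.2).false, fun y z hy => key _ fun hh => hy hh.2⟩

/-- `F` minus a dilate of `F` with the same integrals in `y` is the `y`-derivative of a test. -/
theorem IsTest.exists_dy_eq_sub_dilate (hF : IsTest (Dom h) F) {δ : ℝ} (hδ : 0 < δ) :
    ∃ f, IsTest (Dom h) f ∧ EquatorialLayer.dy f = fun p => F p - δ⁻¹ * F (p.1 / δ, p.2) := by
  obtain ⟨a, b, Z, ha, hab, hZ, hZd, h0, h1, h2⟩ := hF.exists_bounds
  have hs := smooth_primY hF.smooth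
  have hd := hs.differentiable (by simp)
  have hsδ : ContDiff ℝ ∞ fun p : ℝ × ℝ => (-1) * primY F (p.1 / δ, p.2) :=
    contDiff_const.mul (hs.comp ((contDiff_fst.div_const δ).prodMk contDiff_snd))
  have hdδ : Differentiable ℝ fun p : ℝ × ℝ => primY F (p.1 / δ, p.2) :=
    differentiable_comp_div hd δ
  have hb := hF.continuous
  refine ⟨fun p => primY F p + (-1) * primY F (p.1 / δ, p.2), ?_, ?_⟩
  · refine isTest_dom_of_rectangle (a := min a (a * δ)) (b := max b (b * δ)) (hs.add hsδ)
      (lt_min ha (by positivity)) hZ hZd ?_ ?_ ?_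
    · intro y z hy
      rw [lt_min_iff] at hy
      simp only
      rw [primY_eq_zero_left ha h0 y z hy.1.le, primY_eq_zero_left ha h0 (y / δ) z
        (by rw [div_le_iff₀ hδ]; exact hy.2.le)]
      simp
    · intro y z hy
      rw [max_lt_iff] at hy
      simp only
      rw [primY_of_const hb (fun y hy => h1 y z hy) y hy.1.le,
        primY_of_const hb (fun y hy => h1 y z hy) (y / δ) (by rw [le_div_iff₀ hδ]; exact hy.2.le)]
      ring
    · intro y z hz
      simp only
      rw [primY_eq_zero_slice (fun y => h2 y z hz), primY_eq_zero_slice (fun y => h2 y z hz)]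
      simp
  · rw [dy_add hd (hdδ.const_mul _), dy_const_mul hdδ, dy_comp_div hd, dy_primY hF.smooth]
    funext p; ring

/-- `F` minus a combination of two dilates with the same integrals and first moments in `y` is
the second `y`-derivative of a test. -/
theorem IsTest.exists_dyy_eq_sub_dilate (hF : IsTest (Dom h) F) {δ : ℝ} (hδ : 0 < δ) :
    ∃ f, IsTest (Dom h) f ∧ EquatorialLayer.dy (EquatorialLayer.dy f) = fun p => F p
      - (2 - 1 / δ) / δ * F (p.1 / δ, p.2)
      - (1 / δ - 1) / (2 * δ) * F (p.1 / (2 * δ), p.2) := by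
  obtain ⟨a, b, Z, ha, hab, hZ, hZd, h0, h1, h2⟩ := hF.exists_bounds
  have hs1 := smooth_primY hF.smooth
  have hs := smooth_primY hs1
  have hd1 := hs1.differentiable (by simp)
  have hd := hs.differentiable (by simp)
  set P := primY (primY F) with hP
  have hsc : ∀ t : ℝ, ContDiff ℝ ∞ fun p : ℝ × ℝ => P (p.1 / t, p.2) := fun t =>
    hs.comp ((contDiff_fst.div_const t).prodMk contDiff_snd)
  have hdc1 : ∀ t : ℝ, Differentiable ℝ fun p : ℝ × ℝ => primY F (p.1 / t, p.2) := fun t =>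
    differentiable_comp_div hd1 t
  have hdc : ∀ t : ℝ, Differentiable ℝ fun p : ℝ × ℝ => P (p.1 / t, p.2) := fun t =>
    differentiable_comp_div hd t
  have hz1 : ∀ y z, y ≤ a → primY F (y, z) = 0 := primY_eq_zero_left ha h0
  have hz2 : ∀ y z, y ≤ a → P (y, z) = 0 := primY_eq_zero_left ha fun y z hy => hz1 y z hy.le
  have hl1 : ∀ y z, b ≤ y → primY F (y, z) = primY F (b, z) := fun y z hy => by
    rw [primY_of_const hF.continuous (fun y hy => h1 y z hy) y hy]; ring
  have hl2 : ∀ y z, b ≤ y → P (y, z) = P (b, z) + primY F (b, z) * (y - b) := fun y z hy =>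
    primY_of_const hs1.continuous (fun y hy => hl1 y z hy.le) y hy
  refine ⟨fun p => P p + (-((2 - 1 / δ) * δ) * P (p.1 / δ, p.2)
    + -((1 / δ - 1) * (2 * δ)) * P (p.1 / (2 * δ), p.2)), ?_, ?_⟩
  · refine isTest_dom_of_rectangle (a := min a (a * δ)) (b := max b (b * (2 * δ)))
      (hs.add ((contDiff_const.mul (hsc _)).add (contDiff_const.mul (hsc _))))
      (lt_min ha (by positivity)) hZ hZd ?_ ?_ ?_
    · intro y z hy
      rw [lt_min_iff] at hy
      have k1 : y / δ ≤ a := by rw [div_le_iff₀ hδ]; exact hy.2.le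
      have k2 : y / (2 * δ) ≤ a := by
        rw [div_le_iff₀ (by positivity)]; nlinarith [hy.2, mul_pos ha hδ]
      simp only
      rw [hz2 y z hy.1.le, hz2 _ z k1, hz2 _ z k2]; ring
    · intro y z hy
      rw [max_lt_iff] at hy
      have k2 : b ≤ y / (2 * δ) := by rw [le_div_iff₀ (by positivity)]; exact hy.2.le
      have k1 : b ≤ y / δ := by
        rw [le_div_iff₀ hδ]; nlinarith [hy.2, mul_pos (ha.trans hab) hδ]
      simp only
      rw [hl2 y z hy.1.le, hl2 _ z k1, hl2 _ z k2]
      field_simp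
      ring
    · intro y z hz
      have k1 : ∀ y, P (y, z) = 0 := fun y =>
        primY_eq_zero_slice (fun y => primY_eq_zero_slice (fun y => h2 y z hz) y) y
      simp only [k1]; ring
  · have e1 : EquatorialLayer.dy P = primY F := dy_primY hs1
    have e2 : EquatorialLayer.dy (primY F) = F := dy_primY hF.smooth
    rw [dy_add hd (((hdc _).const_mul _).fun_add ((hdc _).const_mul _)),
      dy_add ((hdc _).const_mul _) ((hdc _).const_mul _), dy_const_mul (hdc _),
      dy_const_mul (hdc _), dy_comp_div hd, dy_comp_div hd, e1,
      dy_add hd1 ((((hdc1 _).const_mul _).const_mul _).fun_add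
        (((hdc1 _).const_mul _).const_mul _)),
      dy_add (((hdc1 _).const_mul _).const_mul _) (((hdc1 _).const_mul _).const_mul _),
      dy_const_mul ((hdc1 _).const_mul _), dy_const_mul (hdc1 _),
      dy_const_mul ((hdc1 _).const_mul _), dy_const_mul (hdc1 _),
      dy_comp_div hd1, dy_comp_div hd1, e2]
    funext p
    field_simp
    ring

theorem IsTest.dilate (hF : IsTest (Dom h) F) {δ : ℝ} (hδ : 0 < δ) :
    IsTest (Dom h) fun p => F (p.1 / δ, p.2) := by
  obtain ⟨a, b, Z, ha, hab, hZ, hZd, h0, h1, h2⟩ := hF.exists_bounds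
  refine isTest_dom_of_rectangle (a := a * δ) (b := b * δ)
    (hF.smooth.comp ((contDiff_fst.div_const δ).prodMk contDiff_snd)) (by positivity) hZ hZd ?_ ?_
    fun y z hz => h2 _ z hz
  · exact fun y z hy => h0 _ z (by rw [div_lt_iff₀ hδ]; exact hy)
  · exact fun y z hy => h1 _ z (by rw [lt_div_iff₀ hδ]; exact hy)

theorem integrable_pow_mul_test {X : ℝ × ℝ → ℝ} (hX : MemLp X 2 (mu h)) (k : ℕ)
    {Q : Set (ℝ × ℝ)} (hF : IsTest Q F) : Integrable (fun p => p.1 ^ k * X p * F p) (mu h) := by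
  have := integrable_mul_test hX (hF.mul_left (contDiff_fst.pow k))
  refine this.congr (Eventually.of_forall fun p => ?_)
  simp only; ring

/-- Pairings with dilates are small, as the dilates have small norms with suitable weights. -/
theorem IsTest.exists_dilate_bound (hF : IsTest (Dom h) F) {X : ℝ × ℝ → ℝ}
    (hX : MemLp X 2 (mu h)) (k : ℕ) :
    ∃ C, 0 ≤ C ∧ ∀ δ : ℝ, 0 < δ →
      |∫ p, p.1 ^ k * X p * F (p.1 / δ, p.2) ∂mu h| ≤ C * (δ ^ k * √δ) := by
  obtain ⟨a, b, Z, ha, hab, hZ, hZd, h0, h1, h2⟩ := hF.exists_bounds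
  have hb : 0 < b := ha.trans hab
  obtain ⟨M, hM⟩ := hF.compact.exists_bound_of_continuous hF.continuous
  have hM0 : 0 ≤ M := (norm_nonneg _).trans (hM (0, 0))
  set m := (volume Z).toReal with hm
  refine ⟨√(∫ p, X p ^ 2 ∂mu h) * (b ^ k * M * √(b * m)), by positivity, fun δ hδ => ?_⟩
  have hG := (hF.dilate hδ).mul_left (g := fun p => p.1 ^ k) (contDiff_fst.pow k)
  have e : ∀ p : ℝ × ℝ, p.1 ^ k * X p * F (p.1 / δ, p.2)
      = X p * (p.1 ^ k * F (p.1 / δ, p.2)) := fun p => by ring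
  simp only [e]
  refine (abs_integral_mul_le hX (hG.memLp_mu h)).trans ?_
  rw [mul_assoc]
  refine mul_le_mul_of_nonneg_left ?_ (Real.sqrt_nonneg _)
  let R : Set (ℝ × ℝ) := Ioc 0 (b * δ) ×ˢ Z
  have hRm : MeasurableSet R := measurableSet_Ioc.prod hZ.measurableSet
  have hRv : volume R = ENNReal.ofReal (b * δ) * volume Z := by
    rw [Measure.volume_eq_prod, Measure.prod_prod, Real.volume_Ioc, sub_zero]
  have hRf : volume R < ⊤ := by
    rw [hRv]; exact ENNReal.mul_lt_top ENNReal.ofReal_lt_top hZ.measure_lt_top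
  have hRr : (volume R).toReal = b * δ * m := by
    rw [hRv, ENNReal.toReal_mul, ENNReal.toReal_ofReal (by positivity)]
  set A : ℝ := (b * δ) ^ k * M with hA
  have hA0 : 0 ≤ A := by positivity
  have hbound : ∫ p, (p.1 ^ k * F (p.1 / δ, p.2)) ^ 2 ∂mu h ≤ A ^ 2 * (b * δ * m) := by
    have hRi : Integrable (R.indicator fun _ => A ^ 2) volume :=
      (integrable_indicator_iff hRm).2 (integrableOn_const hRf.ne)
    calc ∫ p, (p.1 ^ k * F (p.1 / δ, p.2)) ^ 2 ∂mu h
        ≤ ∫ p, R.indicator (fun _ => A ^ 2) p ∂mu h := by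
          refine integral_mono_ae ?_ hRi.restrict ?_
          · have := (hG.mul_left hG.smooth).integrable_mu h
            simpa [sq] using this
          · filter_upwards [ae_mem_dom h] with p hp
            have hp1 : 0 < p.1 := hp.1
            by_cases hpR : p ∈ R
            · rw [indicator_of_mem hpR]
              refine sq_le_sq' ?_ ?_
              all_goals
                have k1 : p.1 ^ k ≤ (b * δ) ^ k := by
                  have := hpR.1.2
                  gcongr
                have k2 := abs_le.1 ((Real.norm_eq_abs _).symm.le.trans (hM (p.1 / δ, p.2)))
                have k3 : 0 ≤ p.1 ^ k := by positivity
                have k4 : p.1 ^ k * M ≤ A := by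
                  rw [hA]; exact mul_le_mul_of_nonneg_right k1 hM0
                nlinarith [k2.1, k2.2]
            · rw [indicator_of_notMem hpR]
              have : F (p.1 / δ, p.2) = 0 := by
                by_cases hz : p.2 ∈ Z
                · refine h1 _ _ ?_
                  rw [lt_div_iff₀ hδ]
                  by_contra hlt
                  exact hpR ⟨⟨hp1, not_lt.1 hlt⟩, hz⟩
                · exact h2 _ _ hz
              rw [this]; simp
      _ ≤ ∫ p, R.indicator (fun _ => A ^ 2) p :=
          integral_mono_measure Measure.restrict_le_self
            (Eventually.of_forall fun p => indicator_nonneg (fun _ _ => sq_nonneg _) _) hRi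
      _ = A ^ 2 * (b * δ * m) := by
          rw [integral_indicator_const _ hRm, Measure.real, hRr, smul_eq_mul, mul_comm]
  calc √(∫ p, (p.1 ^ k * F (p.1 / δ, p.2)) ^ 2 ∂mu h) ≤ √(A ^ 2 * (b * δ * m)) :=
        Real.sqrt_le_sqrt hbound
    _ = A * (√(b * m) * √δ) := by
        have hm0 : 0 ≤ m := ENNReal.toReal_nonneg
        rw [Real.sqrt_mul (sq_nonneg _), Real.sqrt_sq hA0, ← Real.sqrt_mul (by positivity)]
        congr 2; ring
    _ = b ^ k * M * √(b * m) * (δ ^ k * √δ) := by rw [hA, mul_pow]; ring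

end primitives

/-! ### Square integrable functions with vanishing weak derivatives -/

section liouville

variable {h : EReal} {X : ℝ × ℝ → ℝ}

theorem eq_zero_of_forall_le_mul {I C : ℝ} (H : ∀ t : ℝ, 0 < t → t ≤ 1 → |I| ≤ C * t) : I = 0 := by
  by_contra hI
  have hI : 0 < |I| := abs_pos.2 hI
  have h1 := H 1 one_pos le_rfl
  have hC : 0 < C := by linarith
  have h2 := H (min 1 (|I| / (2 * C))) (lt_min one_pos (by positivity)) (min_le_left _ _)
  have h3 : C * min 1 (|I| / (2 * C)) ≤ C * (|I| / (2 * C)) := by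
    gcongr; exact min_le_right _ _
  have h4 : C * (|I| / (2 * C)) = |I| / 2 := by field_simp
  linarith

/-- Tests may be divided by powers of `y`, since they are supported in `y > 0`. -/
theorem ae_eq_zero_of_pow_mul (hX : MemLp X 2 (mu h)) (k : ℕ)
    (H : ∀ F, IsTest (Dom h) F → ∫ p, p.1 ^ k * X p * F p ∂mu h = 0) : X =ᵐ[mu h] 0 := by
  refine ae_eq_of_test_memLp hX MemLp.zero fun φ hφ => ?_
  have hq : IsTest (Dom h) fun p => φ p / p.1 ^ k :=
    hφ.div_fst (fun p hp => hp.1) (contDiff_fst.pow k) fun p hp => by positivity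
  have := H _ hq
  rw [← integral_congr_ae (g := fun p => p.1 ^ k * X p * (φ p / p.1 ^ k))] at this
  · simpa using this
  · filter_upwards [ae_mem_dom h] with p hp
    have : p.1 ≠ 0 := ne_of_gt hp.1
    field_simp

/-- If `∂_y² (y^k X) = 0` then the pairing of `y^k X` with a test `F` equals its pairing with a
combination of dilates of `F`. -/
theorem integral_eq_dilates {k : ℕ} (hX : MemLp X 2 (mu h))
    (H : ∀ f, IsTest (Dom h) f → ∫ p, p.1 ^ k * X p * dy (dy f) p ∂mu h = 0)
    {F : ℝ × ℝ → ℝ} (hF : IsTest (Dom h) F) {δ : ℝ} (hδ : 0 < δ) :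
    ∫ p, p.1 ^ k * X p * F p ∂mu h
      = (2 - 1 / δ) / δ * ∫ p, p.1 ^ k * X p * F (p.1 / δ, p.2) ∂mu h
      + (1 / δ - 1) / (2 * δ) * ∫ p, p.1 ^ k * X p * F (p.1 / (2 * δ), p.2) ∂mu h := by
  obtain ⟨f, hf, e⟩ := hF.exists_dyy_eq_sub_dilate hδ
  have h1 := H f hf
  rw [e] at h1
  have e2 : ∀ p : ℝ × ℝ, p.1 ^ k * X p * (F p - (2 - 1 / δ) / δ * F (p.1 / δ, p.2)
      - (1 / δ - 1) / (2 * δ) * F (p.1 / (2 * δ), p.2))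
      = p.1 ^ k * X p * F p - (2 - 1 / δ) / δ * (p.1 ^ k * X p * F (p.1 / δ, p.2))
      - (1 / δ - 1) / (2 * δ) * (p.1 ^ k * X p * F (p.1 / (2 * δ), p.2)) := fun p => by ring
  have i0 := integrable_pow_mul_test hX k hF
  have i1 := integrable_pow_mul_test hX k (hF.dilate hδ)
  have i2 := integrable_pow_mul_test hX k (hF.dilate (δ := 2 * δ) (by positivity))
  simp only [e2] at h1
  have i3 : Integrable (fun p => p.1 ^ k * X p * F p
      - (2 - 1 / δ) / δ * (p.1 ^ k * X p * F (p.1 / δ, p.2))) (mu h) := i0.sub (i1.const_mul _)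
  rw [integral_sub i3 (i2.const_mul _), integral_sub i0 (i1.const_mul _),
    integral_const_mul, integral_const_mul] at h1
  linarith

theorem sqrt_two_mul_sq {t : ℝ} (ht : 0 < t) : √(2 * t ^ 2) ≤ 2 * t := by
  rw [Real.sqrt_le_left (by positivity)]; nlinarith

/-- Dilation to infinity: `∂_y² X = 0` and `X ∈ L²` imply `X = 0`. -/
theorem ae_eq_zero_of_dyy (hX : MemLp X 2 (mu h))
    (H : ∀ f, IsTest (Dom h) f → ∫ p, X p * dy (dy f) p ∂mu h = 0) : X =ᵐ[mu h] 0 := by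
  refine ae_eq_zero_of_pow_mul hX 0 fun F hF => ?_
  obtain ⟨C, hC, hb⟩ := hF.exists_dilate_bound hX 0
  -- dilation by `δ = t⁻²`, with `t → 0`
  refine eq_zero_of_forall_le_mul (C := 4 * C) fun t ht ht1 => ?_
  have hδ : 0 < 1 / t ^ 2 := by positivity
  rw [integral_eq_dilates (k := 0) hX (by simpa using H) hF hδ]
  have b1 := hb _ hδ
  have b2 := hb (2 * (1 / t ^ 2)) (by positivity)
  have s1 : √(1 / t ^ 2) = 1 / t := by
    rw [← one_div_pow, Real.sqrt_sq (by positivity)]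
  have s2 : √(2 * (1 / t ^ 2)) ≤ 2 * (1 / t) := by
    have := sqrt_two_mul_sq (t := 1 / t) (by positivity)
    rwa [div_pow, one_pow] at this
  rw [s1] at b1
  simp only [pow_zero, one_mul] at b1 b2 ⊢
  set I1 := ∫ p, X p * F (p.1 / (1 / t ^ 2), p.2) ∂mu h
  set I2 := ∫ p, X p * F (p.1 / (2 * (1 / t ^ 2)), p.2) ∂mu h
  have b2' : |I2| ≤ C * (2 * (1 / t)) := b2.trans (mul_le_mul_of_nonneg_left s2 hC)
  have c1 : |(2 - 1 / (1 / t ^ 2)) / (1 / t ^ 2)| ≤ 2 * t ^ 2 := by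
    rw [abs_le]; field_simp
    constructor <;> nlinarith [sq_nonneg t]
  have c2 : |(1 / (1 / t ^ 2) - 1) / (2 * (1 / t ^ 2))| ≤ t ^ 2 := by
    rw [abs_le]; field_simp
    constructor <;> nlinarith [sq_nonneg t]
  calc |(2 - 1 / (1 / t ^ 2)) / (1 / t ^ 2) * I1
        + (1 / (1 / t ^ 2) - 1) / (2 * (1 / t ^ 2)) * I2|
      ≤ |(2 - 1 / (1 / t ^ 2)) / (1 / t ^ 2)| * |I1|
        + |(1 / (1 / t ^ 2) - 1) / (2 * (1 / t ^ 2))| * |I2| := by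
        rw [← abs_mul, ← abs_mul]; exact abs_add_le _ _
    _ ≤ 2 * t ^ 2 * (C * (1 / t)) + t ^ 2 * (C * (2 * (1 / t))) := by gcongr
    _ = 4 * C * t := by field_simp; ring

/-- Dilation to zero: `∂_y² (y² X) = 0` and `X ∈ L²` imply `X = 0`. -/
theorem ae_eq_zero_of_dyy_sq (hX : MemLp X 2 (mu h))
    (H : ∀ f, IsTest (Dom h) f → ∫ p, p.1 ^ 2 * X p * dy (dy f) p ∂mu h = 0) : X =ᵐ[mu h] 0 := by
  refine ae_eq_zero_of_pow_mul hX 2 fun F hF => ?_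
  obtain ⟨C, hC, hb⟩ := hF.exists_dilate_bound hX 2
  -- dilation by `δ = t²`, with `t → 0`
  refine eq_zero_of_forall_le_mul (C := 7 * C) fun t ht ht1 => ?_
  have hδ : 0 < t ^ 2 := by positivity
  rw [integral_eq_dilates (k := 2) hX H hF hδ]
  have b1 := hb _ hδ
  have b2 := hb (2 * t ^ 2) (by positivity)
  have s2 := sqrt_two_mul_sq ht
  rw [Real.sqrt_sq ht.le] at b1
  set I1 := ∫ p, p.1 ^ 2 * X p * F (p.1 / t ^ 2, p.2) ∂mu h
  set I2 := ∫ p, p.1 ^ 2 * X p * F (p.1 / (2 * t ^ 2), p.2) ∂mu h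
  have b2' : |I2| ≤ C * ((2 * t ^ 2) ^ 2 * (2 * t)) := b2.trans (by gcongr)
  have ht2 : t ^ 2 ≤ 1 := pow_le_one₀ ht.le ht1
  have c1 : |(2 - 1 / t ^ 2) / t ^ 2| ≤ 3 / (t ^ 2) ^ 2 := by
    rw [abs_le]; field_simp
    constructor <;> nlinarith [sq_nonneg t]
  have c2 : |(1 / t ^ 2 - 1) / (2 * t ^ 2)| ≤ 1 / (2 * (t ^ 2) ^ 2) := by
    rw [abs_le]; field_simp
    constructor <;> nlinarith [sq_nonneg t]
  calc |(2 - 1 / t ^ 2) / t ^ 2 * I1 + (1 / t ^ 2 - 1) / (2 * t ^ 2) * I2|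
      ≤ |(2 - 1 / t ^ 2) / t ^ 2| * |I1| + |(1 / t ^ 2 - 1) / (2 * t ^ 2)| * |I2| := by
        rw [← abs_mul, ← abs_mul]; exact abs_add_le _ _
    _ ≤ 3 / (t ^ 2) ^ 2 * (C * ((t ^ 2) ^ 2 * t))
        + 1 / (2 * (t ^ 2) ^ 2) * (C * ((2 * t ^ 2) ^ 2 * (2 * t))) := by gcongr
    _ = 7 * C * t := by field_simp; ring

/-- Dilation to zero: `∂_y (y X) = 0` and `X ∈ L²` imply `X = 0`. -/
theorem ae_eq_zero_of_dy_mul (hX : MemLp X 2 (mu h))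
    (H : ∀ f, IsTest (Dom h) f → ∫ p, p.1 * X p * dy f p ∂mu h = 0) : X =ᵐ[mu h] 0 := by
  refine ae_eq_zero_of_pow_mul hX 1 fun F hF => ?_
  obtain ⟨C, hC, hb⟩ := hF.exists_dilate_bound hX 1
  -- dilation by `δ = t²`, with `t → 0`
  refine eq_zero_of_forall_le_mul (C := C) fun t ht ht1 => ?_
  have hδ : 0 < t ^ 2 := by positivity
  obtain ⟨f, hf, e⟩ := hF.exists_dy_eq_sub_dilate hδ
  have h1 := H f hf
  rw [e] at h1
  have b1 := hb _ hδ
  have i0 := integrable_pow_mul_test hX 1 hF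
  have i1 := integrable_pow_mul_test hX 1 (hF.dilate hδ)
  have e2 : ∀ p : ℝ × ℝ, p.1 * X p * (F p - (t ^ 2)⁻¹ * F (p.1 / t ^ 2, p.2))
      = p.1 ^ 1 * X p * F p - (t ^ 2)⁻¹ * (p.1 ^ 1 * X p * F (p.1 / t ^ 2, p.2)) :=
    fun p => by ring
  simp only [e2] at h1
  rw [integral_sub i0 (i1.const_mul _), integral_const_mul, sub_eq_zero] at h1
  rw [h1, abs_mul, abs_of_pos (by positivity)]
  rw [Real.sqrt_sq ht.le, pow_one] at b1
  calc _ ≤ (t ^ 2)⁻¹ * (C * (t ^ 2 * t)) := by gcongr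
    _ = C * t := by field_simp

end liouville

end

section

/-! ### Density of test pairs in `E_{0,0}` -/

/-- The pairs of `C_c^∞(Dom h)` functions, as a subspace of `E_{0,0}`. -/
def domTests (h : EReal) : Submodule ℝ (E00 h) where
  carrier := {e | ∃ f g, IsTest (Dom h) f ∧ IsTest (Dom h) g ∧ Represents e f g}
  add_mem' := by
    rintro e e' ⟨f, g, hf, hg, hr⟩ ⟨f', g', hf', hg', hr'⟩
    exact ⟨_, _, hf.add hf', hg.add hg', hr.add hr'⟩
  zero_mem' := ⟨_, _, IsTest.zero, IsTest.zero, Represents.zero⟩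
  smul_mem' := by
    rintro r e ⟨f, g, hf, hg, hr⟩
    exact ⟨_, _, hf.const_mul r, hg.const_mul r, hr.smul r⟩

variable {h : EReal}

/-- Hardy's inequality on the closure of the test pairs. -/
theorem norm_sq_le_inner_diffusion {e : E00 h} (he : e ∈ (domTests h).topologicalClosure) :
    ‖e‖ ^ 2 ≤ 5 * inner ℝ (diffusion 0 h e) e := by
  have hcl : IsClosed {e : E00 h | ‖e‖ ^ 2 ≤ 5 * inner ℝ (diffusion 0 h e) e} :=
    isClosed_le (by fun_prop)
      (continuous_const.mul ((diffusion 0 h).continuous.inner continuous_id))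
  refine hcl.closure_subset_iff.2 ?_ he
  rintro e ⟨f, g, hf, hg, hr⟩
  have he : e = testEnergy le_rfl h hf.half hg.half :=
    hr.unique le_rfl (represents_testEnergy _ _ _)
  have h1 := norm_sq_testEnergy_le (h := h) hf.half hg.half
  change ‖e‖ ^ 2 ≤ 5 * inner ℝ (diffusion 0 h e) e
  rw [inner_diffusion, he]
  refine h1.trans_eq ?_
  congr 2
  · exact integral_congr_ae (by
      filter_upwards [testEnergy_one (h := h) le_rfl hf.half hg.half] with p hp; rw [hp, sq])
  · exact integral_congr_ae (by
      filter_upwards [testEnergy_three (h := h) le_rfl hf.half hg.half] with p hp; rw [hp, sq])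

/-- An element is zero if it is orthogonal to the test pairs for the form given by `diffusion`. -/
theorem eq_zero_of_inner_diffusion {e : E00 h}
    (he : ∀ e' ∈ domTests h, inner ℝ (diffusion 0 h e) e' = 0) : e = 0 := by
  have key : ∀ f g, IsTest (Dom h) f → IsTest (Dom h) g →
      ∫ p, e.1 1 p * dy f p ∂mu h + ∫ p, e.1 3 p * dy (dy g) p ∂mu h = 0 := by
    intro f g hf hg
    refine Eq.trans ?_ (he _ ⟨f, g, hf, hg, represents_testEnergy le_rfl hf.half hg.half⟩)
    rw [inner_diffusion]
    congr 1
    · exact integral_congr_ae (by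
        filter_upwards [testEnergy_one (h := h) le_rfl hf.half hg.half] with p hp
        rw [hp, mul_comm])
    · exact integral_congr_ae (by
        filter_upwards [testEnergy_three (h := h) le_rfl hf.half hg.half] with p hp
        rw [hp, mul_comm])
  have k1 : e.1 1 =ᵐ[mu h] 0 := ae_eq_zero_of_dyy (e.memLp 1) fun f hf => by
    have := key (dy f) (fun _ => 0) hf.dy IsTest.zero
    simpa [dy_zero] using this
  have k3 : e.1 3 =ᵐ[mu h] 0 := ae_eq_zero_of_dyy (e.memLp 3) fun f hf => by
    have := key (fun _ => 0) f IsTest.zero hf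
    simpa [dy_zero] using this
  have k0 : e.1 0 =ᵐ[mu h] 0 := ae_eq_zero_of_dy_mul (e.memLp 0) fun f hf => by
    have h1 := e.hasWeakDy_v f hf
    have h2 : ∫ p in Dom h, dyvOf e p * f p = 0 := integral_eq_zero_of_ae (by
      filter_upwards [k1] with p hp; simp [dyvOf, hp])
    rw [h2, mul_zero] at h1
    simpa [vOf, mu] using h1
  have k2 : e.1 2 =ᵐ[mu h] 0 := ae_eq_zero_of_dyy_sq (e.memLp 2) fun f hf => by
    have h1 := e.hasWeakDy_psi f hf
    have h2 : ∫ p in Dom h, dyypsiOf e p * f p = 0 := integral_eq_zero_of_ae (by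
      filter_upwards [k3] with p hp; simp [dyypsiOf, hp])
    rw [h2, mul_zero] at h1
    simpa [psiOf, mu] using h1
  refine Energy.ext fun i => ?_
  have hz : ((0 : E00 h).1 i) =ᵐ[mu h] 0 := Lp.coeFn_zero ℝ 2 (mu h)
  refine EventuallyEq.trans ?_ hz.symm
  fin_cases i
  exacts [k0, k1, k2, k3]

/-- Density. For `e` in `E_{0,0}` the Lax–Milgram theorem yields `w` in the closure such that `e - w`
is orthogonal to the test pairs for the form given by `diffusion`; hence `e = w`. -/
theorem closure_domTests_eq_top (h : EReal) : (domTests h).topologicalClosure = ⊤ := by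
  set W := (domTests h).topologicalClosure with hW
  have hWc : IsClosed (W : Set (E00 h)) := (domTests h).isClosed_topologicalClosure
  have : CompleteSpace W := hWc.completeSpace_coe
  -- The form given by `diffusion` is coercive on `W`.
  let B : W →L[ℝ] W →L[ℝ] ℝ :=
    ((ContinuousLinearMap.compL ℝ W (E00 h) ℝ).flip W.subtypeL).comp
      ((innerSL ℝ).comp ((diffusion 0 h).comp W.subtypeL))
  have hB : ∀ u w : W, B u w = inner ℝ (diffusion 0 h u) (w : E00 h) := fun u w => rfl
  have hco : IsCoercive B := ⟨1 / 5, by norm_num, fun u => by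
    rw [hB]
    have h1 := norm_sq_le_inner_diffusion u.2
    have h2 : ‖u‖ = ‖(u : E00 h)‖ := rfl
    rw [h2]
    linarith [sq ‖(u : E00 h)‖]⟩
  refine eq_top_iff.2 fun e _ => ?_
  let w : W := hco.continuousLinearEquivOfBilin.symm (W.orthogonalProjectionOnto (diffusion 0 h e))
  have hw : ∀ e' : W, inner ℝ (diffusion 0 h w) (e' : E00 h) = inner ℝ (diffusion 0 h e) (e' : E00 h) := by
    intro e'
    rw [← hB, ← hco.continuousLinearEquivOfBilin_apply]
    simp only [w, ContinuousLinearEquiv.apply_symm_apply]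
    exact Submodule.inner_orthogonalProjectionOnto_eq_of_mem_right _ _
  have h0 : e - w = 0 := eq_zero_of_inner_diffusion fun e' he' => by
    rw [map_sub, inner_sub_left, hw ⟨e', subset_closure he'⟩, sub_self]
  rw [sub_eq_zero.1 h0]
  exact w.2

/-- The element of `E_1` given by a pair of functions is unique: the functional is prescribed on the
dense set of test pairs. -/
theorem E1.ext_of_represents {x x' : E1 h} {f g : ℝ × ℝ → ℝ} (hx : Represents x.1.fst f g)
    (hx' : Represents x'.1.fst f g) : x = x' := by
  have h1 : x.1.fst = x'.1.fst := hx.unique le_rfl hx'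
  have h2 : x.1.snd = x'.1.snd := by
    have hd : Dense (domTests h : Set (E00 h)) := by
      rw [dense_iff_closure_eq, ← Submodule.topologicalClosure_coe, closure_domTests_eq_top]; rfl
    have := Continuous.ext_on hd x.1.snd.continuous x'.1.snd.continuous (by
      rintro e ⟨a, b, ha, hb, hr⟩
      rw [x.2 a b ha hb e hr, x'.2 a b ha hb e hr, h1])
    exact ContinuousLinearMap.ext fun e => congrFun this e
  exact Subtype.ext ((WithLp.equiv 1 _).injective (Prod.ext h1 h2))

/-- The weak formulation holds for every element of `E_1` that represents the test pair. -/
theorem weakForm_eq_apply {c : ℝ} {P : Problem} {s : StrongDual ℝ (E1 P.height)}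
    {u : Energy c P.height} (hu : P.IsWeakSolution s u) {w φ : ℝ × ℝ → ℝ} (hp : P.IsTestPair w φ)
    {x : E1 P.height} (hx : Represents x.1.fst w φ) : weakForm u w φ = s x := by
  obtain ⟨x', hx', e⟩ := hu w φ hp
  rw [e, E1.ext_of_represents hx hx']

end

section

/-! ### Absolute continuity in `z` and traces -/

/-- Lebesgue measure on the rectangle `[a, b] × (0, Z)`. -/
def rectMeasure (a b Z : ℝ) : Measure (ℝ × ℝ) :=
  (volume.restrict (Icc a b)).prod (volume.restrict (Ioo 0 Z))

theorem rectMeasure_eq (a b Z : ℝ) :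
    rectMeasure a b Z = volume.restrict (Icc a b ×ˢ Ioo 0 Z) := by
  rw [rectMeasure, Measure.prod_restrict]; rfl

instance (a b Z : ℝ) : IsFiniteMeasure (rectMeasure a b Z) := by
  rw [rectMeasure]; infer_instance

theorem rect_subset_dom {a b Z : ℝ} (ha : 0 < a) : Icc a b ×ˢ Ioo 0 Z ⊆ Dom (Z : EReal) := by
  rw [dom_eq, zRange_coe]
  exact prod_mono (fun y hy => ha.trans_le hy.1) subset_rfl

theorem dom_mono {h h' : EReal} (hh : h ≤ h') : Dom h ⊆ Dom h' :=
  fun _ hp => ⟨hp.1, hp.2.1, hp.2.2.trans_le hh⟩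

theorem integral_mu_eq_rect {a b Z : ℝ} (ha : 0 < a) {F : ℝ × ℝ → ℝ}
    (hF : ∀ y z, y ∉ Icc a b → F (y, z) = 0) :
    ∫ p, F p ∂mu (Z : EReal) = ∫ p, F p ∂rectMeasure a b Z := by
  rw [rectMeasure_eq, mu]
  refine setIntegral_eq_of_subset_of_forall_sdiff_eq_zero (measurableSet_dom _)
    (rect_subset_dom ha) fun p hp => hF p.1 p.2 fun hy => hp.2 ⟨hy, ?_⟩
  have := hp.1
  rw [dom_eq, zRange_coe] at this
  exact this.2

theorem L2Loc.integrable_rect {h : EReal} {f : ℝ × ℝ → ℝ} (hf : L2Loc h f) {a b Z : ℝ}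
    (ha : 0 < a) (hZ : (Z : EReal) ≤ h) : Integrable f (rectMeasure a b Z) := by
  have h1 := hf (Icc a b ×ˢ Icc 0 Z) (isCompact_Icc.prod isCompact_Icc)
    fun p hp => ha.trans_le hp.1.1
  have h2 : MemLp f 2 (rectMeasure a b Z) := by
    refine h1.mono_measure ?_
    rw [rectMeasure_eq, mu, Measure.restrict_restrict (measurableSet_Icc.prod measurableSet_Icc)]
    refine Measure.restrict_mono (fun p hp => ?_) le_rfl
    exact ⟨⟨hp.1, Ioo_subset_Icc_self hp.2⟩, dom_mono hZ (rect_subset_dom ha hp)⟩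
  exact MemLp.integrable (q := 2) (by norm_num) h2

theorem L2Loc.aestronglyMeasurable {h : EReal} {f : ℝ × ℝ → ℝ} (hf : L2Loc h f) :
    AEStronglyMeasurable f (mu h) := by
  have hs : IsOpen {p : ℝ × ℝ | 0 < p.1} := isOpen_lt continuous_const continuous_fst
  have h1 : LocallyIntegrableOn f {p : ℝ × ℝ | 0 < p.1} (mu h) := by
    refine (locallyIntegrableOn_iff hs.isLocallyClosed).2 fun K hK hc => ?_
    have hfin : IsFiniteMeasure ((mu h).restrict K) :=
      ⟨by
        rw [Measure.restrict_apply_univ]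
        exact (Measure.restrict_apply_le _ _).trans_lt hc.measure_lt_top⟩
    exact MemLp.integrable (q := 2) (by norm_num) (hf K hc hK)
  have h2 := h1.aestronglyMeasurable
  rwa [Measure.restrict_eq_self_of_ae_mem] at h2
  filter_upwards [ae_mem_dom h] with p hp using hp.1

theorem locallyIntegrableOn_Ioi {t : ℝ → ℝ}
    (ht : ∀ a b : ℝ, 0 < a → IntegrableOn t (Icc a b)) : LocallyIntegrableOn t (Ioi 0) := by
  refine (locallyIntegrableOn_iff isOpen_Ioi.isLocallyClosed).2 fun K hK hc => ?_
  rcases K.eq_empty_or_nonempty with rfl | hne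
  · simp
  · obtain ⟨a, haK, ha⟩ := hc.exists_isLeast hne
    obtain ⟨b, _, hb⟩ := hc.exists_isGreatest hne
    exact (ht a b (hK haK)).mono_set fun x hx => ⟨ha hx, hb hx⟩

/-- The primitive `∫_0^z g(y, s) ds`. -/
def primZ (g : ℝ × ℝ → ℝ) : ℝ × ℝ → ℝ := fun p => ∫ s in Ioo 0 p.2, g (p.1, s)

theorem stronglyMeasurable_primZ {g : ℝ × ℝ → ℝ} (hg : StronglyMeasurable g) :
    StronglyMeasurable (primZ g) := by
  have hm : MeasurableSet {q : (ℝ × ℝ) × ℝ | 0 < q.2 ∧ q.2 < q.1.2} :=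
    (measurableSet_lt measurable_const measurable_snd).inter
      (measurableSet_lt measurable_snd measurable_fst.snd)
  have h1 : StronglyMeasurable ({q : (ℝ × ℝ) × ℝ | 0 < q.2 ∧ q.2 < q.1.2}.indicator
      fun q => g (q.1.1, q.2)) :=
    (hg.comp_measurable (measurable_fst.fst.prodMk measurable_snd)).indicator hm
  have h2 := h1.integral_prod_right' (ν := (volume : Measure ℝ))
  have e : primZ g = fun p => ∫ s, {q : (ℝ × ℝ) × ℝ | 0 < q.2 ∧ q.2 < q.1.2}.indicator
      (fun q => g (q.1.1, q.2)) (p, s) := by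
    funext p
    rw [primZ, ← integral_indicator measurableSet_Ioo]
    rfl
  rw [e]
  exact h2

theorem norm_primZ_le {g : ℝ × ℝ → ℝ} {y z Z : ℝ} (hz : z ≤ Z)
    (hg : Integrable (fun s => g (y, s)) (volume.restrict (Ioo 0 Z))) :
    ‖primZ g (y, z)‖ ≤ ∫ s in Ioo 0 Z, ‖g (y, s)‖ :=
  (norm_integral_le_integral_norm _).trans (setIntegral_mono_set hg.norm
    (Eventually.of_forall fun _ => norm_nonneg _) (Ioo_subset_Ioo_right hz).eventuallyLE)

theorem integrable_primZ {g : ℝ × ℝ → ℝ} (hg : StronglyMeasurable g) {a b Z : ℝ}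
    (hi : Integrable g (rectMeasure a b Z)) : Integrable (primZ g) (rectMeasure a b Z) := by
  have h1 : Integrable (fun p : ℝ × ℝ => ∫ s in Ioo 0 Z, ‖g (p.1, s)‖) (rectMeasure a b Z) :=
    (Integrable.integral_prod_left (hi.norm : Integrable (fun p => ‖g p‖) (rectMeasure a b Z))).comp_fst
      (volume.restrict (Ioo 0 Z))
  refine h1.mono' (stronglyMeasurable_primZ hg).aestronglyMeasurable ?_
  have h2 : ∀ᵐ p ∂rectMeasure a b Z, Integrable (fun s => g (p.1, s)) (volume.restrict (Ioo 0 Z)) :=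
    Measure.quasiMeasurePreserving_fst.ae (Integrable.prod_right_ae hi)
  have h3 : ∀ᵐ p ∂rectMeasure a b Z, p ∈ Icc a b ×ˢ Ioo 0 Z := by
    rw [rectMeasure_eq]; exact ae_restrict_mem (measurableSet_Icc.prod measurableSet_Ioo)
  filter_upwards [h2, h3] with p hp hp'
  exact norm_primZ_le hp'.2.2.le hp

/-- Integration by parts against a primitive, by Fubini's theorem. -/
theorem integral_prim_mul_deriv {g φ ψ : ℝ → ℝ} {Z : ℝ} (hg : IntegrableOn g (Ioo 0 Z))
    (hψ : Continuous ψ) (hφ : ∀ z, HasDerivAt φ (ψ z) z) (hZ : φ Z = 0) :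
    ∫ z in Ioo 0 Z, (∫ s in Ioo 0 z, g s) * ψ z = -∫ s in Ioo 0 Z, g s * φ s := by
  set l := volume.restrict (Ioo 0 Z) with hl
  have e1 : ∀ z ∈ Ioo 0 Z, (∫ s in Ioo 0 z, g s) * ψ z
      = ∫ s, (Iio z).indicator g s * ψ z ∂l := by
    intro z hz
    rw [integral_mul_const]
    congr 1
    rw [integral_indicator measurableSet_Iio, hl, Measure.restrict_restrict measurableSet_Iio]
    congr 2
    ext s
    exact ⟨fun h => ⟨h.2, h.1, h.2.trans hz.2⟩, fun h => ⟨h.2.1, h.1⟩⟩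
  rw [setIntegral_congr_fun measurableSet_Ioo e1]
  have hint : Integrable (Function.uncurry fun z s => (Iio z).indicator g s * ψ z) (l.prod l) := by
    have hψi : Integrable ψ l :=
      (hψ.continuousOn.integrableOn_Icc).mono_set Ioo_subset_Icc_self
    have hp : Integrable (fun q : ℝ × ℝ => ψ q.1 * g q.2) (l.prod l) := hψi.mul_prod hg
    have hm : MeasurableSet {q : ℝ × ℝ | q.2 < q.1} := measurableSet_lt measurable_snd measurable_fst
    refine (hp.indicator hm).congr (Eventually.of_forall fun q => ?_)
    by_cases hq : q.2 < q.1
    · simp [Function.uncurry, indicator, hq, mul_comm]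
    · simp [Function.uncurry, indicator, hq]
  rw [integral_integral_swap hint, ← integral_neg]
  refine setIntegral_congr_fun measurableSet_Ioo fun s hs => ?_
  have e2 : ∀ z, (Iio z).indicator g s * ψ z = g s * (Ioi s).indicator ψ z := fun z => by
    by_cases hz : s < z
    · simp [indicator, hz]
    · simp [indicator, hz]
  simp only [e2]
  rw [integral_const_mul, integral_indicator measurableSet_Ioi, hl,
    Measure.restrict_restrict measurableSet_Ioi]
  have e3 : Ioi s ∩ Ioo 0 Z = Ioo s Z := by
    ext z
    exact ⟨fun h => ⟨h.1, h.2.2⟩, fun h => ⟨h.1, hs.1.trans h.1, h.2⟩⟩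
  rw [e3, ← integral_Ioc_eq_integral_Ioo, ← intervalIntegral.integral_of_le hs.2.le,
    intervalIntegral.integral_eq_sub_of_hasDerivAt (fun z _ => hφ z) (hψ.intervalIntegrable _ _),
    hZ]
  ring

theorem integral_primZ_mul_dz {g : ℝ × ℝ → ℝ} (hg : StronglyMeasurable g) {a b Z : ℝ}
    (hi : Integrable g (rectMeasure a b Z)) {Q : Set (ℝ × ℝ)} {φ : ℝ × ℝ → ℝ}
    (hφ : IsTest Q φ) (hφZ : ∀ y, φ (y, Z) = 0) :
    ∫ p, primZ g p * dz φ p ∂rectMeasure a b Z = -∫ p, g p * φ p ∂rectMeasure a b Z := by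
  have bdd : ∀ {F : ℝ × ℝ → ℝ}, Integrable F (rectMeasure a b Z) → ∀ {ψ : ℝ × ℝ → ℝ},
      IsTest Q ψ → Integrable (fun p => F p * ψ p) (rectMeasure a b Z) := by
    intro F hF ψ hψ
    obtain ⟨M, hM⟩ := hψ.compact.exists_bound_of_continuous hψ.continuous
    exact hF.mul_bdd (c := M) hψ.continuous.aestronglyMeasurable (Eventually.of_forall hM)
  have h1 := bdd (integrable_primZ hg hi) hφ.dz
  have h2 := bdd hi hφ
  have h3 : ∀ᵐ y ∂volume.restrict (Icc a b), Integrable (fun s => g (y, s))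
      (volume.restrict (Ioo 0 Z)) := Integrable.prod_right_ae hi
  simp only [rectMeasure] at h1 h2 ⊢
  rw [integral_prod _ h1, integral_prod _ h2, ← integral_neg]
  refine integral_congr_ae ?_
  filter_upwards [h3] with y hy
  exact integral_prim_mul_deriv (φ := fun z => φ (y, z)) hy (hφ.dz.continuous.comp (by fun_prop))
    (fun z => hasDerivAt_snd hφ.differentiable y z) (hφZ y)

/-- The primitive in `z` of a smooth function, for use with tests. -/
theorem exists_smooth_primZ {F : ℝ × ℝ → ℝ} (hF : ContDiff ℝ ∞ F) :
    ∃ f : ℝ × ℝ → ℝ, ContDiff ℝ ∞ f ∧ dz f = F ∧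
      ∀ y z, f (y, z) = ∫ s in (0 : ℝ)..z, F (y, s) := by
  have hs : ContDiff ℝ ∞ fun p : ℝ × ℝ => F (p.2, p.1) := hF.comp (contDiff_snd.prodMk contDiff_fst)
  have h1 := smooth_primY hs
  have h2 : ContDiff ℝ ∞ fun p : ℝ × ℝ => primY (fun p : ℝ × ℝ => F (p.2, p.1)) (p.2, p.1) :=
    h1.comp (contDiff_snd.prodMk contDiff_fst)
  refine ⟨_, h2, ?_, fun y z => rfl⟩
  funext ⟨y, z⟩
  refine dz_eq (h2.differentiable (by simp)) ?_
  have := hasDerivAt_fst (h1.differentiable (by simp)) z y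
  rwa [dy_primY hs] at this

/-- A function with a weak `z`-derivative is, up to a null set, a function of `y` plus a primitive
in `z`. -/
theorem exists_eq_add_primZ {Z : ℝ} (hZ : 0 < Z) {f g : ℝ × ℝ → ℝ} (hg : StronglyMeasurable g)
    (hfi : ∀ a b : ℝ, 0 < a → Integrable f (rectMeasure a b Z))
    (hgi : ∀ a b : ℝ, 0 < a → Integrable g (rectMeasure a b Z))
    (hfg : HasWeakDz (Dom (Z : EReal)) f g) :
    ∃ t : ℝ → ℝ, (∀ a b : ℝ, 0 < a → IntegrableOn t (Icc a b)) ∧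
      ∀ᵐ p ∂mu (Z : EReal), f p = t p.1 + primZ g p := by
  -- The difference `r` of `f` and the primitive has zero weak `z`-derivative.
  let r : ℝ × ℝ → ℝ := fun p => f p - primZ g p
  have hri : ∀ a b : ℝ, 0 < a → Integrable r (rectMeasure a b Z) := fun a b ha =>
    (hfi a b ha).sub (integrable_primZ hg (hgi a b ha))
  have bdd : ∀ {a b : ℝ} {F : ℝ × ℝ → ℝ}, Integrable F (rectMeasure a b Z) → ∀ {ψ : ℝ × ℝ → ℝ},
      Continuous ψ → HasCompactSupport ψ →
        Integrable (fun p => F p * ψ p) (rectMeasure a b Z) := by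
    intro a b F hF ψ hψ hψc
    obtain ⟨M, hM⟩ := hψc.exists_bound_of_continuous hψ
    exact hF.mul_bdd (c := M) hψ.aestronglyMeasurable (Eventually.of_forall hM)
  let κ₀ : ContDiffBump (Z / 2) := ⟨Z / 8, Z / 4, by positivity, by linarith⟩
  let κ : ℝ → ℝ := κ₀.normed volume
  have hκs : ContDiff ℝ ∞ κ := κ₀.contDiff_normed
  have hκ0 : ∀ z, z ∉ Icc (Z / 4) (3 * Z / 4) → κ z = 0 := by
    intro z hz
    have : z ∉ Function.support (κ₀.normed volume) := by
      rw [κ₀.support_normed_eq]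
      intro h
      rw [Metric.mem_ball, Real.dist_eq, abs_lt] at h
      simp only [κ₀] at h
      exact hz ⟨by linarith, by linarith⟩
    simpa [κ] using this
  have hκi : ∫ z in Ioo 0 Z, κ z = 1 := by
    rw [setIntegral_eq_integral_of_forall_compl_eq_zero, κ₀.integral_normed]
    exact fun z hz => hκ0 z fun h => hz ⟨by linarith [h.1], by linarith [h.2]⟩
  have hκc : Continuous κ := hκs.continuous
  let t : ℝ → ℝ := fun y => ∫ z in Ioo 0 Z, r (y, z) * κ z
  have hκb : ∃ M, ∀ z, ‖κ z‖ ≤ M := by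
    refine (HasCompactSupport.intro (isCompact_Icc (a := Z / 4) (b := 3 * Z / 4)) hκ0).exists_bound_of_continuous hκc
  have hrκ : ∀ a b : ℝ, 0 < a → Integrable (fun p => r p * κ p.2) (rectMeasure a b Z) := by
    intro a b ha
    obtain ⟨M, hM⟩ := hκb
    exact (hri a b ha).mul_bdd (c := M) (hκc.comp continuous_snd).aestronglyMeasurable
      (Eventually.of_forall fun p => hM p.2)
  have hti : ∀ a b : ℝ, 0 < a → IntegrableOn t (Icc a b) := fun a b ha =>
    Integrable.integral_prod_left (hrκ a b ha)
  have hti2 : ∀ a b : ℝ, 0 < a → Integrable (fun p : ℝ × ℝ => t p.1) (rectMeasure a b Z) :=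
    fun a b ha => Integrable.comp_fst (hti a b ha) (volume.restrict (Ioo 0 Z))
  refine ⟨t, hti, ?_⟩
  have hloc : ∀ F : ℝ × ℝ → ℝ, (∀ a b : ℝ, 0 < a → Integrable F (rectMeasure a b Z)) →
      LocallyIntegrableOn F (Dom (Z : EReal)) := by
    intro F hF
    refine (locallyIntegrableOn_iff (isOpen_dom _).isLocallyClosed).2 fun K hK hc => ?_
    obtain ⟨a, b, ha, hab, hS, _, hz⟩ := exists_rectangle hc hK
    have := hF a b ha
    rw [rectMeasure_eq] at this
    refine IntegrableOn.mono_set this fun p hp => ⟨(hS hp).1, ?_⟩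
    have := hz (hS hp).2
    rwa [zRange_coe] at this
  have key : r =ᵐ[mu (Z : EReal)] fun p => t p.1 := by
    refine ae_eq_of_test (hloc _ hri) (hloc _ hti2) fun F hF => ?_
    obtain ⟨a, b, S, ha, hab, hS, hSd, h0, h1, h2⟩ := hF.exists_bounds
    have hy0 : ∀ y z, y ∉ Icc a b → F (y, z) = 0 := fun y z hy => by
      by_cases hya : a ≤ y
      · exact h1 y z (not_le.1 fun h => hy ⟨hya, h⟩)
      · exact h0 y z (not_le.1 hya)
    obtain ⟨P, hPs, hPd, hP⟩ := exists_smooth_primZ hF.smooth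
    -- `m y` is the integral of `F (y, ·)`; the test `F - κ m` has a primitive with compact support.
    let m : ℝ → ℝ := fun y => P (y, Z)
    have hms : ContDiff ℝ ∞ m := hPs.comp (contDiff_id.prodMk contDiff_const)
    have hm : ∀ y, m y = ∫ z in Ioo 0 Z, F (y, z) := fun y => by
      simp only [m]
      rw [hP, intervalIntegral.integral_of_le hZ.le, integral_Ioc_eq_integral_Ioo]
    have hm0 : ∀ y, y ∉ Icc a b → m y = 0 := fun y hy => by
      rw [hm]; simp [hy0 y _ hy]
    let G : ℝ × ℝ → ℝ := fun p => F p - κ p.2 * m p.1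
    have hGs : ContDiff ℝ ∞ G := hF.smooth.sub
      ((hκs.comp contDiff_snd).mul (hms.comp contDiff_fst))
    obtain ⟨φ, hφs, hφd, hφ⟩ := exists_smooth_primZ hGs
    -- A common range of `z` for `F` and `κ`.
    obtain ⟨z₁, z₂, hz₁, hz₂, hSz⟩ : ∃ z₁ z₂ : ℝ, 0 < z₁ ∧ z₂ < Z ∧
        S ∪ Icc (Z / 4) (3 * Z / 4) ⊆ Icc z₁ z₂ := by
      have hc : IsCompact (S ∪ Icc (Z / 4) (3 * Z / 4)) := hS.union isCompact_Icc
      have hne : (S ∪ Icc (Z / 4) (3 * Z / 4)).Nonempty :=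
        ⟨Z / 2, Or.inr ⟨by linarith, by linarith⟩⟩
      have hsub : S ∪ Icc (Z / 4) (3 * Z / 4) ⊆ Ioo 0 Z := by
        rw [zRange_coe] at hSd
        exact union_subset hSd fun z hz => ⟨by linarith [hz.1], by linarith [hz.2]⟩
      obtain ⟨z₁, h1, h1'⟩ := hc.exists_isLeast hne
      obtain ⟨z₂, h2, h2'⟩ := hc.exists_isGreatest hne
      exact ⟨z₁, z₂, (hsub h1).1, (hsub h2).2, fun z hz => ⟨h1' hz, h2' hz⟩⟩
    have hG0 : ∀ y z, z ∉ Icc z₁ z₂ → G (y, z) = 0 := fun y z hz => by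
      simp only [G]
      rw [h2 y z fun h => hz (hSz (Or.inl h)), hκ0 z fun h => hz (hSz (Or.inr h))]; simp
    have hGi : ∀ y u v, IntervalIntegrable (fun s => G (y, s)) volume u v := fun y u v =>
      (hGs.continuous.comp (by fun_prop)).intervalIntegrable _ _
    have hφZ : ∀ y, φ (y, Z) = 0 := fun y => by
      rw [hφ, intervalIntegral.integral_of_le hZ.le, integral_Ioc_eq_integral_Ioo]
      simp only [G]
      have i1 : IntegrableOn (fun z => F (y, z)) (Ioo 0 Z) :=
        ((hF.continuous.comp (by fun_prop : Continuous fun z : ℝ => (y, z))).continuousOn.integrableOn_Icc).mono_set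
          Ioo_subset_Icc_self
      have i2 : IntegrableOn (fun z => κ z * m y) (Ioo 0 Z) :=
        ((hκc.mul continuous_const).continuousOn.integrableOn_Icc).mono_set Ioo_subset_Icc_self
      rw [integral_sub i1 i2, integral_mul_const, hκi, hm, one_mul, sub_self]
    have hφt : IsTest (Dom (Z : EReal)) φ := by
      refine isTest_dom_of_rectangle (a := a) (b := b) (Z := Icc z₁ z₂) hφs ha isCompact_Icc
        (by rw [zRange_coe]; exact fun z hz => ⟨hz₁.trans_le hz.1, hz.2.trans_lt hz₂⟩) ?_ ?_ ?_
      · intro y z hy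
        have hy' : y ∉ Icc a b := fun h => (hy.trans_le h.1).false
        rw [hφ]
        simp [G, hy0 y _ hy', hm0 y hy']
      · intro y z hy
        have hy' : y ∉ Icc a b := fun h => (hy.trans_le h.2).false
        rw [hφ]
        simp [G, hy0 y _ hy', hm0 y hy']
      · intro y z hz
        by_cases hz1 : z₁ ≤ z
        · have hz2 : z₂ < z := not_le.1 fun h => hz ⟨hz1, h⟩
          have e : φ (y, z) = φ (y, Z) + ∫ s in Z..z, G (y, s) := by
            rw [hφ, hφ, intervalIntegral.integral_add_adjacent_intervals (hGi _ _ _) (hGi _ _ _)]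
          rw [e, hφZ, zero_add]
          refine intervalIntegral.integral_zero_ae (Eventually.of_forall fun s hs => hG0 y s ?_)
          intro h
          have : min Z z < s := hs.1
          have := lt_min hz₂ hz2
          linarith [h.2]
        · rw [hφ]
          refine intervalIntegral.integral_zero_ae (Eventually.of_forall fun s hs => hG0 y s ?_)
          intro h
          have h3 : s ≤ max 0 z := hs.2
          have := max_lt hz₁ (not_le.1 hz1)
          linarith [h.1]
    have hrφ : ∫ p, r p * G p ∂rectMeasure a b Z = 0 := by
      have hφ0 : ∀ y z, y ∉ Icc a b → φ (y, z) = 0 := fun y z hy => by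
        rw [hφ]; simp [G, hy0 y _ hy, hm0 y hy]
      have hG0' : ∀ y z, y ∉ Icc a b → G (y, z) = 0 := fun y z hy => by
        simp [G, hy0 y _ hy, hm0 y hy]
      have e1 := hfg φ hφt
      rw [hφd] at e1
      change ∫ p, f p * G p ∂mu (Z : EReal) = -∫ p, g p * φ p ∂mu (Z : EReal) at e1
      rw [integral_mu_eq_rect (a := a) (b := b) ha fun y z hy => by rw [hG0' y z hy, mul_zero],
        integral_mu_eq_rect (a := a) (b := b) ha fun y z hy => by rw [hφ0 y z hy, mul_zero]] at e1
      have e2 := integral_primZ_mul_dz hg (hgi a b ha) hφt hφZ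
      rw [hφd] at e2
      have hGc : HasCompactSupport G := hφd ▸ hφt.dz.compact
      simp only [r, sub_mul]
      rw [integral_sub (bdd (hfi a b ha) hGs.continuous hGc)
        (bdd (integrable_primZ hg (hgi a b ha)) hGs.continuous hGc), e1, e2, sub_self]
    rw [integral_mu_eq_rect (a := a) (b := b) ha fun y z hy => by rw [hy0 y z hy, mul_zero],
      integral_mu_eq_rect (a := a) (b := b) ha fun y z hy => by rw [hy0 y z hy, mul_zero]]
    have hmc : HasCompactSupport m := HasCompactSupport.intro (isCompact_Icc (a := a) (b := b)) hm0
    have i1 := bdd (hri a b ha) hF.continuous hF.compact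
    have i2 : Integrable (fun p => r p * κ p.2 * m p.1) (rectMeasure a b Z) := by
      obtain ⟨M, hM⟩ := hmc.exists_bound_of_continuous hms.continuous
      exact (hrκ a b ha).mul_bdd (c := M) (hms.continuous.comp continuous_fst).aestronglyMeasurable
        (Eventually.of_forall fun p => hM p.1)
    have i3 := bdd (hti2 a b ha) hF.continuous hF.compact
    have e3 : ∫ p, r p * F p ∂rectMeasure a b Z = ∫ p, r p * κ p.2 * m p.1 ∂rectMeasure a b Z := by
      rw [← sub_eq_zero, ← integral_sub i1 i2, ← hrφ]
      refine integral_congr_ae (Eventually.of_forall fun p => ?_)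
      simp only [G]; ring
    rw [e3]
    simp only [rectMeasure] at i2 i3 ⊢
    rw [integral_prod _ i2, integral_prod _ i3]
    refine integral_congr_ae (Eventually.of_forall fun y => ?_)
    simp only
    rw [integral_mul_const, integral_const_mul, hm]
  filter_upwards [key] with p hp
  simp only [r] at hp
  linarith

end

section

variable {c : ℝ} {h : EReal}

theorem HasWeakDz.mono {h h' : EReal} (hh : h ≤ h') {f g : ℝ × ℝ → ℝ}
    (hfg : HasWeakDz (Dom h') f g) : HasWeakDz (Dom h) f g := by
  intro φ hφ
  have hs := dom_mono hh
  have h1 := hfg φ (hφ.mono hs)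
  rwa [setIntegral_eq_of_subset_of_forall_sdiff_eq_zero (measurableSet_dom h') hs
      (fun p hp => by rw [hφ.dz.eq_zero hp.2, mul_zero]),
    setIntegral_eq_of_subset_of_forall_sdiff_eq_zero (measurableSet_dom h') hs
      (fun p hp => by rw [hφ.eq_zero hp.2, mul_zero])] at h1

/-- The mean oscillation in a layer is estimated by the integral of `g = ∂_z f` over the layer. -/
theorem hasTrace_of_le {Z z₀ : ℝ} {f g : ℝ × ℝ → ℝ} {τ : ℝ → ℝ}
    (hg : StronglyMeasurable g) (hgi : ∀ a b : ℝ, 0 < a → Integrable g (rectMeasure a b Z))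
    (hτ : ∀ a b : ℝ, 0 < a → IntegrableOn τ (Icc a b))
    (hlayer : ∀ᶠ η in 𝓝[>] (0 : ℝ), ∀ p ∈ Dom h, |p.2 - z₀| < η → p ∈ Dom (Z : EReal))
    (hb : ∀ᵐ p ∂mu (Z : EReal), ‖f p - τ p.1‖ₑ
      ≤ ∫⁻ s in Ioo 0 Z ∩ {s | |s - z₀| ≤ |p.2 - z₀|}, ‖g (p.1, s)‖ₑ) :
    HasTrace h f z₀ τ := by
  refine ⟨locallyIntegrableOn_Ioi hτ, fun a b ha hab => ?_⟩
  let S : ℝ → Set ℝ := fun η => {s | |s - z₀| < η}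
  have hSm : ∀ η, MeasurableSet (S η) := fun η =>
    measurableSet_lt (by fun_prop) measurable_const
  have hSv : ∀ η, volume (S η) ≤ ENNReal.ofReal (2 * η) := fun η => by
    have : S η = Metric.ball z₀ η := by ext s; simp [S, Real.dist_eq]
    rw [this, Real.volume_ball]
  let A : ℝ → ENNReal := fun η => ∫⁻ p in Prod.snd ⁻¹' S η, ‖g p‖ₑ ∂rectMeasure a b Z
  have hA : Tendsto A (𝓝[>] 0) (𝓝 0) := by
    refine tendsto_setLIntegral_zero (hgi a b ha).2.ne ?_
    have hle : ∀ η, rectMeasure a b Z (Prod.snd ⁻¹' S η)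
        ≤ ENNReal.ofReal (b - a) * ENNReal.ofReal (2 * η) := fun η => by
      rw [rectMeasure, ← univ_prod, Measure.prod_prod, Measure.restrict_apply_univ,
        Real.volume_Icc]
      gcongr
      exact (Measure.restrict_apply_le _ _).trans (hSv η)
    refine tendsto_of_tendsto_of_tendsto_of_le_of_le tendsto_const_nhds ?_
      (fun _ => zero_le) hle
    have h1 : Tendsto (fun η : ℝ => ENNReal.ofReal (2 * η)) (𝓝[>] 0) (𝓝 0) := by
      have : Continuous fun η : ℝ => ENNReal.ofReal (2 * η) :=
        ENNReal.continuous_ofReal.comp (by fun_prop)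
      have h2 := this.tendsto 0
      simp only [mul_zero, ENNReal.ofReal_zero] at h2
      exact h2.mono_left nhdsWithin_le_nhds
    have h3 := ENNReal.Tendsto.const_mul (a := ENNReal.ofReal (b - a)) h1 (Or.inr ENNReal.ofReal_ne_top)
    simpa using h3
  have h2A : Tendsto (fun η => 2 * A η) (𝓝[>] 0) (𝓝 0) := by
    have := ENNReal.Tendsto.const_mul (a := 2) hA (Or.inr (by norm_num))
    simpa using this
  refine tendsto_of_tendsto_of_tendsto_of_le_of_le' tendsto_const_nhds h2A
    (Eventually.of_forall fun _ => zero_le) ?_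
  filter_upwards [hlayer, self_mem_nhdsWithin] with η hη hη0
  have hη0 : 0 < η := hη0
  let N : ℝ → ENNReal := fun y => ∫⁻ s in S η, ‖g (y, s)‖ₑ ∂(volume.restrict (Ioo 0 Z))
  have hgm : Measurable fun p : ℝ × ℝ => ‖g p‖ₑ := hg.measurable.enorm
  have hNm : Measurable N := hgm.lintegral_prod_right'
  have hprod : (rectMeasure a b Z).restrict (Prod.snd ⁻¹' S η)
      = (volume.restrict (Icc a b)).prod ((volume.restrict (Ioo 0 Z)).restrict (S η)) := by
    rw [rectMeasure, ← univ_prod, ← Measure.prod_restrict, Measure.restrict_univ]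
  have hmain : ∫⁻ p in {p : ℝ × ℝ | a < p.1 ∧ p.1 < b ∧ |p.2 - z₀| < η}, ‖f p - τ p.1‖ₑ ∂mu h
      ≤ ∫⁻ p in Prod.snd ⁻¹' S η, N p.1 ∂rectMeasure a b Z := by
    have hmL : MeasurableSet {p : ℝ × ℝ | a < p.1 ∧ p.1 < b ∧ |p.2 - z₀| < η} :=
      (measurableSet_lt measurable_const measurable_fst).inter
        ((measurableSet_lt measurable_fst measurable_const).inter
          (measurableSet_lt (measurable_snd.sub_const z₀).abs measurable_const))
    have hmS : MeasurableSet (Prod.snd ⁻¹' S η : Set (ℝ × ℝ)) := (hSm η).preimage measurable_snd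
    calc ∫⁻ p in {p : ℝ × ℝ | a < p.1 ∧ p.1 < b ∧ |p.2 - z₀| < η}, ‖f p - τ p.1‖ₑ ∂mu h
        ≤ ∫⁻ p in Prod.snd ⁻¹' S η, ‖f p - τ p.1‖ₑ ∂rectMeasure a b Z := by
          refine lintegral_mono' ?_ le_rfl
          rw [mu, Measure.restrict_restrict hmL, rectMeasure_eq, Measure.restrict_restrict hmS]
          refine Measure.restrict_mono (fun p hp => ?_) le_rfl
          obtain ⟨⟨hp1, hp2, hp3⟩, hp4⟩ := hp
          have := hη p hp4 hp3
          rw [dom_eq, zRange_coe] at this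
          exact ⟨hp3, ⟨hp1.le, hp2.le⟩, this.2⟩
      _ ≤ ∫⁻ p in Prod.snd ⁻¹' S η, N p.1 ∂rectMeasure a b Z := by
          refine lintegral_mono_ae ?_
          have hb' : ∀ᵐ p ∂rectMeasure a b Z, ‖f p - τ p.1‖ₑ
              ≤ ∫⁻ s in Ioo 0 Z ∩ {s | |s - z₀| ≤ |p.2 - z₀|}, ‖g (p.1, s)‖ₑ := by
            rw [rectMeasure_eq]
            exact ae_mono (Measure.restrict_mono (rect_subset_dom ha) le_rfl) hb
          filter_upwards [ae_restrict_of_ae hb', ae_restrict_mem hmS] with p hp1 hp2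
          refine hp1.trans ?_
          simp only [N]
          rw [Measure.restrict_restrict (hSm η)]
          refine lintegral_mono_set fun s hs => ⟨?_, hs.1⟩
          exact lt_of_le_of_lt (show |s - z₀| ≤ |p.2 - z₀| from hs.2)
            (show |p.2 - z₀| < η from hp2)
  have hN : ∫⁻ p in Prod.snd ⁻¹' S η, N p.1 ∂rectMeasure a b Z
      ≤ ENNReal.ofReal (2 * η) * A η := by
    simp only [A]
    rw [hprod, lintegral_prod (fun p : ℝ × ℝ => N p.1) (hNm.comp measurable_fst).aemeasurable,
      lintegral_prod _ hgm.aemeasurable]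
    simp only [lintegral_const]
    rw [lintegral_mul_const _ hNm, mul_comm]
    gcongr
    rw [Measure.restrict_apply_univ]
    exact (Measure.restrict_apply_le _ _).trans (hSv η)
  calc (ENNReal.ofReal η)⁻¹ * _ ≤ (ENNReal.ofReal η)⁻¹ * (ENNReal.ofReal (2 * η) * A η) := by
        gcongr; exact hmain.trans hN
    _ = 2 * A η := by
        rw [ENNReal.ofReal_mul (by norm_num), ← mul_assoc, ENNReal.ofReal_ofNat,
          mul_comm (2 : ENNReal), ← mul_assoc,
          ENNReal.inv_mul_cancel (by simpa using hη0) ENNReal.ofReal_ne_top, one_mul]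

theorem enorm_primZ_le (g : ℝ × ℝ → ℝ) (y z : ℝ) :
    ‖primZ g (y, z)‖ₑ ≤ ∫⁻ s in Ioo 0 z, ‖g (y, s)‖ₑ := enorm_integral_le_lintegral_enorm _

theorem H2Loc.exists_dz {f : ℝ × ℝ → ℝ} (hf : H2Loc h f) :
    ∃ g, StronglyMeasurable g ∧ HasWeakDz (Dom h) f g ∧ L2Loc h g := by
  obtain ⟨_, _, fz, _, hz, _, hz1⟩ := hf
  have hm := hz1.1.aestronglyMeasurable
  refine ⟨hm.mk fz, hm.stronglyMeasurable_mk, fun φ hφ => ?_, fun K hK hKs => ?_⟩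
  · rw [hz φ hφ]
    congr 1
    exact integral_congr_ae (by filter_upwards [hm.ae_eq_mk] with p hp; rw [hp])
  · exact (hz1.1 K hK hKs).ae_eq (ae_restrict_of_ae hm.ae_eq_mk)

/-- `H²_loc` functions have traces at the lower boundary. -/
theorem H2Loc.exists_trace_bottom {f : ℝ × ℝ → ℝ} (hf : H2Loc h f) {Z : ℝ} (hZ : 0 < Z)
    (hZh : (Z : EReal) ≤ h) : ∃ t, HasTrace h f 0 t := by
  obtain ⟨g, hgm, hg, hgl⟩ := hf.exists_dz
  have hgi := fun a b (ha : 0 < a) => hgl.integrable_rect (b := b) ha hZh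
  obtain ⟨t, ht, he⟩ := exists_eq_add_primZ hZ hgm
    (fun a b ha => hf.1.integrable_rect ha hZh) hgi (hg.mono hZh)
  refine ⟨t, hasTrace_of_le hgm hgi ht ?_ ?_⟩
  · filter_upwards [Ioo_mem_nhdsGT hZ] with η hη p hp hpη
    refine ⟨hp.1, hp.2.1, ?_⟩
    rw [sub_zero] at hpη
    exact EReal.coe_lt_coe_iff.2 ((le_abs_self _).trans_lt (hpη.trans hη.2))
  · filter_upwards [he, ae_mem_dom _] with p hp hpd
    rw [hp, add_sub_cancel_left]
    refine (enorm_primZ_le g p.1 p.2).trans (lintegral_mono_set fun s hs => ?_)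
    have hpZ : p.2 < Z := EReal.coe_lt_coe_iff.1 hpd.2.2
    refine ⟨⟨hs.1, hs.2.trans hpZ⟩, ?_⟩
    simp only [sub_zero, mem_ofPred_eq]
    rw [abs_of_pos hs.1, abs_of_pos hpd.2.1]
    exact hs.2.le

theorem ae_integrableOn_slice {g : ℝ × ℝ → ℝ} {Z : ℝ}
    (hg : ∀ a b : ℝ, 0 < a → Integrable g (rectMeasure a b Z)) :
    ∀ᵐ y ∂volume.restrict (Ioi (0 : ℝ)), IntegrableOn (fun s => g (y, s)) (Ioo 0 Z) := by
  have h1 : Ioi (0 : ℝ) ⊆ ⋃ n : ℕ, Icc (1 / ((n : ℝ) + 1)) n := fun y hy => by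
    have hy : (0 : ℝ) < y := hy
    obtain ⟨n, hn⟩ := exists_nat_one_div_lt hy
    obtain ⟨m, hm⟩ := exists_nat_ge y
    refine mem_iUnion.2 ⟨max n m, ?_, hm.trans (by exact_mod_cast le_max_right n m)⟩
    refine le_trans ?_ hn.le
    have : (n : ℝ) ≤ (max n m : ℕ) := by exact_mod_cast le_max_left n m
    gcongr
  refine ae_restrict_of_ae_restrict_of_subset h1 ?_
  rw [ae_restrict_iUnion_iff]
  exact fun n => Integrable.prod_right_ae (hg _ _ (by positivity))

/-- `H²_loc` functions have traces at the upper boundary of a strip. -/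
theorem H2Loc.exists_trace_top {H : ℝ} (hH : 0 < H) {f : ℝ × ℝ → ℝ} (hf : H2Loc (H : EReal) f) :
    ∃ t, HasTrace (H : EReal) f H t := by
  obtain ⟨g, hgm, hg, hgl⟩ := hf.exists_dz
  have hgi := fun a b (ha : 0 < a) => hgl.integrable_rect (b := b) ha le_rfl
  obtain ⟨t, ht, he⟩ := exists_eq_add_primZ hH hgm
    (fun a b ha => hf.1.integrable_rect ha le_rfl) hgi hg
  have hT : ∀ a b : ℝ, 0 < a → IntegrableOn (fun y => ∫ s in Ioo 0 H, g (y, s)) (Icc a b) :=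
    fun a b ha => Integrable.integral_prod_left (hgi a b ha)
  have hae := ae_integrableOn_slice hgi
  refine ⟨fun y => t y + ∫ s in Ioo 0 H, g (y, s), hasTrace_of_le hgm hgi
    (fun a b ha => (ht a b ha).add (hT a b ha)) (Eventually.of_forall fun η p hp _ => hp) ?_⟩
  have hae' : ∀ᵐ p ∂mu (H : EReal), IntegrableOn (fun s => g (p.1, s)) (Ioo 0 H) := by
    rw [mu_eq]
    exact Measure.quasiMeasurePreserving_fst.ae hae
  filter_upwards [he, ae_mem_dom _, hae'] with p hp hpd hpi
  have hpH : p.2 < H := EReal.coe_lt_coe_iff.1 hpd.2.2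
  have hsplit : ∫ s in Ioo 0 H, g (p.1, s) = primZ g p + ∫ s in Ico p.2 H, g (p.1, s) := by
    rw [primZ, ← setIntegral_union _ measurableSet_Ico (hpi.mono_set (Ioo_subset_Ioo_right hpH.le))
      (hpi.mono_set fun s hs => ⟨hpd.2.1.trans_le hs.1, hs.2⟩), Ioo_union_Ico_eq_Ioo hpd.2.1 hpH.le]
    exact disjoint_left.2 fun s hs hs' => (hs.2.trans_le hs'.1).false
  rw [hp, hsplit]
  have e : t p.1 + primZ g p - (t p.1 + (primZ g p + ∫ s in Ico p.2 H, g (p.1, s)))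
      = -∫ s in Ico p.2 H, g (p.1, s) := by ring
  rw [e, enorm_neg]
  refine (enorm_integral_le_lintegral_enorm _).trans (lintegral_mono_set fun s hs => ?_)
  refine ⟨⟨hpd.2.1.trans_le hs.1, hs.2⟩, ?_⟩
  simp only [mem_ofPred_eq]
  rw [abs_sub_comm, abs_of_pos (sub_pos.2 hs.2), abs_sub_comm, abs_of_pos (sub_pos.2 hpH)]
  linarith [hs.1]

/-! ### Tests concentrated in a layer -/

/-- The test `g(y) η((z - z₀) / δ)`. -/
def layerTest (g η : ℝ → ℝ) (z₀ δ : ℝ) : ℝ × ℝ → ℝ := fun p => g p.1 * η ((p.2 - z₀) / δ)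

theorem IsTest.exists_bounds_Ioi {g : ℝ → ℝ} (hg : IsTest (Ioi 0) g) :
    ∃ a b : ℝ, 0 < a ∧ a < b ∧ tsupport g ⊆ Icc a b := by
  rcases (tsupport g).eq_empty_or_nonempty with h0 | hne
  · exact ⟨1, 2, one_pos, by norm_num, by rw [h0]; exact empty_subset _⟩
  · obtain ⟨a, ha, ha'⟩ := hg.compact.isCompact.exists_isLeast hne
    obtain ⟨b, hb, hb'⟩ := hg.compact.isCompact.exists_isGreatest hne
    exact ⟨a, b + 1, hg.supp ha, by linarith [ha' hb], fun x hx => ⟨ha' hx, by linarith [hb' hx]⟩⟩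

theorem IsTest.deriv_Ioi {g : ℝ → ℝ} (hg : IsTest (Ioi 0) g) : IsTest (Ioi 0) (deriv g) :=
  ⟨(contDiff_infty_iff_deriv.1 hg.smooth).2, hg.compact.deriv,
    tsupport_deriv_subset.trans hg.supp⟩

section layer

variable {g η : ℝ → ℝ} {z₀ δ : ℝ}

theorem tsupport_layerTest_subset (hg : IsTest (Ioi 0) g) (hη : ∀ s, 1 / 2 < |s| → η s = 0)
    (hδ : 0 < δ) :
    tsupport (layerTest g η z₀ δ) ⊆ tsupport g ×ˢ Icc (z₀ - δ / 2) (z₀ + δ / 2) := by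
  refine closure_minimal (fun p hp => ?_) (hg.compact.isCompact.isClosed.prod isClosed_Icc)
  by_contra hn
  refine hp ?_
  by_cases h1 : p.1 ∈ tsupport g
  · have : 1 / 2 < |(p.2 - z₀) / δ| := by
      rw [abs_div, abs_of_pos hδ, lt_div_iff₀ hδ]
      by_contra hlt
      have := abs_le.1 (not_lt.1 hlt)
      exact hn ⟨h1, by linarith [this.1], by linarith [this.2]⟩
    simp [layerTest, hη _ this]
  · simp [layerTest, image_eq_zero_of_notMem_tsupport h1]

theorem layerTest_isTest (hg : IsTest (Ioi 0) g) (hηs : ContDiff ℝ ∞ η)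
    (hη : ∀ s, 1 / 2 < |s| → η s = 0) (hδ : 0 < δ) {Q : Set (ℝ × ℝ)}
    (hQ : Ioi 0 ×ˢ Icc (z₀ - δ / 2) (z₀ + δ / 2) ⊆ Q) : IsTest Q (layerTest g η z₀ δ) := by
  have hs := tsupport_layerTest_subset (z₀ := z₀) hg hη hδ
  refine ⟨?_, ?_, hs.trans ((prod_mono hg.supp subset_rfl).trans hQ)⟩
  · exact (hg.smooth.comp contDiff_fst).mul
      (hηs.comp ((contDiff_snd.sub contDiff_const).div_const δ))
  · exact (hg.compact.isCompact.prod isCompact_Icc).of_isClosed_subset (isClosed_tsupport _) hs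

theorem layerTest_half (hg : IsTest (Ioi 0) g) (hηs : ContDiff ℝ ∞ η)
    (hη : ∀ s, 1 / 2 < |s| → η s = 0) (hδ : 0 < δ) : HalfTest (layerTest g η z₀ δ) :=
  layerTest_isTest hg hηs hη hδ fun _ hp => hp.1

theorem dy_layerTest (hg : IsTest (Ioi 0) g) (hηs : ContDiff ℝ ∞ η) :
    dy (layerTest g η z₀ δ) = layerTest (deriv g) η z₀ δ := by
  funext ⟨y, z⟩
  have hd : Differentiable ℝ (layerTest g η z₀ δ) :=
    ((hg.smooth.comp contDiff_fst).mul
      (hηs.comp ((contDiff_snd.sub contDiff_const).div_const δ))).differentiable (by simp)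
  exact dy_eq hd
    (((hg.smooth.differentiable (by simp)) y).hasDerivAt.mul_const (η ((z - z₀) / δ)))

theorem dz_layerTest (hg : IsTest (Ioi 0) g) (hηs : ContDiff ℝ ∞ η) :
    dz (layerTest g η z₀ δ) = fun p => δ⁻¹ * layerTest g (deriv η) z₀ δ p := by
  funext ⟨y, z⟩
  have hd : Differentiable ℝ (layerTest g η z₀ δ) :=
    ((hg.smooth.comp contDiff_fst).mul
      (hηs.comp ((contDiff_snd.sub contDiff_const).div_const δ))).differentiable (by simp)
  refine dz_eq hd ?_
  have h1 : HasDerivAt (fun z : ℝ => (z - z₀) / δ) (1 / δ) z :=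
    ((hasDerivAt_id' z).sub_const z₀).div_const δ
  have h2 := ((hηs.differentiable (by simp)) ((z - z₀) / δ)).hasDerivAt.comp z h1
  have h3 := h2.const_mul (g y)
  refine h3.congr_deriv ?_
  simp only [layerTest]; ring

/-- Integrals of a locally integrable function against layer tests tend to zero. -/
theorem tendsto_integral_layer {F : ℝ × ℝ → ℝ}
    (hF : LocallyIntegrableOn F {p : ℝ × ℝ | 0 < p.1} (mu h)) {G θ : ℝ → ℝ} {a b : ℝ} (ha : 0 < a)
    (hG : Continuous G) (hG0 : ∀ y, y ∉ Icc a b → G y = 0) (hθ : Continuous θ)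
    (hθ0 : ∀ s, 1 / 2 < |s| → θ s = 0) (z₀ : ℝ) :
    Tendsto (fun δ => ∫ p, F p * layerTest G θ z₀ δ p ∂mu h) (𝓝[>] 0) (𝓝 0) := by
  have hs : IsOpen {p : ℝ × ℝ | 0 < p.1} := isOpen_lt continuous_const continuous_fst
  have hFm : AEStronglyMeasurable F (mu h) := by
    have h2 := hF.aestronglyMeasurable
    rwa [Measure.restrict_eq_self_of_ae_mem] at h2
    filter_upwards [ae_mem_dom h] with p hp using hp.1
  obtain ⟨M, hM⟩ := (HasCompactSupport.intro (isCompact_Icc (a := a) (b := b))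
    hG0).exists_bound_of_continuous hG
  obtain ⟨M', hM'⟩ := (HasCompactSupport.intro (isCompact_Icc (a := -1) (b := 1))
    (fun s hs => hθ0 s (by
      by_contra hlt
      have := abs_le.1 (not_lt.1 hlt)
      exact hs ⟨by linarith [this.1], by linarith [this.2]⟩))).exists_bound_of_continuous hθ
  have hM0 : 0 ≤ M := (norm_nonneg _).trans (hM 0)
  have hM0' : 0 ≤ M' := (norm_nonneg _).trans (hM' 0)
  let K : Set (ℝ × ℝ) := Icc a b ×ˢ Icc (z₀ - 1) (z₀ + 1)
  have hKm : MeasurableSet K := measurableSet_Icc.prod measurableSet_Icc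
  have hK : IsCompact K := isCompact_Icc.prod isCompact_Icc
  have hFK : IntegrableOn F K (mu h) :=
    hF.integrableOn_compact_subset (fun p hp => ha.trans_le hp.1.1) hK
  have h0 : ∫ p, (0 : ℝ) ∂mu h = 0 := by simp
  refine Eq.subst (motive := fun r => Tendsto _ _ (𝓝 r)) h0 ?_
  refine tendsto_integral_filter_of_dominated_convergence
    (fun p => (M * M') * K.indicator (fun p => ‖F p‖) p) ?_ ?_ ?_ ?_
  · refine Eventually.of_forall fun δ => hFm.mul ?_
    exact (by unfold layerTest; fun_prop : Continuous (layerTest G θ z₀ δ)).aestronglyMeasurable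
  · filter_upwards [Ioo_mem_nhdsGT (zero_lt_one' ℝ)] with δ hδ
    refine Eventually.of_forall fun p => ?_
    have hn : ‖layerTest G θ z₀ δ p‖ ≤ M * M' := by
      rw [layerTest, norm_mul]
      exact mul_le_mul (hM _) (hM' _) (norm_nonneg _) hM0
    by_cases hp : p ∈ K
    · rw [indicator_of_mem hp, norm_mul, mul_comm]
      exact mul_le_mul_of_nonneg_right hn (norm_nonneg _)
    · have : layerTest G θ z₀ δ p = 0 := by
        by_cases hy : p.1 ∈ Icc a b
        · have : 1 / 2 < |(p.2 - z₀) / δ| := by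
            rw [abs_div, abs_of_pos hδ.1, lt_div_iff₀ hδ.1]
            by_contra hlt
            have h1 := abs_le.1 (not_lt.1 hlt)
            exact hp ⟨hy, by linarith [h1.1, hδ.2], by linarith [h1.2, hδ.2]⟩
          simp [layerTest, hθ0 _ this]
        · simp [layerTest, hG0 _ hy]
      rw [this]
      simp only [mul_zero, norm_zero]
      exact mul_nonneg (mul_nonneg hM0 hM0') (indicator_nonneg (fun _ _ => norm_nonneg _) _)
  · exact ((integrable_indicator_iff hKm).2 hFK.norm).const_mul _
  · have hne : ∀ᵐ p ∂mu h, p.2 ≠ z₀ := by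
      have h1 : ∀ᵐ z ∂volume.restrict (zRange h), z ≠ z₀ := by
        refine ae_restrict_of_ae ?_
        exact compl_mem_ae_iff.2 (measure_singleton z₀)
      rw [mu_eq]
      exact Measure.quasiMeasurePreserving_snd.ae h1
    filter_upwards [hne] with p hp
    refine tendsto_const_nhds.congr' ?_
    have hpos : 0 < |p.2 - z₀| := abs_pos.2 (sub_ne_zero.2 hp)
    filter_upwards [Ioo_mem_nhdsGT hpos] with δ hδ
    have : 1 / 2 < |(p.2 - z₀) / δ| := by
      rw [abs_div, abs_of_pos hδ.1, lt_div_iff₀ hδ.1]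
      linarith [hδ.2, hδ.1]
    simp [layerTest, hθ0 _ this]

/-- Integrals of a function against the `z`-derivatives of layer tests tend to an integral of its
trace. -/
theorem HasTrace.tendsto_integral {f : ℝ × ℝ → ℝ} {t : ℝ → ℝ} (hf : HasTrace h f z₀ t)
    (hfi : ∀ φ : ℝ × ℝ → ℝ, HalfTest φ → Integrable (fun p => f p * φ p) (mu h))
    (hg : IsTest (Ioi 0) g) (hηs : ContDiff ℝ ∞ η) (hη : ∀ s, 1 / 2 < |s| → η s = 0) {σ : ℝ}
    (hσ : ∀ᶠ δ in 𝓝[>] (0 : ℝ), ∫ z in zRange h, δ⁻¹ * deriv η ((z - z₀) / δ) = σ) :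
    Tendsto (fun δ => ∫ p, f p * dz (layerTest g η z₀ δ) p ∂mu h) (𝓝[>] 0)
      (𝓝 (σ * ∫ y in Ioi (0 : ℝ), t y * g y)) := by
  obtain ⟨a, b, ha, hab, hgs⟩ := hg.exists_bounds_Ioi
  have hg0 : ∀ y, y ∉ Icc a b → g y = 0 := fun y hy =>
    image_eq_zero_of_notMem_tsupport fun hh => hy (hgs hh)
  have hη' : ContDiff ℝ ∞ (deriv η) := (contDiff_infty_iff_deriv.1 hηs).2
  have hη0' : ∀ s, 1 / 2 < |s| → deriv η s = 0 := fun s hs => by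
    have : η =ᶠ[𝓝 s] fun _ => 0 := by
      filter_upwards [continuous_abs.continuousAt.eventually_const_lt hs] with r hr using hη r hr
    rw [this.deriv_eq]; simp
  obtain ⟨M, hM⟩ := hg.compact.exists_bound_of_continuous hg.continuous
  obtain ⟨M', hM'⟩ := (HasCompactSupport.intro (isCompact_Icc (a := -1) (b := 1))
    (fun s hs => hη0' s (by
      by_contra hlt
      have := abs_le.1 (not_lt.1 hlt)
      exact hs ⟨by linarith [this.1], by linarith [this.2]⟩))).exists_bound_of_continuous
        hη'.continuous
  have hM0 : 0 ≤ M := (norm_nonneg _).trans (hM 0)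
  have hM0' : 0 ≤ M' := (norm_nonneg _).trans (hM' 0)
  have htg : IntegrableOn (fun y => t y * g y) (Ioi 0) := by
    have h1 : IntegrableOn t (tsupport g) :=
      hf.1.integrableOn_compact_subset hg.supp hg.compact.isCompact
    have h2 : IntegrableOn (fun y => t y * g y) (tsupport g) :=
      h1.mul_continuousOn hg.continuous.continuousOn hg.compact.isCompact
    have h3 : Integrable (fun y => t y * g y) :=
      (integrableOn_iff_integrable_of_support_subset (fun y hy => by
        by_contra hn
        exact hy (by simp [image_eq_zero_of_notMem_tsupport hn]))).1 h2
    exact h3.integrableOn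
  have hti : ∀ δ : ℝ, 0 < δ → Integrable (fun p => t p.1 * dz (layerTest g η z₀ δ) p) (mu h) := by
    intro δ hδ
    have h1 : Integrable (fun z => δ⁻¹ * deriv η ((z - z₀) / δ)) (volume.restrict (zRange h)) := by
      refine Integrable.restrict (Continuous.integrable_of_hasCompactSupport (by fun_prop) ?_)
      refine HasCompactSupport.intro (isCompact_Icc (a := z₀ - δ) (b := z₀ + δ)) fun z hz => ?_
      have : 1 / 2 < |(z - z₀) / δ| := by
        rw [abs_div, abs_of_pos hδ, lt_div_iff₀ hδ]
        by_contra hlt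
        have h1 := abs_le.1 (not_lt.1 hlt)
        exact hz ⟨by linarith [h1.1], by linarith [h1.2]⟩
      rw [hη0' _ this, mul_zero]
    have h2 := htg.mul_prod h1
    rw [mu_eq]
    refine h2.congr (Eventually.of_forall fun p => ?_)
    simp only [dz_layerTest hg hηs, layerTest]; ring
  have hmain : ∀ᶠ δ in 𝓝[>] (0 : ℝ),
      ∫ p, t p.1 * dz (layerTest g η z₀ δ) p ∂mu h = σ * ∫ y in Ioi (0 : ℝ), t y * g y := by
    filter_upwards [hσ] with δ hδ
    rw [← hδ, mul_comm, mu_eq, ← integral_prod_mul]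
    refine integral_congr_ae (Eventually.of_forall fun p => ?_)
    simp only [dz_layerTest hg hηs, layerTest]; ring
  have hrest : Tendsto (fun δ => ∫ p, (f p - t p.1) * dz (layerTest g η z₀ δ) p ∂mu h)
      (𝓝[>] 0) (𝓝 0) := by
    have hlim := hf.2 (a / 2) (b + 1) (by positivity) (by linarith)
    have hlim2 := ENNReal.Tendsto.const_mul (a := ENNReal.ofReal (M * M')) hlim
      (Or.inr ENNReal.ofReal_ne_top)
    rw [mul_zero] at hlim2
    rw [tendsto_zero_iff_enorm_tendsto_zero]
    refine tendsto_of_tendsto_of_tendsto_of_le_of_le' tendsto_const_nhds hlim2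
      (Eventually.of_forall fun _ => zero_le) ?_
    filter_upwards [self_mem_nhdsWithin] with δ hδ
    have hδ : 0 < δ := hδ
    refine (enorm_integral_le_lintegral_enorm _).trans ?_
    set L : Set (ℝ × ℝ) := {p : ℝ × ℝ | a / 2 < p.1 ∧ p.1 < b + 1 ∧ |p.2 - z₀| < δ} with hL
    have hmL : MeasurableSet L :=
      (measurableSet_lt measurable_const measurable_fst).inter
        ((measurableSet_lt measurable_fst measurable_const).inter
          (measurableSet_lt (measurable_snd.sub_const z₀).abs measurable_const))
    calc ∫⁻ p, ‖(f p - t p.1) * dz (layerTest g η z₀ δ) p‖ₑ ∂mu h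
        ≤ ∫⁻ p, L.indicator (fun p => ENNReal.ofReal (M * M') * (ENNReal.ofReal δ)⁻¹
            * ‖f p - t p.1‖ₑ) p ∂mu h := by
          refine lintegral_mono fun p => ?_
          simp only [dz_layerTest hg hηs]
          by_cases hp : p ∈ L
          · rw [indicator_of_mem hp, enorm_mul, mul_comm]
            gcongr
            rw [enorm_mul, mul_comm]
            refine mul_le_mul' ?_ ?_
            · rw [← ofReal_norm]
              refine ENNReal.ofReal_le_ofReal ?_
              rw [layerTest, norm_mul]
              exact mul_le_mul (hM _) (hM' _) (norm_nonneg _) hM0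
            · rw [← ofReal_norm, norm_inv, Real.norm_of_nonneg hδ.le,
                ENNReal.ofReal_inv_of_pos hδ]
          · have : layerTest g (deriv η) z₀ δ p = 0 := by
              by_cases hy : p.1 ∈ Icc a b
              · have : 1 / 2 < |(p.2 - z₀) / δ| := by
                  rw [abs_div, abs_of_pos hδ, lt_div_iff₀ hδ]
                  by_contra hlt
                  exact hp ⟨by linarith [hy.1], by linarith [hy.2], by linarith⟩
                simp [layerTest, hη0' _ this]
              · simp [layerTest, hg0 _ hy]
            rw [this]; simp
      _ = ENNReal.ofReal (M * M') * ((ENNReal.ofReal δ)⁻¹ * ∫⁻ p in L, ‖f p - t p.1‖ₑ ∂mu h) := by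
          rw [lintegral_indicator hmL, lintegral_const_mul' _ _ (ENNReal.mul_ne_top
            ENNReal.ofReal_ne_top (by simpa using hδ)), mul_assoc]
  have hsum := hrest.add_const (σ * ∫ y in Ioi (0 : ℝ), t y * g y)
  rw [zero_add] at hsum
  refine hsum.congr' ?_
  filter_upwards [hmain, self_mem_nhdsWithin] with δ h1 h2
  have h2 : 0 < δ := h2
  have i1 := hfi _ (layerTest_half (z₀ := z₀) hg hηs hη h2).dz
  rw [← h1, ← integral_add _ (hti δ h2)]
  · exact integral_congr_ae (Eventually.of_forall fun p => by ring)
  · refine (i1.sub (hti δ h2)).congr (Eventually.of_forall fun p => ?_)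
    simp only [Pi.sub_apply]; ring

end layer

end

section

/-! ### The boundary conditions -/

variable {c : ℝ} {h : EReal}

theorem exists_bump : ∃ η : ℝ → ℝ, ContDiff ℝ ∞ η ∧ η 0 = 1 ∧ ∀ s, 1 / 2 < |s| → η s = 0 := by
  let f : ContDiffBump (0 : ℝ) := ⟨1 / 4, 1 / 2, by norm_num, by norm_num⟩
  refine ⟨f, f.contDiff, f.one_of_mem_closedBall (by simp [f]), fun s hs => ?_⟩
  refine f.zero_of_le_dist ?_
  simpa [f, Real.dist_eq] using hs.le

instance (h : EReal) : IsLocallyFiniteMeasure (mu h) :=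
  inferInstanceAs (IsLocallyFiniteMeasure (volume.restrict (Dom h)))

theorem locallyIntegrableOn_mul {f a : ℝ × ℝ → ℝ} {S : Set (ℝ × ℝ)} (hf : MemLp f 2 (mu h))
    (ha : Continuous a) (hS : IsOpen S) :
    LocallyIntegrableOn (fun p => a p * f p) S (mu h) := by
  have h1 : LocallyIntegrable f (mu h) := hf.locallyIntegrable (by norm_num)
  exact (h1.locallyIntegrableOn S).continuousOn_mul ha.continuousOn hS.isLocallyClosed

/-- The integral of a derivative across a layer. -/
theorem integral_zRange_deriv {η : ℝ → ℝ} (hηs : ContDiff ℝ ∞ η)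
    (hη : ∀ s, 1 / 2 < |s| → η s = 0) {z₀ Z δ : ℝ} (hZ : 0 < Z) (hδ : 0 < δ)
    (hh : ∀ z : ℝ, z ∈ zRange h → z ∉ Ioo 0 Z → δ < |z - z₀|) (hZh : (Z : EReal) ≤ h) :
    ∫ z in zRange h, δ⁻¹ * deriv η ((z - z₀) / δ) = η ((Z - z₀) / δ) - η ((0 - z₀) / δ) := by
  have hη' : ContDiff ℝ ∞ (deriv η) := (contDiff_infty_iff_deriv.1 hηs).2
  have hη0' : ∀ s, 1 / 2 < |s| → deriv η s = 0 := fun s hs => by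
    have : η =ᶠ[𝓝 s] fun _ => 0 := by
      filter_upwards [continuous_abs.continuousAt.eventually_const_lt hs] with r hr using hη r hr
    rw [this.deriv_eq]; simp
  have hsub : Ioo 0 Z ⊆ zRange h := fun z hz =>
    ⟨hz.1, (EReal.coe_lt_coe_iff.2 hz.2).trans_le hZh⟩
  rw [setIntegral_eq_of_subset_of_forall_sdiff_eq_zero (isOpen_zRange h).measurableSet hsub,
    ← integral_Ioc_eq_integral_Ioo, ← intervalIntegral.integral_of_le hZ.le]
  · have hc : Continuous fun z => δ⁻¹ * deriv η ((z - z₀) / δ) := by fun_prop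
    refine intervalIntegral.integral_eq_sub_of_hasDerivAt (f := fun z => η ((z - z₀) / δ))
      (fun z _ => ?_) (hc.intervalIntegrable _ _)
    have h1 : HasDerivAt (fun z : ℝ => (z - z₀) / δ) (1 / δ) z :=
      ((hasDerivAt_id' z).sub_const z₀).div_const δ
    have h2 := ((hηs.differentiable (by simp)) ((z - z₀) / δ)).hasDerivAt.comp z h1
    refine h2.congr_deriv ?_
    rw [mul_comm, one_div]
  · intro z hz
    have h1 := hh z hz.1 hz.2
    rw [hη0', mul_zero]
    rw [abs_div, abs_of_pos hδ, lt_div_iff₀ hδ]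
    linarith

/-- The weak formulation with test functions concentrated in a layer at `z = z₀`, as the thickness
tends to zero: only the boundary terms survive, with the factor `σ` (the outward orientation times
`η 0`). -/
theorem Problem.IsRegularSource.trace_pairing {P : Problem} {s : StrongDual ℝ (E1 P.height)}
    (hs : P.IsRegularSource s) {u : Energy c P.height} (hu : P.IsWeakSolution s u)
    {g k η tv tψ : ℝ → ℝ} {z₀ σ : ℝ} (hg : IsTest (Ioi 0) g) (hk : IsTest (Ioi 0) k)
    (hηs : ContDiff ℝ ∞ η) (hη : ∀ s, 1 / 2 < |s| → η s = 0)
    (hp : ∀ᶠ δ in 𝓝[>] (0 : ℝ), P.IsTestPair (layerTest g η z₀ δ) (layerTest k η z₀ δ))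
    (hσ : ∀ᶠ δ in 𝓝[>] (0 : ℝ), ∫ z in zRange P.height, δ⁻¹ * deriv η ((z - z₀) / δ) = σ)
    (hv : HasTrace P.height (vOf u) z₀ tv) (hψ : HasTrace P.height (psiOf u) z₀ tψ) :
    σ * ((∫ y in Ioi (0 : ℝ), tv y * k y) + ∫ y in Ioi (0 : ℝ), tψ y * g y) = 0 := by
  obtain ⟨ρ, σv, σψ, hσv, hσψ, hreg⟩ := hs
  have hopen : IsOpen {p : ℝ × ℝ | 0 < p.1} := isOpen_lt continuous_const continuous_fst
  have hlim : ∀ {F : ℝ × ℝ → ℝ}, LocallyIntegrableOn F {p : ℝ × ℝ | 0 < p.1} (mu P.height) →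
      ∀ {G : ℝ → ℝ}, IsTest (Ioi 0) G →
      Tendsto (fun δ => ∫ p, F p * layerTest G η z₀ δ p ∂mu P.height) (𝓝[>] 0) (𝓝 0) := by
    intro F hF G hG
    obtain ⟨a, b, ha, -, hsub⟩ := hG.exists_bounds_Ioi
    exact tendsto_integral_layer hF ha hG.continuous
      (fun y hy => image_eq_zero_of_notMem_tsupport fun hh => hy (hsub hh)) hηs.continuous hη z₀
  have hsq : ∀ {G : ℝ → ℝ}, IsTest (Ioi 0) G →
      Tendsto (fun δ => ∫ p, layerTest G η z₀ δ p ^ 2 ∂mu P.height) (𝓝[>] 0) (𝓝 0) := by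
    intro G hG
    obtain ⟨a, b, ha, -, hsub⟩ := hG.exists_bounds_Ioi
    have h1 := tendsto_integral_layer (h := P.height) (F := fun _ => 1) (b := b)
      ((locallyIntegrable_const (1 : ℝ)).locallyIntegrableOn _) ha (hG.continuous.pow 2)
      (fun y (hy : y ∉ Icc a b) => by
        simp [image_eq_zero_of_notMem_tsupport (f := G) fun hh => hy (hsub hh)])
      (hηs.continuous.pow 2) (fun s hs => by simp [hη s hs]) z₀
    refine h1.congr fun δ => integral_congr_ae (Eventually.of_forall fun p => ?_)
    simp only [layerTest, one_mul, mul_pow, Pi.pow_apply]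
  have hvint : ∀ φ : ℝ × ℝ → ℝ, HalfTest φ → Integrable (fun p => vOf u p * φ p) (mu P.height) :=
    fun φ hφ => vOf_mul_integrable u hφ
  have hψint : ∀ φ : ℝ × ℝ → ℝ, HalfTest φ → Integrable (fun p => psiOf u p * φ p) (mu P.height) :=
    fun φ hφ => psiOf_mul_integrable u hφ
  -- the transport terms and the diffusion terms on the left
  have hT : ∀ {f : ℝ × ℝ → ℝ} {t G : ℝ → ℝ}, HasTrace P.height f z₀ t →
      LocallyIntegrableOn (fun p => p.2 * f p) {p : ℝ × ℝ | 0 < p.1} (mu P.height) →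
      (∀ φ : ℝ × ℝ → ℝ, HalfTest φ → Integrable (fun p => f p * φ p) (mu P.height)) →
      IsTest (Ioi 0) G →
      Tendsto (fun δ => ∫ p, f p * transport (layerTest G η z₀ δ) p ∂mu P.height) (𝓝[>] 0)
        (𝓝 (σ * ∫ y in Ioi (0 : ℝ), t y * G y)) := by
    intro f t G hf hloc hint hG
    have h1 := (hf.tendsto_integral hint hG hηs hη hσ).add (hlim hloc hG.deriv_Ioi)
    rw [add_zero] at h1
    refine h1.congr' ?_
    filter_upwards [self_mem_nhdsWithin] with δ hδ
    have hL := layerTest_half (z₀ := z₀) hG hηs hη (show 0 < δ from hδ)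
    rw [← integral_add (hint _ hL.dz)]
    · refine integral_congr_ae (Eventually.of_forall fun p => ?_)
      simp only [transport, dy_layerTest hG hηs]; ring
    · refine (hint _ (hL.dy.mul_left (g := fun p : ℝ × ℝ => p.2) contDiff_snd)).congr
        (Eventually.of_forall fun p => ?_)
      simp only [dy_layerTest hG hηs]; ring
  have hloc : ∀ (i : Fin 4) {a : ℝ × ℝ → ℝ}, Continuous a →
      LocallyIntegrableOn (fun p => a p * u.1 i p) {p : ℝ × ℝ | 0 < p.1} (mu P.height) :=
    fun i a ha => locallyIntegrableOn_mul (u.memLp i) ha hopen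
  have hlocv : LocallyIntegrableOn (fun p => p.2 * vOf u p) {p : ℝ × ℝ | 0 < p.1} (mu P.height) := by
    have := hloc 0 (a := fun p => p.2 * (c + p.1)) (by fun_prop)
    simp only [mul_assoc] at this
    exact this
  have hlocψ : LocallyIntegrableOn (fun p => p.2 * psiOf u p) {p : ℝ × ℝ | 0 < p.1}
      (mu P.height) := by
    have := hloc 2 (a := fun p => p.2 * (c + p.1 ^ 2)) (by fun_prop)
    simp only [mul_assoc] at this
    exact this
  have hloc1 := hloc 1 (a := fun _ => 1) continuous_const
  have hloc3 := hloc 3 (a := fun _ => 1) continuous_const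
  simp only [one_mul] at hloc1 hloc3
  have hL : Tendsto (fun δ => weakForm u (layerTest g η z₀ δ) (layerTest k η z₀ δ)) (𝓝[>] 0)
      (𝓝 (-(σ * ((∫ y in Ioi (0 : ℝ), tv y * k y) + ∫ y in Ioi (0 : ℝ), tψ y * g y)))) := by
    have h1 := (hT hv hlocv hvint hk).add (hT hψ hlocψ hψint hg)
    have h2 := (hlim hloc1 hg.deriv_Ioi).add (hlim hloc3 hk.deriv_Ioi.deriv_Ioi)
    have h3 := h1.neg.sub (h2.const_mul (1 / 2))
    rw [add_zero, mul_zero, sub_zero, ← mul_add] at h3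
    refine h3.congr' ?_
    filter_upwards [self_mem_nhdsWithin] with δ hδ
    rw [weakForm_eq u (layerTest_half hg hηs hη hδ) (layerTest_half hk hηs hη hδ),
      dy_layerTest hg hηs, dy_layerTest hk hηs, dy_layerTest hk.deriv_Ioi hηs]
  -- the right-hand side is small
  have hE : Tendsto (fun δ => if hδ : 0 < δ then ρ (testEnergy le_rfl P.height
      (layerTest_half (z₀ := z₀) hg hηs hη hδ) (layerTest_half (z₀ := z₀) hk hηs hη hδ)) else 0)
      (𝓝[>] 0) (𝓝 0) := by
    have h1 := ((hsq hg.deriv_Ioi).add (hsq hk.deriv_Ioi.deriv_Ioi)).const_mul 5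
    have h2 := (h1.sqrt).const_mul ‖ρ‖
    simp only [add_zero, mul_zero, Real.sqrt_zero] at h2
    refine squeeze_zero_norm' ?_ h2
    filter_upwards [self_mem_nhdsWithin] with δ hδ
    have hδ : 0 < δ := hδ
    rw [dif_pos hδ]
    refine (ρ.le_opNorm _).trans (mul_le_mul_of_nonneg_left ?_ (norm_nonneg _))
    refine Real.le_sqrt_of_sq_le ((norm_sq_testEnergy_le _ _).trans (le_of_eq ?_))
    rw [dy_layerTest hg hηs, dy_layerTest hk hηs, dy_layerTest hk.deriv_Ioi hηs]
  have hR := hE.add ((hlim hσψ hk).add (hlim hσv hg))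
  rw [add_zero, add_zero] at hR
  have he := tendsto_nhds_unique (hL.congr' ?_) hR
  · linarith
  · filter_upwards [hp, self_mem_nhdsWithin] with δ hpδ hδ
    have hδ : 0 < δ := hδ
    have hw := layerTest_half (z₀ := z₀) hg hηs hη hδ
    have hφ := layerTest_half (z₀ := z₀) hk hηs hη hδ
    have hx := represents_testE1 (h := P.height) hw hφ
    rw [weakForm_eq_apply hu hpδ hx, hreg _ _ hpδ _ hx, dif_pos hδ]
    rfl

theorem ae_eq_zero_of_test_Ioi {t : ℝ → ℝ} (ht : LocallyIntegrableOn t (Ioi 0))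
    (h0 : ∀ g, IsTest (Ioi 0) g → ∫ y in Ioi (0 : ℝ), t y * g y = 0) :
    ∀ᵐ y ∂volume.restrict (Ioi (0 : ℝ)), t y = 0 := by
  rw [ae_restrict_iff' measurableSet_Ioi]
  refine isOpen_Ioi.ae_eq_zero_of_integral_contDiff_smul_eq_zero ht fun g hg hc hs => ?_
  rw [← h0 g ⟨hg, hc, hs⟩, ← setIntegral_eq_integral_of_forall_compl_eq_zero (s := Ioi 0)]
  · refine integral_congr_ae (Eventually.of_forall fun y => ?_)
    simp [mul_comm]
  · intro y hy
    rw [image_eq_zero_of_notMem_tsupport fun hh => hy (hs hh), zero_smul]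

/-- `ψ = 0` at `z = 0`. -/
theorem Problem.IsRegularSource.trace_bottom {P : Problem} {s : StrongDual ℝ (E1 P.height)}
    (hs : P.IsRegularSource s) {u : Energy c P.height} (hu : P.IsWeakSolution s u)
    (hv : H2Loc P.height (vOf u)) (hψ : H2Loc P.height (psiOf u)) :
    HasTrace P.height (psiOf u) 0 (fun _ => 0) := by
  obtain ⟨Z, hZ, hZh⟩ : ∃ Z : ℝ, 0 < Z ∧ (Z : EReal) ≤ P.height := by
    cases P with
    | quarterPlane => exact ⟨1, one_pos, le_top⟩
    | strip H hH Λ hΛ => exact ⟨H, hH, le_rfl⟩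
  obtain ⟨tv, htv⟩ := hv.exists_trace_bottom hZ hZh
  obtain ⟨t, ht⟩ := hψ.exists_trace_bottom hZ hZh
  obtain ⟨η, hηs, hη1, hη⟩ := exists_bump
  have h0 : ∀ g, IsTest (Ioi 0) g → ∫ y in Ioi (0 : ℝ), t y * g y = 0 := by
    intro g hg
    have hz : layerTest (fun _ => 0) η 0 = fun _ _ => (0 : ℝ) := by
      funext δ p; simp [layerTest]
    have key := hs.trace_pairing hu (σ := -1) hg (IsTest.zero (Q := Ioi (0 : ℝ))) hηs hη ?_ ?_ htv ht
    · simpa using key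
    · filter_upwards [Ioo_mem_nhdsGT hZ] with δ hδ
      rw [hz]
      refine ⟨layerTest_half hg hηs hη hδ.1, IsTest.zero, ?_⟩
      cases P with
      | quarterPlane => trivial
      | strip H hH Λ hΛ =>
        have hZH : Z ≤ H := EReal.coe_le_coe_iff.1 hZh
        have e : (fun y => layerTest g η 0 δ (y, H)) = fun _ => 0 := by
          funext y
          have : 1 / 2 < |(H - 0) / δ| := by
            rw [sub_zero, abs_of_pos (div_pos hH hδ.1), lt_div_iff₀ hδ.1]
            linarith [hδ.2, hδ.1]
          simp only [layerTest]
          rw [hη _ this, mul_zero]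
        simp only [Problem.TopCondition, e, neg_zero]
        exact AdjointEq.zero Λ
    · filter_upwards [Ioo_mem_nhdsGT hZ] with δ hδ
      rw [integral_zRange_deriv hηs hη hZ hδ.1 _ hZh]
      · have : 1 / 2 < |(Z - 0) / δ| := by
          rw [sub_zero, abs_of_pos (div_pos hZ hδ.1), lt_div_iff₀ hδ.1]
          linarith [hδ.2, hδ.1]
        rw [hη _ this]; simp [hη1]
      · intro z hz hz'
        have : Z ≤ z := by
          by_contra hlt
          exact hz' ⟨hz.1, not_le.1 hlt⟩
        rw [sub_zero, abs_of_pos hz.1]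
        linarith [hδ.2]
  have ht0 := ae_eq_zero_of_test_Ioi ht.1 h0
  have ht0' : ∀ᵐ p ∂mu P.height, t p.1 = 0 := by
    rw [mu_eq]; exact Measure.quasiMeasurePreserving_fst.ae ht0
  refine ⟨locallyIntegrableOn_zero, fun a b ha hab => (ht.2 a b ha hab).congr fun η => ?_⟩
  congr 1
  exact lintegral_congr_ae (ae_restrict_of_ae (ht0'.mono fun p hp => by simp only [hp]))

/-- An element of `H^{1/2}_0` is determined by its function. -/
theorem HHalf.ext_of_hFn {f g : HHalf} (hfg : hFn f =ᵐ[volume.restrict (Ioi (0 : ℝ))] hFn g) :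
    f = g := by
  have h1 : (f.1.fst : ℝ → ℝ) =ᵐ[volume.restrict (Ioi (0 : ℝ))] g.1.fst := by
    filter_upwards [hfg, ae_restrict_mem measurableSet_Ioi] with y hy hy0
    have hy0 : 0 < y := hy0
    have h2 : √(1 + 1 / y) ≠ 0 := by positivity
    exact (div_left_inj' h2).1 hy
  have e1 : f.1.fst = g.1.fst := Lp.ext h1
  have e2 : f.1.snd = g.1.snd := by
    refine Lp.ext ?_
    filter_upwards [f.2, g.2] with q h2 h3
    rw [h2, h3, e1]
  exact Subtype.ext (WithLp.ofLp_injective 2 (Prod.ext e1 e2))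

/-- `ψ = Λ v` at `z = H`. -/
theorem exists_trace_top {H : ℝ} {hH : 0 < H} {Λ : HHalf →L[ℝ] StrongDual ℝ HHalf}
    {hΛ : ∀ f, Λ f f ≤ 0} {s : StrongDual ℝ (E1 (Problem.strip H hH Λ hΛ).height)}
    {u : Energy c (Problem.strip H hH Λ hΛ).height}
    (hs : (Problem.strip H hH Λ hΛ).IsRegularSource s)
    (hu : (Problem.strip H hH Λ hΛ).IsWeakSolution s u)
    (hv : H2Loc (H : EReal) (vOf u)) (hψ : H2Loc (H : EReal) (psiOf u)) :
    ∃ vH ψH : ℝ → ℝ,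
      HasTrace (H : EReal) (vOf u) H vH ∧ HasTrace (H : EReal) (psiOf u) H ψH ∧
      ∀ g k : ℝ → ℝ, IsTest (Ioi 0) g → IsTest (Ioi 0) k → AdjointEq Λ g k →
        (∫ y in Ioi (0 : ℝ), ψH y * g y) = (∫ y in Ioi (0 : ℝ), vH y * k y) ∧
        ∀ V G : HHalf, HIs V vH → HIs G g → (∫ y in Ioi (0 : ℝ), ψH y * g y) = Λ V G := by
  obtain ⟨vH, hvH⟩ := hv.exists_trace_top hH
  obtain ⟨ψH, hψH⟩ := hψ.exists_trace_top hH
  obtain ⟨η, hηs, hη1, hη⟩ := exists_bump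
  refine ⟨vH, ψH, hvH, hψH, fun g k hg hk hgk => ?_⟩
  have hfar : ∀ δ ∈ Ioo 0 H, η ((0 - H) / δ) = 0 := fun δ hδ => hη _ (by
    rw [zero_sub, neg_div, abs_neg, abs_of_pos (div_pos hH hδ.1), lt_div_iff₀ hδ.1]
    linarith [hδ.2, hδ.1])
  have key : (∫ y in Ioi (0 : ℝ), ψH y * g y) = ∫ y in Ioi (0 : ℝ), vH y * k y := by
    have h1 := hs.trace_pairing hu (σ := 1) hg (hk.const_mul (-1)) hηs hη ?_ ?_ hvH hψH
    · have e : ∫ y in Ioi (0 : ℝ), vH y * (-1 * k y) = -∫ y in Ioi (0 : ℝ), vH y * k y := by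
        rw [← integral_neg]
        exact integral_congr_ae (Eventually.of_forall fun y => by ring)
      rw [e] at h1
      linarith
    · filter_upwards [Ioo_mem_nhdsGT hH] with δ hδ
      refine ⟨layerTest_half hg hηs hη hδ.1,
        layerTest_isTest (hk.const_mul (-1)) hηs hη hδ.1 fun p hp => ⟨hp.1, ?_⟩, ?_⟩
      · have := hp.2.1
        linarith [hδ.2, hδ.1]
      · simpa [Problem.TopCondition, layerTest, hη1] using hgk
    · filter_upwards [Ioo_mem_nhdsGT hH] with δ hδ
      simp only [Problem.height]
      rw [integral_zRange_deriv hηs hη hH hδ.1 _ le_rfl, hfar δ hδ]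
      · simp [hη1]
      · intro z hz hz'
        exact absurd (by rwa [← zRange_coe]) hz'
  refine ⟨key, fun V G hV hG => ?_⟩
  obtain ⟨G', hG', hΛG⟩ := hgk
  have : G = G' := HHalf.ext_of_hFn (hG.trans hG'.symm)
  subst this
  have h2 := hΛG V
  rw [ContinuousLinearMap.flip_apply] at h2
  rw [key, h2]
  refine integral_congr_ae ?_
  filter_upwards [hV] with y hy
  rw [← hy, mul_comm]

end

section

/-! ### Products of functions with weak derivatives -/

/-- The product rule for `θ Φ (t + Γ)`, where `Φ` and `Γ` are primitives of integrable functions,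
integrated over an interval at whose ends the product vanishes. -/
theorem integral_mul_prim_mul_prim {F G θ : ℝ → ℝ} {t Z : ℝ} (hZ : 0 < Z)
    (hF : IntegrableOn F (Ioo 0 Z)) (hG : IntegrableOn G (Ioo 0 Z)) (hθ : ContDiff ℝ ∞ θ)
    (hθZ : θ Z = 0) :
    ∫ z in Ioo 0 Z, (θ z * (F z * (t + ∫ s in Ioo 0 z, G s) + (∫ s in Ioo 0 z, F s) * G z)
      + deriv θ z * ((∫ s in Ioo 0 z, F s) * (t + ∫ s in Ioo 0 z, G s))) = 0 := by
  have hFi : IntervalIntegrable F volume 0 Z :=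
    (intervalIntegrable_iff_integrableOn_Ioo_of_le hZ.le).2 hF
  have hGi : IntervalIntegrable G volume 0 Z :=
    (intervalIntegrable_iff_integrableOn_Ioo_of_le hZ.le).2 hG
  have h0 : (0 : ℝ) ∈ uIcc 0 Z := left_mem_uIcc
  have aF := hFi.absolutelyContinuousOnInterval_intervalIntegral h0
  have aG := hGi.absolutelyContinuousOnInterval_intervalIntegral h0
  have at' : AbsolutelyContinuousOnInterval (fun _ : ℝ => t) 0 Z :=
    (contDiff_const (n := 1)).contDiffOn.absolutelyContinuousOnInterval
  have aθ : AbsolutelyContinuousOnInterval θ 0 Z :=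
    (hθ.of_le (by simp)).contDiffOn.absolutelyContinuousOnInterval
  have ha := aθ.fun_mul (aF.fun_mul (at'.fun_add aG))
  have hsub := ha.integral_deriv_eq_sub
  simp only [hθZ, intervalIntegral.integral_same, zero_mul, mul_zero, sub_zero] at hsub
  refine Eq.trans ?_ hsub
  rw [← integral_Ioc_eq_integral_Ioo, ← intervalIntegral.integral_of_le hZ.le]
  refine intervalIntegral.integral_congr_ae ?_
  filter_upwards [hFi.ae_hasDerivAt_integral, hGi.ae_hasDerivAt_integral] with z h1 h2 hz
  have hz' : z ∈ uIcc 0 Z := uIoc_subset_uIcc hz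
  rw [uIoc_of_le hZ.le] at hz
  have e : ∀ g : ℝ → ℝ, ∫ s in Ioo 0 z, g s = ∫ s in (0 : ℝ)..z, g s := fun g => by
    rw [intervalIntegral.integral_of_le hz.1.le, integral_Ioc_eq_integral_Ioo]
  have d1 := ((hθ.differentiable (by simp)) z).hasDerivAt
  have d := d1.fun_mul ((h1 hz' 0 h0).fun_mul ((h2 hz' 0 h0).const_add t))
  rw [d.deriv, e, e]
  ring

variable {Z : ℝ}

/-- `f` has the weak `z`-derivative `F` for `0 < z < Z` and zero boundary values at `z = 0`:
the tests need not vanish at the bottom. -/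
def HasWeakDzZero (Z : ℝ) (f F : ℝ × ℝ → ℝ) : Prop :=
  ∀ w, IsTest {p : ℝ × ℝ | 0 < p.1 ∧ p.2 < Z} w →
    ∫ p, f p * dz w p ∂mu (Z : EReal) = -∫ p, F p * w p ∂mu (Z : EReal)

theorem HasWeakDzZero.hasWeakDz {f F : ℝ × ℝ → ℝ} (hf : HasWeakDzZero Z f F) :
    HasWeakDz (Dom (Z : EReal)) f F := fun φ hφ =>
  hf φ (hφ.mono fun _ hp => ⟨hp.1, EReal.coe_lt_coe_iff.1 hp.2.2⟩)

theorem MemLp.integrable_rect {f : ℝ × ℝ → ℝ} (hf : MemLp f 2 (mu (Z : EReal))) {a b : ℝ}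
    (ha : 0 < a) : Integrable f (rectMeasure a b Z) := by
  have h1 : MemLp f 2 (rectMeasure a b Z) := by
    rw [rectMeasure_eq]
    exact hf.mono_measure (Measure.restrict_mono (rect_subset_dom ha) le_rfl)
  exact MemLp.integrable (q := 2) (by norm_num) h1

/-- A function with zero boundary values is a primitive. -/
theorem HasWeakDzZero.eq_primZ (hZ : 0 < Z) {f F : ℝ × ℝ → ℝ} (hfF : HasWeakDzZero Z f F)
    (hF : StronglyMeasurable F) (hf2 : MemLp f 2 (mu (Z : EReal)))
    (hF2 : MemLp F 2 (mu (Z : EReal))) : f =ᵐ[mu (Z : EReal)] primZ F := by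
  have hFi := fun a b (ha : 0 < a) => MemLp.integrable_rect (b := b) hF2 ha
  obtain ⟨t, hti, ht⟩ := exists_eq_add_primZ hZ hF (fun a b ha => MemLp.integrable_rect hf2 ha) hFi
    hfF.hasWeakDz
  obtain ⟨η, hηs, hη1, hη⟩ := exists_bump
  have hηZ : ∀ z, 0 < z → z ∉ Ioo 0 Z → Z ≤ z := fun z h1 h2 => not_lt.1 fun h => h2 ⟨h1, h⟩
  have h0 : ∀ g, IsTest (Ioi 0) g → ∫ y in Ioi (0 : ℝ), t y * g y = 0 := by
    intro g hg
    obtain ⟨a, b, ha, hab, hgs⟩ := hg.exists_bounds_Ioi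
    have hg0 : ∀ y, y ∉ Icc a b → g y = 0 := fun y hy =>
      image_eq_zero_of_notMem_tsupport fun hh => hy (hgs hh)
    set w := layerTest g η 0 Z with hw
    have hwt : IsTest {p : ℝ × ℝ | 0 < p.1 ∧ p.2 < Z} w :=
      layerTest_isTest hg hηs hη hZ fun p hp => ⟨hp.1, by linarith [hp.2.2]⟩
    have hw0 : ∀ (y z : ℝ), y ∉ Icc a b → w (y, z) = 0 := fun y z hy => by
      simp [hw, layerTest, hg0 y hy]
    have hdw0 : ∀ (y z : ℝ), y ∉ Icc a b → dz w (y, z) = 0 := fun y z hy => by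
      simp [hw, dz_layerTest hg hηs, layerTest, hg0 y hy]
    have hηZ' : 1 / 2 < |(Z - 0) / Z| := by
      rw [sub_zero, div_self hZ.ne']; norm_num
    have hwZ : ∀ y, w (y, Z) = 0 := fun y => by
      simp only [hw, layerTest]; rw [hη _ hηZ', mul_zero]
    have e1 := hfF w hwt
    have e2 := integral_primZ_mul_dz hF (hFi a b ha) hwt hwZ
    rw [integral_mu_eq_rect ha (fun y z hy => by rw [hdw0 y z hy, mul_zero]),
      integral_mu_eq_rect ha (fun y z hy => by rw [hw0 y z hy, mul_zero]), ← e2] at e1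
    obtain ⟨M, hM⟩ := hwt.dz.compact.exists_bound_of_continuous hwt.dz.continuous
    have bdd : ∀ {F : ℝ × ℝ → ℝ}, Integrable F (rectMeasure a b Z) →
        Integrable (fun p => F p * dz w p) (rectMeasure a b Z) := fun hF =>
      hF.mul_bdd (c := M) hwt.dz.continuous.aestronglyMeasurable (Eventually.of_forall hM)
    have hti2 : Integrable (fun p : ℝ × ℝ => t p.1) (rectMeasure a b Z) :=
      Integrable.comp_fst (hti a b ha) (volume.restrict (Ioo 0 Z))
    have ht' : ∀ᵐ p ∂rectMeasure a b Z, f p = t p.1 + primZ F p := by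
      rw [rectMeasure_eq]
      exact ae_mono (Measure.restrict_mono (rect_subset_dom ha) le_rfl) ht
    have e3 : ∫ p, f p * dz w p ∂rectMeasure a b Z = ∫ p, t p.1 * dz w p ∂rectMeasure a b Z
        + ∫ p, primZ F p * dz w p ∂rectMeasure a b Z := by
      rw [← integral_add (bdd hti2) (bdd (integrable_primZ hF (hFi a b ha)))]
      refine integral_congr_ae ?_
      filter_upwards [ht'] with p hp
      rw [hp]; ring
    have e4 : ∫ p, t p.1 * dz w p ∂rectMeasure a b Z = 0 := by linarith
    rw [← integral_mu_eq_rect ha (F := fun p => t p.1 * dz w p)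
      (fun y z hy => by rw [hdw0 y z hy, mul_zero]), mu_eq] at e4
    have e5 : ∫ p : ℝ × ℝ, t p.1 * dz w p ∂(volume.restrict (Ioi (0 : ℝ))).prod
          (volume.restrict (zRange (Z : EReal)))
        = (∫ y in Ioi (0 : ℝ), t y * g y)
          * ∫ z in zRange (Z : EReal), Z⁻¹ * deriv η ((z - 0) / Z) := by
      rw [← integral_prod_mul]
      refine integral_congr_ae (Eventually.of_forall fun p => ?_)
      simp only [hw, dz_layerTest hg hηs, layerTest]; ring
    rw [e5, integral_zRange_deriv hηs hη hZ hZ (fun z h1 h2 => ?_) le_rfl, hη _ hηZ'] at e4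
    · simpa [hη1] using e4
    · rw [← zRange_coe] at h2
      exact absurd h1 h2
  have ht0 := ae_eq_zero_of_test_Ioi (locallyIntegrableOn_Ioi hti) h0
  have ht0' : ∀ᵐ p ∂mu (Z : EReal), t p.1 = 0 := by
    rw [mu_eq]; exact Measure.quasiMeasurePreserving_fst.ae ht0
  filter_upwards [ht, ht0'] with p h1 h2
  rw [h1, h2, zero_add]

/-- The product rule for weak `z`-derivatives, one of the factors having zero boundary values. -/
theorem HasWeakDzZero.integral_mul (hZ : 0 < Z) {f F g G : ℝ × ℝ → ℝ} (hfF : HasWeakDzZero Z f F)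
    (hgG : HasWeakDz (Dom (Z : EReal)) g G)
    (hF : StronglyMeasurable F) (hG : StronglyMeasurable G) (hf2 : MemLp f 2 (mu (Z : EReal)))
    (hF2 : MemLp F 2 (mu (Z : EReal))) (hg2 : MemLp g 2 (mu (Z : EReal)))
    (hG2 : MemLp G 2 (mu (Z : EReal))) {X θ : ℝ → ℝ} (hX : Continuous X)
    (hXc : HasCompactSupport X) (hθ : ContDiff ℝ ∞ θ) (hθZ : θ Z = 0) :
    ∫ p, X p.1 * (θ p.2 * (F p * g p + f p * G p) + deriv θ p.2 * (f p * g p)) ∂mu (Z : EReal)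
      = 0 := by
  have hFi := fun a b (ha : 0 < a) => MemLp.integrable_rect (b := b) hF2 ha
  have hGi := fun a b (ha : 0 < a) => MemLp.integrable_rect (b := b) hG2 ha
  obtain ⟨t, hti, ht⟩ := exists_eq_add_primZ hZ hG (fun a b ha => MemLp.integrable_rect hg2 ha) hGi
    hgG
  have hfp := hfF.eq_primZ hZ hF hf2 hF2
  obtain ⟨M, hM⟩ := hXc.exists_bound_of_continuous hX
  obtain ⟨M₁, hM₁⟩ := isCompact_Icc.exists_bound_of_continuousOn (s := Icc 0 Z)
    hθ.continuous.continuousOn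
  have hθ' : Continuous (deriv θ) := (contDiff_infty_iff_deriv.1 hθ).2.continuous
  obtain ⟨M₂, hM₂⟩ := isCompact_Icc.exists_bound_of_continuousOn (s := Icc 0 Z) hθ'.continuousOn
  have hmem : ∀ᵐ p ∂mu (Z : EReal), p.2 ∈ Icc 0 Z := by
    filter_upwards [ae_mem_dom _] with p hp
    exact ⟨hp.2.1.le, (EReal.coe_lt_coe_iff.1 hp.2.2).le⟩
  have hint : Integrable (fun p : ℝ × ℝ =>
      X p.1 * (θ p.2 * (F p * g p + f p * G p) + deriv θ p.2 * (f p * g p))) (mu (Z : EReal)) := by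
    have i1 : Integrable (fun p => F p * g p + f p * G p) (mu (Z : EReal)) :=
      (hF2.integrable_mul hg2).add (hf2.integrable_mul hG2)
    have i2 : Integrable (fun p => f p * g p) (mu (Z : EReal)) := hf2.integrable_mul hg2
    have j1 := i1.bdd_mul (f := fun p : ℝ × ℝ => θ p.2) (c := M₁)
      (hθ.continuous.comp continuous_snd).aestronglyMeasurable (hmem.mono fun p hp => hM₁ _ hp)
    have j2 := i2.bdd_mul (f := fun p : ℝ × ℝ => deriv θ p.2) (c := M₂)
      (hθ'.comp continuous_snd).aestronglyMeasurable (hmem.mono fun p hp => hM₂ _ hp)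
    exact (j1.add j2).bdd_mul (f := fun p : ℝ × ℝ => X p.1) (c := M)
      (hX.comp continuous_fst).aestronglyMeasurable (Eventually.of_forall fun p => hM _)
  have hae : ∀ᵐ p ∂mu (Z : EReal), f p = primZ F p ∧ g p = t p.1 + primZ G p := by
    filter_upwards [hfp, ht] with p h1 h2 using ⟨h1, h2⟩
  rw [mu_eq, zRange_coe] at hint hae ⊢
  rw [integral_prod _ hint]
  refine integral_eq_zero_of_ae ?_
  filter_upwards [ae_integrableOn_slice hFi, ae_integrableOn_slice hGi,
    Measure.ae_ae_of_ae_prod hae] with y h1 h2 h3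
  rw [integral_const_mul]
  refine mul_eq_zero_of_right _ ?_
  refine Eq.trans ?_ (integral_mul_prim_mul_prim (t := t y) hZ h1 h2 hθ hθZ)
  refine integral_congr_ae ?_
  filter_upwards [h3] with z hz
  rw [hz.1, hz.2]
  rfl

end

section

/-! ### Mollification along the horizontal lines -/

/-- The convolution of `f` with `κ` in the variable `y`. -/
def mol (κ : ℝ → ℝ) (f : ℝ × ℝ → ℝ) : ℝ × ℝ → ℝ := fun p => ∫ t, κ t * f (p.1 - t, p.2)

section

variable {κ : ℝ → ℝ} {f : ℝ × ℝ → ℝ}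

theorem shift_eq (p : ℝ × ℝ) (t : ℝ) : (p.1 - t, p.2) = p - (t, 0) := by ext <;> simp

theorem MemLp.shift (hf : MemLp f 2 volume) (t : ℝ) : 
    MemLp (fun p : ℝ × ℝ => f (p.1 - t, p.2)) 2 volume := by
  simp only [shift_eq]
  exact hf.comp_measurePreserving (measurePreserving_sub_right volume ((t, 0) : ℝ × ℝ))

theorem integral_shift (F : ℝ × ℝ → ℝ) (t : ℝ) : ∫ p : ℝ × ℝ, F (p.1 - t, p.2) = ∫ p, F p := by
  simp only [shift_eq]
  exact integral_sub_right_eq_self F ((t, 0) : ℝ × ℝ)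

theorem stronglyMeasurable_mol (hκ : Continuous κ) (hf : StronglyMeasurable f) :
    StronglyMeasurable (mol κ f) := by
  have h1 : StronglyMeasurable fun q : (ℝ × ℝ) × ℝ => κ q.2 * f (q.1.1 - q.2, q.1.2) :=
    (hκ.stronglyMeasurable.comp_measurable measurable_snd).mul
      (hf.comp_measurable (by fun_prop))
  exact h1.integral_prod_right'

theorem lintegral_mol_sq_le (hκ : Continuous κ) (hf : StronglyMeasurable f) :
    ∫⁻ p, ‖mol κ f p‖ₑ ^ (2 : ℝ) ≤ (∫⁻ t, ‖κ t‖ₑ) ^ (2 : ℝ) * ∫⁻ p, ‖f p‖ₑ ^ (2 : ℝ) := by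
  have hm : Measurable fun q : (ℝ × ℝ) × ℝ => ‖κ q.2‖ₑ * ‖f (q.1.1 - q.2, q.1.2)‖ₑ ^ (2 : ℝ) :=
    (hκ.measurable.comp measurable_snd).enorm.mul
      ((hf.measurable.comp (by fun_prop)).enorm.pow_const _)
  have h1 : ∀ p : ℝ × ℝ, ‖mol κ f p‖ₑ ^ (2 : ℝ)
      ≤ (∫⁻ t, ‖κ t‖ₑ) * ∫⁻ t, ‖κ t‖ₑ * ‖f (p.1 - t, p.2)‖ₑ ^ (2 : ℝ) := by
    intro p
    have e1 : ‖mol κ f p‖ₑ ≤ ∫⁻ t, (‖κ t‖ₑ ^ (1 / 2 : ℝ)) *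
        (‖κ t‖ₑ ^ (1 / 2 : ℝ) * ‖f (p.1 - t, p.2)‖ₑ) := by
      refine (enorm_integral_le_lintegral_enorm _).trans (le_of_eq ?_)
      refine lintegral_congr fun t => ?_
      rw [enorm_mul, ← mul_assoc, ← ENNReal.rpow_add_of_nonneg _ _ (by norm_num) (by norm_num)]
      norm_num
    have e2 := ENNReal.lintegral_mul_le_Lp_mul_Lq volume Real.HolderConjugate.two_two
      (f := fun t => ‖κ t‖ₑ ^ (1 / 2 : ℝ))
      (g := fun t => ‖κ t‖ₑ ^ (1 / 2 : ℝ) * ‖f (p.1 - t, p.2)‖ₑ)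
      (hκ.measurable.enorm.pow_const _).aemeasurable
      ((hκ.measurable.enorm.pow_const _).mul
        (hf.measurable.comp (by fun_prop)).enorm).aemeasurable
    have e3 := ENNReal.rpow_le_rpow (e1.trans e2) (z := 2) (by norm_num)
    refine e3.trans (le_of_eq ?_)
    rw [ENNReal.mul_rpow_of_nonneg _ _ (by norm_num), ← ENNReal.rpow_mul, ← ENNReal.rpow_mul]
    have e4 : ∀ x : ENNReal, (x ^ (1 / 2 : ℝ)) ^ (2 : ℝ) = x := fun x => by
      rw [← ENNReal.rpow_mul]; norm_num
    have e5 : (1 / 2 * 2 : ℝ) = 1 := by norm_num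
    simp only [e5, ENNReal.rpow_one, ENNReal.mul_rpow_of_nonneg _ _ (show (0 : ℝ) ≤ 2 by norm_num),
      e4]
  calc ∫⁻ p, ‖mol κ f p‖ₑ ^ (2 : ℝ)
      ≤ ∫⁻ p : ℝ × ℝ, (∫⁻ t, ‖κ t‖ₑ) * ∫⁻ t, ‖κ t‖ₑ * ‖f (p.1 - t, p.2)‖ₑ ^ (2 : ℝ) :=
        lintegral_mono h1
    _ = (∫⁻ t, ‖κ t‖ₑ) * ∫⁻ t, ∫⁻ p : ℝ × ℝ, ‖κ t‖ₑ * ‖f (p.1 - t, p.2)‖ₑ ^ (2 : ℝ) := by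
        rw [lintegral_const_mul _ hm.lintegral_prod_right', lintegral_lintegral_swap hm.aemeasurable]
    _ = (∫⁻ t, ‖κ t‖ₑ) * ∫⁻ t, ‖κ t‖ₑ * ∫⁻ p : ℝ × ℝ, ‖f p‖ₑ ^ (2 : ℝ) := by
        congr 1
        refine lintegral_congr fun t => ?_
        have hft : Measurable fun p : ℝ × ℝ => f (p.1 - t, p.2) := hf.measurable.comp (by fun_prop)
        rw [lintegral_const_mul _ (hft.enorm.pow_const _)]
        congr 1
        simp only [shift_eq]
        exact lintegral_sub_right_eq_self (fun p => ‖f p‖ₑ ^ (2 : ℝ)) ((t, 0) : ℝ × ℝ)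
    _ = _ := by
        rw [lintegral_mul_const _ hκ.measurable.enorm, ← mul_assoc]
        congr 1
        rw [ENNReal.rpow_two, sq]

variable (hκ : IsTest (Iio 0) κ) (hf : StronglyMeasurable f) (hf2 : MemLp f 2 volume)

include hκ in
theorem lintegral_kernel_lt_top : ∫⁻ t, ‖κ t‖ₑ < ⊤ :=
  (hκ.continuous.integrable_of_hasCompactSupport hκ.compact).2

include hκ hf hf2 in
theorem memLp_mol : MemLp (mol κ f) 2 volume := by
  refine ⟨(stronglyMeasurable_mol hκ.continuous hf).aestronglyMeasurable, ?_⟩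
  have h2 := (eLpNorm_lt_top_iff_lintegral_rpow_enorm_lt_top (by norm_num) (by norm_num)).1 hf2.2
  refine (eLpNorm_lt_top_iff_lintegral_rpow_enorm_lt_top (by norm_num) (by norm_num)).2 ?_
  simp only [ENNReal.toReal_ofNat] at h2 ⊢
  refine (lintegral_mol_sq_le hκ.continuous hf).trans_lt (ENNReal.mul_lt_top ?_ h2)
  exact ENNReal.rpow_lt_top_of_nonneg (by norm_num) (lintegral_kernel_lt_top hκ).ne

theorem integral_sq_eq_toReal {g : ℝ × ℝ → ℝ} (hg : AEStronglyMeasurable g volume) :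
    ∫ p, g p ^ 2 = (∫⁻ p, ‖g p‖ₑ ^ (2 : ℝ)).toReal := by
  rw [integral_eq_lintegral_of_nonneg_ae (Eventually.of_forall fun p => sq_nonneg _) (hg.pow 2)]
  congr 1
  refine lintegral_congr fun p => ?_
  rw [← ofReal_norm, ENNReal.ofReal_rpow_of_nonneg (norm_nonneg _) (by norm_num)]
  simp

include hκ hf hf2 in
/-- Young's inequality. -/
theorem integral_mol_sq_le (h0 : ∀ t, 0 ≤ κ t) (h1 : ∫ t, κ t = 1) :
    ∫ p, mol κ f p ^ 2 ≤ ∫ p, f p ^ 2 := by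
  rw [integral_sq_eq_toReal (memLp_mol hκ hf hf2).1, integral_sq_eq_toReal hf2.1]
  have h2 := (eLpNorm_lt_top_iff_lintegral_rpow_enorm_lt_top (by norm_num) (by norm_num)).1 hf2.2
  simp only [ENNReal.toReal_ofNat] at h2
  refine ENNReal.toReal_mono h2.ne ((lintegral_mol_sq_le hκ.continuous hf).trans (le_of_eq ?_))
  have h3 : ∫⁻ t, ‖κ t‖ₑ = 1 := by
    have := ofReal_integral_norm_eq_lintegral_enorm (μ := (volume : Measure ℝ))
      (hκ.continuous.integrable_of_hasCompactSupport hκ.compact)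
    rw [← this]
    simp only [Real.norm_of_nonneg (h0 _), h1, ENNReal.ofReal_one]
  rw [h3]; simp

include hκ hf hf2 in
theorem integrable_mol_kernel {G : ℝ × ℝ → ℝ} (hG : StronglyMeasurable G) (hG2 : MemLp G 2 volume) :
    Integrable (fun q : (ℝ × ℝ) × ℝ => κ q.2 * f (q.1.1 - q.2, q.1.2) * G q.1)
      ((volume : Measure (ℝ × ℝ)).prod volume) := by
  have hκi : Integrable κ := hκ.continuous.integrable_of_hasCompactSupport hκ.compact
  have hm : StronglyMeasurable fun q : (ℝ × ℝ) × ℝ => κ q.2 * f (q.1.1 - q.2, q.1.2) * G q.1 :=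
    ((hκ.continuous.stronglyMeasurable.comp_measurable measurable_snd).mul
      (hf.comp_measurable (by fun_prop))).mul (hG.comp_measurable measurable_fst)
  rw [integrable_prod_iff' hm.aestronglyMeasurable]
  refine ⟨Eventually.of_forall fun t => ?_, ?_⟩
  · have := ((MemLp.shift hf2 t).integrable_mul hG2).const_mul (κ t)
    refine this.congr (Eventually.of_forall fun p => ?_)
    simp only [Pi.mul_apply]; ring
  · refine (hκi.norm.mul_const (√(∫ p, f p ^ 2) * √(∫ p, G p ^ 2))).mono'
      hm.norm.integral_prod_left'.aestronglyMeasurable (Eventually.of_forall fun t => ?_)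
    have hs := abs_integral_mul_le (MemLp.shift hf2 t).norm hG2.norm
    rw [Real.norm_of_nonneg (integral_nonneg fun p => norm_nonneg _)]
    simp only [norm_mul, mul_assoc]
    rw [integral_const_mul]
    refine mul_le_mul_of_nonneg_left ((le_abs_self _).trans (hs.trans (le_of_eq ?_)))
      (norm_nonneg _)
    simp only [Real.norm_eq_abs, sq_abs]
    rw [integral_shift (fun p => f p ^ 2) t]

theorem integral_shift_mul (f G : ℝ × ℝ → ℝ) (r t : ℝ) :
    ∫ p : ℝ × ℝ, r * f (p.1 - t, p.2) * G p = r * ∫ p : ℝ × ℝ, f p * G (p.1 + t, p.2) := by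
  simp only [mul_assoc]
  rw [integral_const_mul, ← integral_shift (fun p => f p * G (p.1 + t, p.2)) t]
  simp

include hκ hf hf2 in
/-- The transpose of a mollification. -/
theorem integral_mol_mul {G : ℝ × ℝ → ℝ} (hG : StronglyMeasurable G) (hG2 : MemLp G 2 volume) :
    ∫ p, mol κ f p * G p = ∫ t, κ t * ∫ p : ℝ × ℝ, f p * G (p.1 + t, p.2) := by
  have hi := integrable_mol_kernel hκ hf hf2 hG hG2
  have e1 : ∀ p : ℝ × ℝ, mol κ f p * G p = ∫ t, κ t * f (p.1 - t, p.2) * G p := fun p => by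
    rw [integral_mul_const]; rfl
  simp only [e1]
  rw [integral_integral_swap hi]
  simp only [integral_shift_mul]

include hκ hf hf2 in
theorem integrable_mul_integral_shift {G : ℝ × ℝ → ℝ} (hG : StronglyMeasurable G)
    (hG2 : MemLp G 2 volume) :
    Integrable fun t => κ t * ∫ p : ℝ × ℝ, f p * G (p.1 + t, p.2) := by
  have hi := (integrable_mol_kernel hκ hf hf2 hG hG2).integral_prod_right
  simpa only [integral_shift_mul] using hi

include hf hf2 in
theorem ae_locallyIntegrable_slice : ∀ᵐ z : ℝ, LocallyIntegrable (fun y => f (y, z)) := by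
  have h1 : Integrable (fun p => f p ^ 2) (volume : Measure (ℝ × ℝ)) := hf2.integrable_sq
  rw [Measure.volume_eq_prod] at h1
  filter_upwards [h1.prod_left_ae] with z hz
  have hm : StronglyMeasurable fun y => f (y, z) := hf.comp_measurable (by fun_prop)
  exact ((memLp_two_iff_integrable_sq hm.aestronglyMeasurable).2 hz).locallyIntegrable (by norm_num)

include hκ hf hf2 in
/-- On almost every horizontal line the mollification is smooth, and its derivative falls on the
kernel. -/
theorem hasDerivAt_mol : ∀ᵐ z : ℝ, ∀ y : ℝ,
    HasDerivAt (fun y => mol κ f (y, z)) (mol (deriv κ) f (y, z)) y := by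
  filter_upwards [ae_locallyIntegrable_slice hf hf2] with z hz y
  exact hκ.compact.hasDerivAt_convolution_left (ContinuousLinearMap.lsmul ℝ ℝ)
    (hκ.smooth.of_le (by simp)) hz y

/-- The integral of a `y`-derivative vanishes. -/
theorem integral_eq_zero_of_hasDerivAt_slice {H H' : ℝ × ℝ → ℝ} {a b : ℝ}
    (hd : ∀ᵐ z : ℝ, ∀ y : ℝ, HasDerivAt (fun y => H (y, z)) (H' (y, z)) y)
    (hs : ∀ y z, y ∉ Icc a b → H (y, z) = 0) (hi : Integrable H' volume) : ∫ p, H' p = 0 := by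
  rw [Measure.volume_eq_prod] at hi ⊢
  rw [integral_prod_symm _ hi]
  refine integral_eq_zero_of_ae ?_
  filter_upwards [hd, hi.prod_left_ae] with z h1 h2
  refine integral_eq_zero_of_hasDerivAt_of_integrable h1 h2 ?_
  refine Continuous.integrable_of_hasCompactSupport
    (continuous_iff_continuousAt.2 fun y => (h1 y).continuousAt) ?_
  exact HasCompactSupport.intro (isCompact_Icc (a := a) (b := b)) fun y hy => hs y z hy

include hκ in
theorem IsTest.deriv_Iio : IsTest (Iio 0) (deriv κ) :=
  ⟨(contDiff_infty_iff_deriv.1 hκ.smooth).2, hκ.compact.deriv,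
    tsupport_deriv_subset.trans hκ.supp⟩

include hκ in
theorem IsTest.deriv_iter_Iio (n : ℕ) : IsTest (Iio 0) (deriv^[n] κ) := by
  induction n with
  | zero => exact hκ
  | succ n ih => rw [Function.iterate_succ_apply']; exact ih.deriv_Iio

theorem IsTest.memLp_volume {Q : Set (ℝ × ℝ)} {φ : ℝ × ℝ → ℝ} (hφ : IsTest Q φ) :
    MemLp φ 2 volume := hφ.continuous.memLp_of_hasCompactSupport hφ.compact

include hκ hf hf2 in
theorem integral_mol_mul_dy {Q : Set (ℝ × ℝ)} {φ : ℝ × ℝ → ℝ} (hφ : IsTest Q φ) :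
    ∫ p, mol κ f p * dy φ p = -∫ p, mol (deriv κ) f p * φ p := by
  have i1 : Integrable (fun p => mol κ f p * dy φ p) volume :=
    (memLp_mol hκ hf hf2).integrable_mul hφ.dy.memLp_volume
  have i2 : Integrable (fun p => mol (deriv κ) f p * φ p) volume :=
    (memLp_mol hκ.deriv_Iio hf hf2).integrable_mul hφ.memLp_volume
  have hc : IsCompact (Prod.fst '' tsupport φ) := hφ.compact.isCompact.image continuous_fst
  obtain ⟨R, hR⟩ := hc.isBounded.subset_closedBall 0
  have h0 := integral_eq_zero_of_hasDerivAt_slice (a := -R) (b := R)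
    (H := fun p => mol κ f p * φ p)
    (H' := fun p => mol (deriv κ) f p * φ p + mol κ f p * dy φ p) ?_ ?_ (i2.add i1)
  · rw [integral_add i2 i1] at h0
    linarith
  · filter_upwards [hasDerivAt_mol hκ hf hf2] with z hz y
    exact (hz y).mul (hasDerivAt_fst hφ.differentiable y z)
  · intro y z hy
    have : φ (y, z) = 0 := image_eq_zero_of_notMem_tsupport fun h => hy (by
      have := hR (mem_image_of_mem Prod.fst h)
      rwa [Real.closedBall_eq_Icc, zero_sub, zero_add] at this)
    rw [this, mul_zero]

include hκ hf hf2 in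
theorem integral_mol_mul_dy_iter {Q : Set (ℝ × ℝ)} {φ : ℝ × ℝ → ℝ} (hφ : IsTest Q φ) (n : ℕ) :
    ∫ p, mol κ f p * (dy^[n] φ) p = (-1) ^ n * ∫ p, mol (deriv^[n] κ) f p * φ p := by
  induction n generalizing φ with
  | zero => simp
  | succ n ih =>
    rw [Function.iterate_succ_apply, ih hφ.dy, Function.iterate_succ_apply',
      integral_mol_mul_dy (hκ.deriv_iter_Iio n) hf hf2 hφ]
    ring

end

end

section

/-! ### The differentiated system and its mollification -/

theorem shift_add_eq (p : ℝ × ℝ) (t : ℝ) : (p.1 + t, p.2) = p + (t, 0) := by ext <;> simp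

theorem dy_shift (φ : ℝ × ℝ → ℝ) (t : ℝ) :
    dy (fun p => φ (p.1 + t, p.2)) = fun p => dy φ (p.1 + t, p.2) := by
  funext p
  simp only [shift_add_eq, dy]
  rw [fderiv_comp_add_right]

theorem dz_shift (φ : ℝ × ℝ → ℝ) (t : ℝ) :
    dz (fun p => φ (p.1 + t, p.2)) = fun p => dz φ (p.1 + t, p.2) := by
  funext p
  simp only [shift_add_eq, dz]
  rw [fderiv_comp_add_right]

theorem transport_shift (φ : ℝ × ℝ → ℝ) (t : ℝ) :
    transport (fun p => φ (p.1 + t, p.2)) = fun p => transport φ (p.1 + t, p.2) := by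
  funext p
  simp only [transport, dy_shift, dz_shift]

theorem dy_iter_shift (φ : ℝ × ℝ → ℝ) (t : ℝ) (n : ℕ) :
    dy^[n] (fun p => φ (p.1 + t, p.2)) = fun p => (dy^[n] φ) (p.1 + t, p.2) := by
  induction n with
  | zero => rfl
  | succ n ih => rw [Function.iterate_succ_apply', Function.iterate_succ_apply', ih, dy_shift]

theorem IsTest.shift {Q : Set (ℝ × ℝ)} {φ : ℝ × ℝ → ℝ} (hφ : IsTest Q φ) {t : ℝ}
    (hQ : ∀ p : ℝ × ℝ, (p.1 + t, p.2) ∈ Q → p ∈ Q) : IsTest Q (fun p => φ (p.1 + t, p.2)) := by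
  have e : (fun p : ℝ × ℝ => φ (p.1 + t, p.2)) = φ ∘ Homeomorph.addRight ((t, 0) : ℝ × ℝ) := by
    funext p; simp [shift_add_eq]
  refine ⟨hφ.smooth.comp (by fun_prop), ?_, ?_⟩
  · rw [e]; exact hφ.compact.comp_homeomorph _
  · intro p hp
    refine hQ p (hφ.supp ?_)
    rw [e] at hp
    have := tsupport_comp_subset_preimage φ (Homeomorph.continuous (Homeomorph.addRight ((t, 0) : ℝ × ℝ))) hp
    rw [shift_add_eq]
    exact this

/-- The system satisfied by `p = ∂_y v` and `Ψ = ∂_y² ψ`, in the sense of distributions: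
`T ∂_y p - ½ ∂_y⁴ Ψ = c + ∂_y² d` and `T Ψ + ½ ∂_y³ p = a - ∂_y b`, where `T = ∂_z + z ∂_y`, with
`Ψ = 0` at `z = 0`. The integrals run over the plane, for functions that vanish for `z ≤ 0`; the
tests of the second equation need not vanish at `z = 0`. -/
structure WeakSystem (h : EReal) (p Ψ a b c d : ℝ × ℝ → ℝ) : Prop where
  eq_p : ∀ φ, IsTest (Dom h) φ → (∫ x, p x * transport (dy φ) x) - 1 / 2 * (∫ x, Ψ x * (dy^[4] φ) x)
    = (∫ x, c x * φ x) + ∫ x, d x * (dy^[2] φ) x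
  eq_Ψ : ∀ w, IsTest {x : ℝ × ℝ | 0 < x.1 ∧ (x.2 : EReal) < h} w →
    -(∫ x, Ψ x * transport w x) - 1 / 2 * (∫ x, p x * (dy^[3] w) x)
      = (∫ x, a x * w x) + ∫ x, b x * dy w x

/-- A square integrable function that vanishes for `z ≤ 0`. -/
structure IsDatum (f : ℝ × ℝ → ℝ) : Prop where
  meas : StronglyMeasurable f
  memLp : MemLp f 2 volume
  zero : ∀ y z : ℝ, z ≤ 0 → f (y, z) = 0

variable {κ : ℝ → ℝ} {f : ℝ × ℝ → ℝ} {h : EReal}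

theorem IsDatum.mol (hf : IsDatum f) (hκ : IsTest (Iio 0) κ) : IsDatum (mol κ f) :=
  ⟨stronglyMeasurable_mol hκ.continuous hf.meas, memLp_mol hκ hf.meas hf.memLp, fun y z hz => by
    simp [EquatorialLayer.mol, hf.zero _ z hz]⟩

/-- The system is preserved by mollification in `y`. The kernel is supported in `t < 0`, so that the
translates of a test that occur in the transposed mollification stay in `y > 0`. The coefficient `z`
does not depend on `y`, so that there is no commutator. -/
theorem WeakSystem.mol {p Ψ a b c d : ℝ × ℝ → ℝ} (hs : WeakSystem h p Ψ a b c d)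
    (hp : IsDatum p) (hΨ : IsDatum Ψ) (ha : IsDatum a) (hb : IsDatum b) (hc : IsDatum c)
    (hd : IsDatum d) (hκ : IsTest (Iio 0) κ) :
    WeakSystem h (mol κ p) (mol κ Ψ) (mol κ a) (mol κ b) (mol κ c) (mol κ d) := by
  have pair : ∀ {f : ℝ × ℝ → ℝ}, IsDatum f → ∀ {Q : Set (ℝ × ℝ)} {G : ℝ × ℝ → ℝ}, IsTest Q G →
      ∫ x, EquatorialLayer.mol κ f x * G x = ∫ t, κ t * ∫ x : ℝ × ℝ, f x * G (x.1 + t, x.2) :=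
    fun hf _ _ hG => integral_mol_mul hκ hf.meas hf.memLp hG.continuous.stronglyMeasurable
      hG.memLp_volume
  have int : ∀ {f : ℝ × ℝ → ℝ}, IsDatum f → ∀ {Q : Set (ℝ × ℝ)} {G : ℝ × ℝ → ℝ}, IsTest Q G →
      Integrable fun t => κ t * ∫ x : ℝ × ℝ, f x * G (x.1 + t, x.2) :=
    fun hf _ _ hG => integrable_mul_integral_shift hκ hf.meas hf.memLp
      hG.continuous.stronglyMeasurable hG.memLp_volume
  have hneg : ∀ t, κ t ≠ 0 → t < 0 := fun t ht => by
    by_contra hn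
    exact ht (hκ.eq_zero hn)
  constructor
  · intro φ hφ
    have t1 := hφ.dy.transport
    have t2 := hφ.dy_iter 4
    have t3 := hφ.dy_iter 2
    rw [pair hp t1, pair hΨ t2, pair hc hφ, pair hd t3, ← integral_const_mul, ← integral_sub
      (int hp t1) ((int hΨ t2).const_mul _), ← integral_add (int hc hφ) (int hd t3)]
    refine integral_congr_ae (Eventually.of_forall fun t => ?_)
    by_cases ht : κ t = 0
    · simp [ht]
    · have hφt := hφ.shift (t := t) fun x hx => ⟨by linarith [hx.1, hneg t ht], hx.2⟩
      have := hs.eq_p _ hφt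
      simp only [dy_shift, transport_shift, dy_iter_shift] at this
      linear_combination κ t * this
  · intro w hw
    have t1 := hw.transport
    have t2 := hw.dy_iter 3
    have t3 := hw.dy
    have k := integral_sub (int hΨ t1).neg ((int hp t2).const_mul (1 / 2))
    simp only [Pi.neg_apply] at k
    rw [pair hΨ t1, pair hp t2, pair ha hw, pair hb t3, ← integral_const_mul, ← integral_neg, ← k,
      ← integral_add (int ha hw) (int hb t3)]
    refine integral_congr_ae (Eventually.of_forall fun t => ?_)
    by_cases ht : κ t = 0
    · simp [ht]
    · have hwt := hw.shift (t := t) fun x hx => ⟨by linarith [hx.1, hneg t ht], hx.2⟩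
      have := hs.eq_Ψ _ hwt
      simp only [dy_shift, transport_shift, dy_iter_shift] at this
      linear_combination κ t * this

/-- Integrals over the plane reduce to integrals over `0 < z < Z`. -/
theorem integral_eq_integral_mu {Z : ℝ} {F : ℝ × ℝ → ℝ} (h1 : ∀ y z, z ≤ 0 → F (y, z) = 0)
    (h2 : ∀ y z, ¬(0 < y ∧ z < Z) → F (y, z) = 0) : ∫ x, F x = ∫ x, F x ∂mu (Z : EReal) := by
  rw [mu, setIntegral_eq_integral_of_forall_compl_eq_zero]
  intro x hx
  by_cases h0 : 0 < x.2
  · exact h2 x.1 x.2 fun h => hx ⟨h.1, h0, EReal.coe_lt_coe_iff.2 h.2⟩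
  · exact h1 x.1 x.2 (not_lt.1 h0)

theorem deriv_iter_add (κ : ℝ → ℝ) (n : ℕ) : deriv (deriv^[n] κ) = deriv^[n + 1] κ :=
  (Function.iterate_succ_apply' _ _ _).symm

section weak

variable {p Ψ a b c d : ℝ × ℝ → ℝ} {Z : ℝ}
  (hs : WeakSystem h p Ψ a b c d) (hp : IsDatum p) (hΨ : IsDatum Ψ) (ha : IsDatum a)
  (hb : IsDatum b) (hc : IsDatum c) (hd : IsDatum d) (hκ : IsTest (Iio 0) κ)
  (hZ : (Z : EReal) ≤ h)

/-- The `n`-th `y`-derivative of the mollified function, written with the derivative of the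
kernel. -/
def molD (κ : ℝ → ℝ) (n : ℕ) (f : ℝ × ℝ → ℝ) : ℝ × ℝ → ℝ := mol (deriv^[n] κ) f

include hκ in
theorem IsDatum.molD (hf : IsDatum f) (n : ℕ) : IsDatum (molD κ n f) :=
  hf.mol (hκ.deriv_iter_Iio n)

include hκ in
theorem IsDatum.hasDerivAt_molD (hf : IsDatum f) (n : ℕ) : ∀ᵐ z : ℝ, ∀ y : ℝ,
    HasDerivAt (fun y => EquatorialLayer.molD κ n f (y, z))
      (EquatorialLayer.molD κ (n + 1) f (y, z)) y := by
  have := hasDerivAt_mol (hκ.deriv_iter_Iio n) hf.meas hf.memLp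
  rwa [deriv_iter_add] at this

include hκ in
theorem IsDatum.integral_molD_mul_dy (hf : IsDatum f) {Q : Set (ℝ × ℝ)} {φ : ℝ × ℝ → ℝ}
    (hφ : IsTest Q φ) (n : ℕ) :
    ∫ x, EquatorialLayer.mol κ f x * (dy^[n] φ) x
      = (-1) ^ n * ∫ x, EquatorialLayer.molD κ n f x * φ x :=
  integral_mol_mul_dy_iter hκ hf.meas hf.memLp hφ n

/-- The weak `z`-derivative of the mollification of `Ψ`. -/
def dzΨ (κ : ℝ → ℝ) (p Ψ a b : ℝ × ℝ → ℝ) : ℝ × ℝ → ℝ := fun x =>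
  -(x.2 * molD κ 1 Ψ x) - 1 / 2 * molD κ 3 p x + mol κ a x - molD κ 1 b x

/-- The weak `z`-derivative of the mollification of `∂_y p`. -/
def dzp (κ : ℝ → ℝ) (p Ψ c d : ℝ × ℝ → ℝ) : ℝ × ℝ → ℝ := fun x =>
  -(x.2 * molD κ 2 p x) + 1 / 2 * molD κ 4 Ψ x + mol κ c x + molD κ 2 d x

theorem IsDatum.integrable_mul_test {f : ℝ × ℝ → ℝ} (hf : IsDatum f) {Q : Set (ℝ × ℝ)}
    {φ : ℝ × ℝ → ℝ} (hφ : IsTest Q φ) : Integrable (fun x => f x * φ x) volume :=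
  hf.memLp.integrable_mul hφ.memLp_volume

include hs hp hΨ ha hb hc hd hκ hZ in
theorem WeakSystem.hasWeakDzZero :
    HasWeakDzZero Z (EquatorialLayer.mol κ Ψ) (dzΨ κ p Ψ a b) := by
  intro w hw
  have hm := (hs.mol hp hΨ ha hb hc hd hκ).eq_Ψ w (hw.mono fun x hx =>
    ⟨hx.1, (EReal.coe_lt_coe_iff.2 hx.2).trans_le hZ⟩)
  have hzw : IsTest _ (fun x : ℝ × ℝ => x.2 * w x) := hw.mul_left contDiff_snd
  have e1 := hΨ.integral_molD_mul_dy hκ hzw 1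
  have e2 := hp.integral_molD_mul_dy hκ hw 3
  have e3 := hb.integral_molD_mul_dy hκ hw 1
  simp only [Function.iterate_one] at e1 e3
  have hdz : dy (fun x : ℝ × ℝ => x.2 * w x) = fun x => x.2 * dy w x :=
    dy_snd_mul hw.differentiable (fun t => t) differentiable_id
  rw [hdz] at e1
  have hΨ0 := hΨ.mol hκ
  have i0 := hΨ0.integrable_mul_test hw.dz
  have i1 := hΨ0.integrable_mul_test (hw.dy.mul_left (g := fun x : ℝ × ℝ => x.2) contDiff_snd)
  have e4 : ∫ x, EquatorialLayer.mol κ Ψ x * transport w x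
      = (∫ x, EquatorialLayer.mol κ Ψ x * dz w x)
        + ∫ x, EquatorialLayer.mol κ Ψ x * (x.2 * dy w x) := by
    rw [← integral_add i0 i1]
    exact integral_congr_ae (Eventually.of_forall fun x => by simp only [transport]; ring)
  have j1 := (hΨ.molD hκ 1).integrable_mul_test hzw
  have j2 := (hp.molD hκ 3).integrable_mul_test hw
  have j3 := (ha.mol hκ).integrable_mul_test hw
  have j4 := (hb.molD hκ 1).integrable_mul_test hw
  have e5 : ∫ x, dzΨ κ p Ψ a b x * w x = -(∫ x, EquatorialLayer.molD κ 1 Ψ x * (x.2 * w x))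
      - 1 / 2 * (∫ x, EquatorialLayer.molD κ 3 p x * w x) + (∫ x, EquatorialLayer.mol κ a x * w x)
      - ∫ x, EquatorialLayer.molD κ 1 b x * w x := by
    have k1 := integral_sub j1.neg (j2.const_mul (1 / 2))
    have k2 := integral_add (j1.neg.sub (j2.const_mul (1 / 2))) j3
    have k3 := integral_sub ((j1.neg.sub (j2.const_mul (1 / 2))).add j3) j4
    simp only [Pi.neg_apply, Pi.sub_apply, Pi.add_apply] at k1 k2 k3
    rw [← integral_neg, ← integral_const_mul, ← k1, ← k2, ← k3]
    refine integral_congr_ae (Eventually.of_forall fun x => ?_)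
    simp only [dzΨ]; ring
  have hw0 : ∀ y z, ¬(0 < y ∧ z < Z) → w (y, z) = 0 := fun y z h => hw.eq_zero h
  have hdw0 : ∀ y z, ¬(0 < y ∧ z < Z) → dz w (y, z) = 0 := fun y z h => hw.dz.eq_zero h
  rw [← integral_eq_integral_mu (Z := Z) (F := fun x => EquatorialLayer.mol κ Ψ x * dz w x)
      (fun y z h => by rw [hΨ0.zero y z h, zero_mul]) (fun y z h => by rw [hdw0 y z h, mul_zero]),
    ← integral_eq_integral_mu (Z := Z) (F := fun x => dzΨ κ p Ψ a b x * w x)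
      (fun y z h => by
        simp only [dzΨ]
        rw [(hΨ.molD hκ 1).zero y z h, (hp.molD hκ 3).zero y z h, (ha.mol hκ).zero y z h,
          (hb.molD hκ 1).zero y z h]
        ring)
      (fun y z h => by rw [hw0 y z h, mul_zero]), e5]
  rw [e4, e1, e2, e3] at hm
  linear_combination -hm

include hs hp hΨ ha hb hc hd hκ hZ in
theorem WeakSystem.hasWeakDz :
    HasWeakDz (Dom (Z : EReal)) (EquatorialLayer.molD κ 1 p) (dzp κ p Ψ c d) := by
  intro φ hφ
  have hm := (hs.mol hp hΨ ha hb hc hd hκ).eq_p φ (hφ.mono (dom_mono hZ))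
  have hzw : IsTest _ (fun x : ℝ × ℝ => x.2 * φ x) := hφ.mul_left contDiff_snd
  have e0 := hp.integral_molD_mul_dy hκ hφ.dz 1
  have e1 := hp.integral_molD_mul_dy hκ hzw 2
  have e2 := hΨ.integral_molD_mul_dy hκ hφ 4
  have e3 := hd.integral_molD_mul_dy hκ hφ 2
  have hdz : dy^[2] (fun x : ℝ × ℝ => x.2 * φ x) = fun x => x.2 * dy (dy φ) x := by
    change dy (dy _) = _
    rw [dy_snd_mul hφ.differentiable (fun t => t) differentiable_id,
      dy_snd_mul hφ.dy.differentiable (fun t => t) differentiable_id]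
  rw [hdz] at e1
  simp only [Function.iterate_one, dy_dz_comm hφ.smooth] at e0
  have hp0 := hp.mol hκ
  have i0 := hp0.integrable_mul_test hφ.dy.dz
  have i1 := hp0.integrable_mul_test (hφ.dy.dy.mul_left (g := fun x : ℝ × ℝ => x.2) contDiff_snd)
  have e4 : ∫ x, EquatorialLayer.mol κ p x * transport (dy φ) x
      = (∫ x, EquatorialLayer.mol κ p x * dz (dy φ) x)
        + ∫ x, EquatorialLayer.mol κ p x * (x.2 * dy (dy φ) x) := by
    rw [← integral_add i0 i1]
    exact integral_congr_ae (Eventually.of_forall fun x => by simp only [transport]; ring)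
  have j1 := (hp.molD hκ 2).integrable_mul_test hzw
  have j2 := (hΨ.molD hκ 4).integrable_mul_test hφ
  have j3 := (hc.mol hκ).integrable_mul_test hφ
  have j4 := (hd.molD hκ 2).integrable_mul_test hφ
  have e5 : ∫ x, dzp κ p Ψ c d x * φ x = -(∫ x, EquatorialLayer.molD κ 2 p x * (x.2 * φ x))
      + 1 / 2 * (∫ x, EquatorialLayer.molD κ 4 Ψ x * φ x) + (∫ x, EquatorialLayer.mol κ c x * φ x)
      + ∫ x, EquatorialLayer.molD κ 2 d x * φ x := by
    have k1 := integral_add j1.neg (j2.const_mul (1 / 2))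
    have k2 := integral_add (j1.neg.add (j2.const_mul (1 / 2))) j3
    have k3 := integral_add ((j1.neg.add (j2.const_mul (1 / 2))).add j3) j4
    simp only [Pi.neg_apply, Pi.add_apply] at k1 k2 k3
    rw [← integral_neg, ← integral_const_mul, ← k1, ← k2, ← k3]
    refine integral_congr_ae (Eventually.of_forall fun x => ?_)
    simp only [dzp]; ring
  have hw0 : ∀ y z, ¬(0 < y ∧ z < Z) → φ (y, z) = 0 := fun y z h => hφ.eq_zero fun hx =>
    h ⟨hx.1, EReal.coe_lt_coe_iff.1 hx.2.2⟩
  have hdw0 : ∀ y z, ¬(0 < y ∧ z < Z) → dz φ (y, z) = 0 := fun y z h => hφ.dz.eq_zero fun hx =>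
    h ⟨hx.1, EReal.coe_lt_coe_iff.1 hx.2.2⟩
  change ∫ x, _ ∂mu (Z : EReal) = -∫ x, _ ∂mu (Z : EReal)
  rw [← integral_eq_integral_mu (Z := Z) (F := fun x => EquatorialLayer.molD κ 1 p x * dz φ x)
      (fun y z h => by rw [(hp.molD hκ 1).zero y z h, zero_mul])
      (fun y z h => by rw [hdw0 y z h, mul_zero]),
    ← integral_eq_integral_mu (Z := Z) (F := fun x => dzp κ p Ψ c d x * φ x)
      (fun y z h => by
        simp only [dzp]
        rw [(hp.molD hκ 2).zero y z h, (hΨ.molD hκ 4).zero y z h, (hc.mol hκ).zero y z h,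
          (hd.molD hκ 2).zero y z h]
        ring)
      (fun y z h => by rw [hw0 y z h, mul_zero]), e5]
  rw [e4, e0, e1, e2, e3] at hm
  linear_combination -hm

end weak

end

section

/-! ### The energy estimate for the mollified system -/

/-- Young's inequality for a product with a bounded coefficient. -/
theorem neg_le_mul_mul {k s t M ε : ℝ} (hε : 0 < ε) (hk : |k| ≤ M) :
    -(ε * t ^ 2 + M ^ 2 / (4 * ε) * s ^ 2) ≤ k * s * t := by
  have h1 : k ^ 2 ≤ M ^ 2 := sq_le_sq' (by linarith [neg_abs_le k]) (le_trans (le_abs_self k) hk)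
  have h2 : k ^ 2 / (4 * ε) * s ^ 2 ≤ M ^ 2 / (4 * ε) * s ^ 2 := by gcongr
  have h3 : 0 ≤ ε * (t + k * s / (2 * ε)) ^ 2 := by positivity
  have h4 : ε * (t + k * s / (2 * ε)) ^ 2 = ε * t ^ 2 + k * s * t + k ^ 2 / (4 * ε) * s ^ 2 := by
    field_simp; ring
  linarith

/-- The weight of the identity `∫ ∂_y (η² (p ∂_y p + Ψ ∂_y Ψ)) = 0` in the energy estimate. It is so
large that the terms `∂_y² v` and `∂_y³ ψ`, of intermediate order, have a positive coefficient. -/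
def interpConst (B : ℝ) : ℝ := 64 * B ^ 2 + 1

/-- A bound for the coefficients of the lower order terms in the energy estimate. -/
def coefConst (B Z : ℝ) : ℝ :=
  1 + 12 * B ^ 2 + 12 * B + 4 * B * (1 + Z) + interpConst B + 2 * interpConst B * B

/-- The quadratic form of the energy identity is coercive. Here `x, y, u, v` stand for
`η² ∂_y³ v`, `η² ∂_y⁴ ψ`, `η ∂_y² v`, `η ∂_y³ ψ`. -/
theorem energy_form_coercive {B Z e q r m z x y u v P S a b c d : ℝ} (hB : 0 ≤ B) (he : |e| ≤ 1)
    (hq : |q| ≤ B) (hr : |r| ≤ B) (hm : |m| ≤ B) (hz0 : 0 ≤ z) (hz : z ≤ Z) :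
    1 / 4 * (x ^ 2 + y ^ 2)
        - 20 * coefConst B Z ^ 2 * (P ^ 2 + S ^ 2 + a ^ 2 + b ^ 2 + c ^ 2 + d ^ 2)
      ≤ 1 / 2 * x ^ 2 + 1 / 2 * y ^ 2 + 2 * q * u * x + 4 * q * v * y
        + (6 * q ^ 2 + 2 * e * r) * S * y + 4 * e ^ 2 * (m + z * q) * S * u + e ^ 3 * a * u
        + e ^ 2 * b * x + e ^ 4 * S * c + 4 * e ^ 2 * q * b * u + e ^ 2 * d * y
        + 8 * e ^ 2 * q * d * v + (12 * e ^ 2 * q ^ 2 + 4 * e ^ 3 * r) * S * d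
        + interpConst B * (u ^ 2 + v ^ 2) + interpConst B * P * x + interpConst B * S * y
        + 2 * interpConst B * q * P * u + 2 * interpConst B * q * S * v := by
  have hZ : 0 ≤ Z := hz0.trans hz
  set K := interpConst B with hK
  have hK0 : 0 ≤ K := by rw [hK, interpConst]; positivity
  set M := coefConst B Z with hM
  have hM' : M = 1 + 12 * B ^ 2 + 12 * B + 4 * B * (1 + Z) + K + 2 * K * B := by
    rw [hM, coefConst]
  have p1 : 0 ≤ B ^ 2 := sq_nonneg B
  have p2 : 0 ≤ B * (1 + Z) := by positivity
  have p3 : 0 ≤ K * B := by positivity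
  have en : ∀ n : ℕ, |e ^ n| ≤ 1 := fun n => by
    rw [abs_pow]; exact pow_le_one₀ (abs_nonneg e) he
  have hq2 : |q ^ 2| ≤ B ^ 2 := by
    rw [abs_pow]; exact pow_le_pow_left₀ (abs_nonneg q) hq 2
  have mulB : ∀ {s t S T : ℝ}, |s| ≤ S → |t| ≤ T → |s * t| ≤ S * T := fun {s t S T} hs ht => by
    rw [abs_mul]
    exact mul_le_mul hs ht (abs_nonneg _) ((abs_nonneg _).trans hs)
  have cst : ∀ s : ℝ, 0 ≤ s → |s| ≤ s := fun s hs => (abs_of_nonneg hs).le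
  have hzq : |m + z * q| ≤ B + Z * B :=
    (abs_add_le _ _).trans (add_le_add hm (mulB ((abs_of_nonneg hz0).le.trans hz) hq))
  have k1 : |2 * q| ≤ 2 * B := mulB (cst 2 (by norm_num)) hq
  have k2 : |4 * q| ≤ 4 * B := mulB (cst 4 (by norm_num)) hq
  have k3 : |6 * q ^ 2 + 2 * e * r| ≤ M := by
    refine (abs_add_le _ _).trans ((add_le_add (mulB (cst 6 (by norm_num)) hq2)
      (mulB (mulB (cst 2 (by norm_num)) he) hr)).trans ?_)
    linarith
  have k4 : |4 * e ^ 2 * (m + z * q)| ≤ M :=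
    (mulB (mulB (cst 4 (by norm_num)) (en 2)) hzq).trans (by linarith)
  have k5 : |e ^ 3| ≤ M := (en 3).trans (by linarith)
  have k6 : |e ^ 2| ≤ M := (en 2).trans (by linarith)
  have k7 : |e ^ 4| ≤ 1 := en 4
  have k8 : |4 * e ^ 2 * q| ≤ M := (mulB (mulB (cst 4 (by norm_num)) (en 2)) hq).trans (by linarith)
  have k9 : |8 * e ^ 2 * q| ≤ M := (mulB (mulB (cst 8 (by norm_num)) (en 2)) hq).trans (by linarith)
  have k10 : |12 * e ^ 2 * q ^ 2 + 4 * e ^ 3 * r| ≤ M := by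
    refine (abs_add_le _ _).trans ((add_le_add (mulB (mulB (cst 12 (by norm_num)) (en 2)) hq2)
      (mulB (mulB (cst 4 (by norm_num)) (en 3)) hr)).trans ?_)
    linarith
  have k11 : |K| ≤ M := (cst K hK0).trans (by linarith)
  have k12 : |2 * K * q| ≤ M := (mulB (cst (2 * K) (by positivity)) hq).trans (by linarith)
  have e16 : (0 : ℝ) < 1 / 16 := by norm_num
  have t1 := neg_le_mul_mul (s := u) (t := x) e16 k1
  have t2 := neg_le_mul_mul (s := v) (t := y) e16 k2
  have t3 := neg_le_mul_mul (s := S) (t := y) e16 k3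
  have t4 := neg_le_mul_mul (s := S) (t := u) e16 k4
  have t5 := neg_le_mul_mul (s := a) (t := u) e16 k5
  have t6 := neg_le_mul_mul (s := b) (t := x) e16 k6
  have t7 := neg_le_mul_mul (s := S) (t := c) one_pos k7
  have t8 := neg_le_mul_mul (s := b) (t := u) e16 k8
  have t9 := neg_le_mul_mul (s := d) (t := y) e16 k6
  have t10 := neg_le_mul_mul (s := d) (t := v) e16 k9
  have t11 := neg_le_mul_mul (s := S) (t := d) one_pos k10
  have t12 := neg_le_mul_mul (s := P) (t := x) e16 k11
  have t13 := neg_le_mul_mul (s := S) (t := y) e16 k11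
  have t14 := neg_le_mul_mul (s := P) (t := u) e16 k12
  have t15 := neg_le_mul_mul (s := S) (t := v) e16 k12
  have hM1 : 1 ≤ M ^ 2 := one_le_pow₀ (by linarith)
  have q1 : S ^ 2 ≤ M ^ 2 * S ^ 2 := le_mul_of_one_le_left (sq_nonneg _) hM1
  have q2 : c ^ 2 ≤ M ^ 2 * c ^ 2 := le_mul_of_one_le_left (sq_nonneg _) hM1
  have q3 : d ^ 2 ≤ M ^ 2 * d ^ 2 := le_mul_of_one_le_left (sq_nonneg _) hM1
  have r1 : 0 ≤ M ^ 2 * P ^ 2 := by positivity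
  have r2 : 0 ≤ M ^ 2 * S ^ 2 := by positivity
  have r3 : 0 ≤ M ^ 2 * a ^ 2 := by positivity
  have r4 : 0 ≤ M ^ 2 * b ^ 2 := by positivity
  have r5 : 0 ≤ M ^ 2 * c ^ 2 := by positivity
  have r6 : 0 ≤ M ^ 2 * d ^ 2 := by positivity
  have s1 : K * (u ^ 2 + v ^ 2) = 64 * (B ^ 2 * u ^ 2) + u ^ 2 + 64 * (B ^ 2 * v ^ 2) + v ^ 2 := by
    rw [hK, interpConst]; ring
  have s2 : 0 ≤ B ^ 2 * u ^ 2 := by positivity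
  have s3 : 0 ≤ B ^ 2 * v ^ 2 := by positivity
  have s4 : 0 ≤ u ^ 2 := by positivity
  have s5 : 0 ≤ v ^ 2 := by positivity
  have s6 : 0 ≤ x ^ 2 := by positivity
  have s7 : 0 ≤ y ^ 2 := by positivity
  ring_nf at t1 t2 t3 t4 t5 t6 t7 t8 t9 t10 t11 t12 t13 t14 t15 s1 q1 q2 q3 r1 r2 r3 r4 r5 r6 s2 s3 ⊢
  linarith

/-- The integrand of the energy identity: the product rule in `z`, with
`∂_z Ψ = -z ∂_y Ψ - ½ ∂_y³ p + a - ∂_y b` and `∂_z ∂_y p = -z ∂_y² p + ½ ∂_y⁴ Ψ + c + ∂_y² d`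
inserted, plus a `y`-derivative. -/
theorem energy_identity_integrand
    (z X X₁ X₂ t t₁ K P0 P1 P2 P3 S0 S1 S2 S3 S4 A0 B0 B1 C0 D0 D1 D2 : ℝ) :
    X ^ 4 * (t ^ 4 * ((-(z * S1) - 1 / 2 * P3 + A0 - B1) * P1
          + S0 * (-(z * P2) + 1 / 2 * S4 + C0 + D2)) + 4 * t ^ 3 * t₁ * (S0 * P1))
      + (t ^ 4 * ((4 * X ^ 3 * X₁) * (z * (S0 * P1) + 1 / 2 * (P1 * P2) - 1 / 2 * (S0 * S3)
            + 1 / 2 * (S1 * S2) + B0 * P1 - S0 * D1 + S1 * D0)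
          + X ^ 4 * (z * (S1 * P1 + S0 * P2) + 1 / 2 * (P2 * P2 + P1 * P3)
            - 1 / 2 * (S1 * S3 + S0 * S4) + 1 / 2 * (S2 * S2 + S1 * S3) + (B1 * P1 + B0 * P2)
            - (S1 * D1 + S0 * D2) + (S2 * D0 + S1 * D1))
          + ((12 * X ^ 2 * X₁ ^ 2 + 4 * X ^ 3 * X₂) * (1 / 2 * (S0 * S2) + S0 * D0)
          + (4 * X ^ 3 * X₁) * (1 / 2 * (S1 * S2 + S0 * S3) + (S1 * D0 + S0 * D1))))
        + K * t ^ 2 * ((2 * X * X₁) * (P0 * P1 + S0 * S1)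
          + X ^ 2 * (P1 * P1 + P0 * P2 + (S1 * S1 + S0 * S2))))
    = 1 / 2 * ((X * t) ^ 2 * P2) ^ 2 + 1 / 2 * ((X * t) ^ 2 * S2) ^ 2
      + 2 * (X₁ * t) * (X * t * P1) * ((X * t) ^ 2 * P2)
      + 4 * (X₁ * t) * (X * t * S1) * ((X * t) ^ 2 * S2)
      + (6 * (X₁ * t) ^ 2 + 2 * (X * t) * (X₂ * t)) * S0 * ((X * t) ^ 2 * S2)
      + 4 * (X * t) ^ 2 * (X * t₁ + z * (X₁ * t)) * S0 * (X * t * P1)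
      + (X * t) ^ 3 * A0 * (X * t * P1) + (X * t) ^ 2 * B0 * ((X * t) ^ 2 * P2)
      + (X * t) ^ 4 * S0 * C0 + 4 * (X * t) ^ 2 * (X₁ * t) * B0 * (X * t * P1)
      + (X * t) ^ 2 * D0 * ((X * t) ^ 2 * S2) + 8 * (X * t) ^ 2 * (X₁ * t) * D0 * (X * t * S1)
      + (12 * (X * t) ^ 2 * (X₁ * t) ^ 2 + 4 * (X * t) ^ 3 * (X₂ * t)) * S0 * D0
      + K * ((X * t * P1) ^ 2 + (X * t * S1) ^ 2) + K * P0 * ((X * t) ^ 2 * P2)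
      + K * S0 * ((X * t) ^ 2 * S2) + 2 * K * (X₁ * t) * P0 * (X * t * P1)
      + 2 * K * (X₁ * t) * S0 * (X * t * S1) := by
  ring

end

section

/-- The `y`-derivative in the energy identity, on a horizontal line. -/
theorem hasDerivAt_energy_flux {X X₁ P0 P1 P2 S0 S1 S2 S3 B0 D0 D1 : ℝ → ℝ}
    {y X₂ P3 S4 B1 D2 : ℝ} (z t K : ℝ) (hX : HasDerivAt X (X₁ y) y) (hX₁ : HasDerivAt X₁ X₂ y)
    (hP0 : HasDerivAt P0 (P1 y) y) (hP1 : HasDerivAt P1 (P2 y) y) (hP2 : HasDerivAt P2 P3 y)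
    (hS0 : HasDerivAt S0 (S1 y) y) (hS1 : HasDerivAt S1 (S2 y) y) (hS2 : HasDerivAt S2 (S3 y) y)
    (hS3 : HasDerivAt S3 S4 y) (hB0 : HasDerivAt B0 B1 y) (hD0 : HasDerivAt D0 (D1 y) y)
    (hD1 : HasDerivAt D1 D2 y) :
    HasDerivAt (fun y => t ^ 4 * (X y ^ 4 * (z * (S0 y * P1 y) + 1 / 2 * (P1 y * P2 y)
        - 1 / 2 * (S0 y * S3 y) + 1 / 2 * (S1 y * S2 y) + B0 y * P1 y - S0 y * D1 y + S1 y * D0 y)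
        + (4 * X y ^ 3 * X₁ y) * (1 / 2 * (S0 y * S2 y) + S0 y * D0 y))
        + K * t ^ 2 * (X y ^ 2 * (P0 y * P1 y + S0 y * S1 y)))
      (t ^ 4 * ((4 * X y ^ 3 * X₁ y) * (z * (S0 y * P1 y) + 1 / 2 * (P1 y * P2 y)
            - 1 / 2 * (S0 y * S3 y)
            + 1 / 2 * (S1 y * S2 y) + B0 y * P1 y - S0 y * D1 y + S1 y * D0 y)
          + X y ^ 4 * (z * (S1 y * P1 y + S0 y * P2 y) + 1 / 2 * (P2 y * P2 y + P1 y * P3)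
            - 1 / 2 * (S1 y * S3 y + S0 y * S4) + 1 / 2 * (S2 y * S2 y + S1 y * S3 y)
            + (B1 * P1 y + B0 y * P2 y) - (S1 y * D1 y + S0 y * D2) + (S2 y * D0 y + S1 y * D1 y))
          + ((12 * X y ^ 2 * X₁ y ^ 2 + 4 * X y ^ 3 * X₂) * (1 / 2 * (S0 y * S2 y) + S0 y * D0 y)
          + (4 * X y ^ 3 * X₁ y)
            * (1 / 2 * (S1 y * S2 y + S0 y * S3 y) + (S1 y * D0 y + S0 y * D1 y))))
        + K * t ^ 2 * ((2 * X y * X₁ y) * (P0 y * P1 y + S0 y * S1 y)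
          + X y ^ 2 * (P1 y * P1 y + P0 y * P2 y + (S1 y * S1 y + S0 y * S2 y)))) y := by
  have n1 := ((((((hS0.fun_mul hP1).const_mul z).fun_add ((hP1.fun_mul hP2).const_mul (1 / 2))).fun_sub
    ((hS0.fun_mul hS3).const_mul (1 / 2))).fun_add ((hS1.fun_mul hS2).const_mul (1 / 2))).fun_add
    (hB0.fun_mul hP1)).fun_sub (hS0.fun_mul hD1)
  have n1' := n1.fun_add (hS1.fun_mul hD0)
  have n2 := ((hS0.fun_mul hS2).const_mul (1 / 2)).fun_add (hS0.fun_mul hD0)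
  have n3 := (hP0.fun_mul hP1).fun_add (hS0.fun_mul hS1)
  have x4 := hX.fun_pow 4
  have x3 := ((hX.fun_pow 3).const_mul 4).fun_mul hX₁
  have x2 := hX.fun_pow 2
  have := (((x4.fun_mul n1').fun_add (x3.fun_mul n2)).const_mul (t ^ 4)).fun_add
    ((x2.fun_mul n3).const_mul (K * t ^ 2))
  refine this.congr_deriv ?_
  push_cast
  ring

variable {κ : ℝ → ℝ} {h : EReal} {p Ψ a b c d : ℝ × ℝ → ℝ} {Z : ℝ}

theorem IsDatum.memLp_mu {f : ℝ × ℝ → ℝ} (hf : IsDatum f) (h : EReal) : MemLp f 2 (mu h) :=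
  hf.memLp.restrict _

theorem ae_mem_Icc (Z : ℝ) : ∀ᵐ x ∂mu (Z : EReal), x.2 ∈ Icc 0 Z := by
  filter_upwards [ae_mem_dom _] with x hx
  exact ⟨hx.2.1.le, (EReal.coe_lt_coe_iff.1 hx.2.2).le⟩

/-- The energy estimate for the mollified system. With `η = χ(y) θ(z)`, the first equation times
`η⁴ Ψ` plus the second equation times `η⁴ ∂_y p` is integrated. The `z`-derivatives form a total
derivative, since `Ψ = 0` at the bottom and `θ = 0` at the top; integrations by parts in `y` turn the
terms of highest order into `½ η⁴ ((∂_y² p)² + (∂_y² Ψ)²)`. The constant does not depend on the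
kernel. -/
theorem WeakSystem.energy_estimate (hs : WeakSystem h p Ψ a b c d) (hp : IsDatum p)
    (hΨ : IsDatum Ψ) (ha : IsDatum a) (hb : IsDatum b) (hc : IsDatum c) (hd : IsDatum d)
    (hκ : IsTest (Iio 0) κ) (hκ0 : ∀ t, 0 ≤ κ t) (hκ1 : ∫ t, κ t = 1) (hZ0 : 0 < Z)
    (hZ : (Z : EReal) ≤ h) {χ θ : ℝ → ℝ} {α β B : ℝ} (hα : 0 < α) (hχ : ContDiff ℝ ∞ χ)
    (hχs : ∀ y, y ∉ Icc α β → χ y = 0) (hχ1 : ∀ y, |χ y| ≤ 1) (hχB : ∀ y, |deriv χ y| ≤ B)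
    (hχB' : ∀ y, |deriv (deriv χ) y| ≤ B) (hθ : ContDiff ℝ ∞ θ) (hθs : ∀ z, Z ≤ z → θ z = 0)
    (hθ1 : ∀ z, |θ z| ≤ 1) (hθB : ∀ z, |deriv θ z| ≤ B) :
    ∫ x, (((χ x.1 * θ x.2) ^ 2 * molD κ 2 p x) ^ 2
        + ((χ x.1 * θ x.2) ^ 2 * molD κ 2 Ψ x) ^ 2) ∂mu (Z : EReal)
      ≤ 80 * coefConst B Z ^ 2 * ((∫ x, p x ^ 2) + (∫ x, Ψ x ^ 2) + (∫ x, a x ^ 2)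
        + (∫ x, b x ^ 2) + (∫ x, c x ^ 2) + ∫ x, d x ^ 2) := by
  have hB : 0 ≤ B := (abs_nonneg _).trans (hχB 0)
  have hχc : HasCompactSupport χ := HasCompactSupport.intro isCompact_Icc hχs
  have hχ' : ContDiff ℝ ∞ (deriv χ) := (contDiff_infty_iff_deriv.1 hχ).2
  have hχ'' : ContDiff ℝ ∞ (deriv (deriv χ)) := (contDiff_infty_iff_deriv.1 hχ').2
  have hθ' : ContDiff ℝ ∞ (deriv θ) := (contDiff_infty_iff_deriv.1 hθ).2
  have hθc : Continuous θ := hθ.continuous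
  have hχcont := hχ.continuous
  have hχcont' := hχ'.continuous
  have hχcont'' := hχ''.continuous
  have P := fun n => (hp.molD hκ n).memLp_mu (Z : EReal)
  have S := fun n => (hΨ.molD hκ n).memLp_mu (Z : EReal)
  have A := fun n => (ha.molD hκ n).memLp_mu (Z : EReal)
  have Bm := fun n => (hb.molD hκ n).memLp_mu (Z : EReal)
  have Cm := fun n => (hc.molD hκ n).memLp_mu (Z : EReal)
  have D := fun n => (hd.molD hκ n).memLp_mu (Z : EReal)
  have mI : ∀ {f g : ℝ × ℝ → ℝ}, MemLp f 2 (mu (Z : EReal)) → MemLp g 2 (mu (Z : EReal)) →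
      Integrable (fun x => f x * g x) (mu (Z : EReal)) := fun hf hg => hf.integrable_mul hg
  have zb : ∀ᵐ x : ℝ × ℝ ∂mu (Z : EReal), ‖x.2‖ ≤ Z := (ae_mem_Icc Z).mono fun x hx => by
    rw [Real.norm_of_nonneg hx.1]; exact hx.2
  have zI : ∀ {f : ℝ × ℝ → ℝ}, Integrable f (mu (Z : EReal)) →
      Integrable (fun x => x.2 * f x) (mu (Z : EReal)) := fun hf =>
    hf.bdd_mul (f := fun x : ℝ × ℝ => x.2) (c := Z) continuous_snd.aestronglyMeasurable zb
  have zM : ∀ {f : ℝ × ℝ → ℝ}, MemLp f 2 (mu (Z : EReal)) →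
      MemLp (fun x => x.2 * f x) 2 (mu (Z : EReal)) := fun hf => by
    refine (hf.const_mul Z).mono (continuous_snd.aestronglyMeasurable.mul hf.1) ?_
    filter_upwards [zb] with x hx
    rw [norm_mul, norm_mul, Real.norm_of_nonneg hZ0.le]
    gcongr
  -- coefficients `k(z) g(y)` are bounded on the strip, as `g` has compact support
  have cI : ∀ {f : ℝ × ℝ → ℝ} {g k : ℝ → ℝ}, Integrable f (mu (Z : EReal)) → Continuous g →
      (∀ y, y ∉ Icc α β → g y = 0) → Continuous k →
      Integrable (fun x => k x.2 * (g x.1 * f x)) (mu (Z : EReal)) := by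
    intro f g k hf hg hg0 hk
    obtain ⟨M, hM⟩ := (HasCompactSupport.intro (isCompact_Icc (a := α) (b := β))
      hg0).exists_bound_of_continuous hg
    obtain ⟨M₁, hM₁⟩ := isCompact_Icc.exists_bound_of_continuousOn (s := Icc 0 Z) hk.continuousOn
    have h1 := hf.bdd_mul (f := fun x : ℝ × ℝ => g x.1) (c := M)
      (hg.comp continuous_fst).aestronglyMeasurable (Eventually.of_forall fun x => hM _)
    exact h1.bdd_mul (f := fun x : ℝ × ℝ => k x.2) (c := M₁)
      (hk.comp continuous_snd).aestronglyMeasurable ((ae_mem_Icc Z).mono fun x hx => hM₁ _ hx)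
  have hχ0 : ∀ y, y ∉ Icc α β → ∀ n : ℕ, n ≠ 0 → χ y ^ n = 0 := fun y hy n hn => by
    rw [hχs y hy, zero_pow hn]
  set K := interpConst B
  -- the identity from the product rule in `z`
  let E₁ : ℝ × ℝ → ℝ := fun x => χ x.1 ^ 4 * (θ x.2 ^ 4 * ((dzΨ κ p Ψ a b x) * molD κ 1 p x
    + molD κ 0 Ψ x * dzp κ p Ψ c d x)
      + 4 * θ x.2 ^ 3 * deriv θ x.2 * (molD κ 0 Ψ x * molD κ 1 p x))
  have F2 : MemLp (dzΨ κ p Ψ a b) 2 (mu (Z : EReal)) :=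
    (((zM (S 1)).neg.sub ((P 3).const_mul (1 / 2))).add (A 0)).sub (Bm 1)
  have G2 : MemLp (dzp κ p Ψ c d) 2 (mu (Z : EReal)) :=
    (((zM (P 2)).neg.add ((S 4).const_mul (1 / 2))).add (Cm 0)).add (D 2)
  have Fm : StronglyMeasurable (dzΨ κ p Ψ a b) :=
    (((continuous_snd.stronglyMeasurable.mul (hΨ.molD hκ 1).meas).neg.sub
      ((hp.molD hκ 3).meas.const_mul (1 / 2))).add (ha.molD hκ 0).meas).sub (hb.molD hκ 1).meas
  have Gm : StronglyMeasurable (dzp κ p Ψ c d) :=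
    (((continuous_snd.stronglyMeasurable.mul (hp.molD hκ 2).meas).neg.add
      ((hΨ.molD hκ 4).meas.const_mul (1 / 2))).add (hc.molD hκ 0).meas).add (hd.molD hκ 2).meas
  have i₁ : Integrable E₁ (mu (Z : EReal)) := by
    have j1 := cI (k := fun z => θ z ^ 4) (g := fun y => χ y ^ 4)
      ((mI F2 (P 1)).add (mI (S 0) G2)) (by fun_prop) (fun y hy => hχ0 y hy 4 (by norm_num))
      (by fun_prop)
    have j2 := cI (k := fun z => 4 * θ z ^ 3 * deriv θ z) (g := fun y => χ y ^ 4)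
      (mI (S 0) (P 1)) (by fun_prop) (fun y hy => hχ0 y hy 4 (by norm_num))
      (by have := hθ'.continuous; fun_prop)
    refine (j1.add j2).congr (Eventually.of_forall fun x => ?_)
    simp only [E₁, Pi.add_apply]; ring
  have z₁ : ∫ x, E₁ x ∂mu (Z : EReal) = 0 := by
    have hX : ContDiff ℝ ∞ fun z => θ z ^ 4 := hθ.pow 4
    have := (hs.hasWeakDzZero hp hΨ ha hb hc hd hκ hZ).integral_mul hZ0
      (hs.hasWeakDz hp hΨ ha hb hc hd hκ hZ) Fm Gm (S 0) F2 (P 1) G2 (X := fun y => χ y ^ 4)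
      (by fun_prop) (HasCompactSupport.intro isCompact_Icc fun y hy => hχ0 y hy 4 (by norm_num)) hX
      (by simp only [hθs Z le_rfl]; norm_num)
    refine Eq.trans (integral_congr_ae (Eventually.of_forall fun x => ?_)) this
    have hd4 : deriv (fun z => θ z ^ 4) x.2 = 4 * θ x.2 ^ 3 * deriv θ x.2 := by
      have := ((hθ.differentiable (by simp) x.2).hasDerivAt.fun_pow 4).deriv
      rw [this]; norm_num
    simp only [E₁, hd4]
    rfl
  -- the identity from integration by parts in `y`
  let N₁ : ℝ × ℝ → ℝ := fun x => x.2 * (molD κ 0 Ψ x * molD κ 1 p x)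
    + 1 / 2 * (molD κ 1 p x * molD κ 2 p x) - 1 / 2 * (molD κ 0 Ψ x * molD κ 3 Ψ x)
    + 1 / 2 * (molD κ 1 Ψ x * molD κ 2 Ψ x) + molD κ 0 b x * molD κ 1 p x
    - molD κ 0 Ψ x * molD κ 1 d x + molD κ 1 Ψ x * molD κ 0 d x
  let N₁' : ℝ × ℝ → ℝ := fun x =>
    x.2 * (molD κ 1 Ψ x * molD κ 1 p x + molD κ 0 Ψ x * molD κ 2 p x)
    + 1 / 2 * (molD κ 2 p x * molD κ 2 p x + molD κ 1 p x * molD κ 3 p x)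
    - 1 / 2 * (molD κ 1 Ψ x * molD κ 3 Ψ x + molD κ 0 Ψ x * molD κ 4 Ψ x)
    + 1 / 2 * (molD κ 2 Ψ x * molD κ 2 Ψ x + molD κ 1 Ψ x * molD κ 3 Ψ x)
    + (molD κ 1 b x * molD κ 1 p x + molD κ 0 b x * molD κ 2 p x)
    - (molD κ 1 Ψ x * molD κ 1 d x + molD κ 0 Ψ x * molD κ 2 d x)
    + (molD κ 2 Ψ x * molD κ 0 d x + molD κ 1 Ψ x * molD κ 1 d x)
  let N₂ : ℝ × ℝ → ℝ := fun x =>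
    1 / 2 * (molD κ 0 Ψ x * molD κ 2 Ψ x) + molD κ 0 Ψ x * molD κ 0 d x
  let N₂' : ℝ × ℝ → ℝ := fun x =>
    1 / 2 * (molD κ 1 Ψ x * molD κ 2 Ψ x + molD κ 0 Ψ x * molD κ 3 Ψ x)
    + (molD κ 1 Ψ x * molD κ 0 d x + molD κ 0 Ψ x * molD κ 1 d x)
  let N₃ : ℝ × ℝ → ℝ := fun x => molD κ 0 p x * molD κ 1 p x + molD κ 0 Ψ x * molD κ 1 Ψ x
  let N₃' : ℝ × ℝ → ℝ := fun x => molD κ 1 p x * molD κ 1 p x + molD κ 0 p x * molD κ 2 p x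
    + (molD κ 1 Ψ x * molD κ 1 Ψ x + molD κ 0 Ψ x * molD κ 2 Ψ x)
  let E₂ : ℝ × ℝ → ℝ := fun x => θ x.2 ^ 4 * ((4 * χ x.1 ^ 3 * deriv χ x.1) * N₁ x
      + χ x.1 ^ 4 * N₁' x
      + ((12 * χ x.1 ^ 2 * deriv χ x.1 ^ 2 + 4 * χ x.1 ^ 3 * deriv (deriv χ) x.1) * N₂ x
      + (4 * χ x.1 ^ 3 * deriv χ x.1) * N₂' x))
    + K * θ x.2 ^ 2 * ((2 * χ x.1 * deriv χ x.1) * N₃ x + χ x.1 ^ 2 * N₃' x)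
  have n₁ : Integrable N₁ (mu (Z : EReal)) :=
    ((((((zI (mI (S 0) (P 1))).add ((mI (P 1) (P 2)).const_mul (1 / 2))).sub
      ((mI (S 0) (S 3)).const_mul (1 / 2))).add ((mI (S 1) (S 2)).const_mul (1 / 2))).add
      (mI (Bm 0) (P 1))).sub (mI (S 0) (D 1))).add (mI (S 1) (D 0))
  have n₁' : Integrable N₁' (mu (Z : EReal)) :=
    ((((((zI ((mI (S 1) (P 1)).add (mI (S 0) (P 2)))).add
      (((mI (P 2) (P 2)).add (mI (P 1) (P 3))).const_mul (1 / 2))).sub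
      (((mI (S 1) (S 3)).add (mI (S 0) (S 4))).const_mul (1 / 2))).add
      (((mI (S 2) (S 2)).add (mI (S 1) (S 3))).const_mul (1 / 2))).add
      ((mI (Bm 1) (P 1)).add (mI (Bm 0) (P 2)))).sub
      ((mI (S 1) (D 1)).add (mI (S 0) (D 2)))).add
      ((mI (S 2) (D 0)).add (mI (S 1) (D 1)))
  have n₂ : Integrable N₂ (mu (Z : EReal)) :=
    ((mI (S 0) (S 2)).const_mul (1 / 2)).add (mI (S 0) (D 0))
  have n₂' : Integrable N₂' (mu (Z : EReal)) :=
    (((mI (S 1) (S 2)).add (mI (S 0) (S 3))).const_mul (1 / 2)).add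
      ((mI (S 1) (D 0)).add (mI (S 0) (D 1)))
  have n₃ : Integrable N₃ (mu (Z : EReal)) := (mI (P 0) (P 1)).add (mI (S 0) (S 1))
  have n₃' : Integrable N₃' (mu (Z : EReal)) :=
    ((mI (P 1) (P 1)).add (mI (P 0) (P 2))).add ((mI (S 1) (S 1)).add (mI (S 0) (S 2)))
  have i₂ : Integrable E₂ (mu (Z : EReal)) := by
    have j1 := cI (k := fun z => θ z ^ 4) (g := fun y => 4 * χ y ^ 3 * deriv χ y) n₁ (by fun_prop)
      (fun y hy => by simp [hχs y hy]) (by fun_prop)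
    have j2 := cI (k := fun z => θ z ^ 4) (g := fun y => χ y ^ 4) n₁' (by fun_prop)
      (fun y hy => by simp [hχs y hy]) (by fun_prop)
    have j3 := cI (k := fun z => θ z ^ 4)
      (g := fun y => 12 * χ y ^ 2 * deriv χ y ^ 2 + 4 * χ y ^ 3 * deriv (deriv χ) y) n₂
      (by fun_prop) (fun y hy => by simp [hχs y hy]) (by fun_prop)
    have j4 := cI (k := fun z => θ z ^ 4) (g := fun y => 4 * χ y ^ 3 * deriv χ y) n₂' (by fun_prop)
      (fun y hy => by simp [hχs y hy]) (by fun_prop)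
    have j5 := cI (k := fun z => K * θ z ^ 2) (g := fun y => 2 * χ y * deriv χ y) n₃ (by fun_prop)
      (fun y hy => by simp [hχs y hy]) (by fun_prop)
    have j6 := cI (k := fun z => K * θ z ^ 2) (g := fun y => χ y ^ 2) n₃' (by fun_prop)
      (fun y hy => by simp [hχs y hy]) (by fun_prop)
    refine (((((j1.add j2).add j3).add j4).add j5).add j6).congr
      (Eventually.of_forall fun x => ?_)
    simp only [E₂, Pi.add_apply]; ring
  have z₂ : ∫ x, E₂ x ∂mu (Z : EReal) = 0 := by
    have hE1 : ∀ y z, z ≤ 0 → E₂ (y, z) = 0 := fun y z hz => by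
      simp only [E₂, N₁, N₁', N₂, N₂', N₃, N₃', (hp.molD hκ _).zero y z hz,
        (hΨ.molD hκ _).zero y z hz, (hb.molD hκ _).zero y z hz]
      ring
    have hE2 : ∀ y z, ¬(0 < y ∧ z < Z) → E₂ (y, z) = 0 := fun y z hyz => by
      by_cases hz : Z ≤ z
      · simp [E₂, hθs z hz]
      · have : χ y = 0 := hχs y fun hy => hyz ⟨hα.trans_le hy.1, not_le.1 hz⟩
        simp [E₂, this]
    rw [← integral_eq_integral_mu hE1 hE2]
    refine integral_eq_zero_of_hasDerivAt_slice (a := α) (b := β)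
      (H := fun x => θ x.2 ^ 4 * (χ x.1 ^ 4 * N₁ x + (4 * χ x.1 ^ 3 * deriv χ x.1) * N₂ x)
        + K * θ x.2 ^ 2 * (χ x.1 ^ 2 * N₃ x)) ?_ ?_ ?_
    · filter_upwards [hp.hasDerivAt_molD hκ 0, hp.hasDerivAt_molD hκ 1, hp.hasDerivAt_molD hκ 2,
        hΨ.hasDerivAt_molD hκ 0, hΨ.hasDerivAt_molD hκ 1, hΨ.hasDerivAt_molD hκ 2,
        hΨ.hasDerivAt_molD hκ 3, hb.hasDerivAt_molD hκ 0, hd.hasDerivAt_molD hκ 0,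
        hd.hasDerivAt_molD hκ 1] with z p0 p1 p2 s0 s1 s2 s3 b0 d0 d1 y
      exact hasDerivAt_energy_flux z (θ z) K (hχ.differentiable (by simp) y).hasDerivAt
        (hχ'.differentiable (by simp) y).hasDerivAt (p0 y) (p1 y) (p2 y) (s0 y) (s1 y) (s2 y)
        (s3 y) (b0 y) (d0 y) (d1 y)
    · intro y z hy
      simp [hχs y hy]
    · refine (integrableOn_iff_integrable_of_support_subset (s := Dom (Z : EReal)) ?_).1 i₂
      intro x hx
      by_contra hn
      refine hx ?_
      by_cases h0 : 0 < x.2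
      · exact hE2 x.1 x.2 fun h => hn ⟨h.1, h0, EReal.coe_lt_coe_iff.2 h.2⟩
      · exact hE1 x.1 x.2 (not_lt.1 h0)
  -- the sum of the two identities has a coercive integrand
  have q : ∀ {f : ℝ × ℝ → ℝ}, IsDatum f →
      Integrable (fun x => molD κ 0 f x ^ 2) (mu (Z : EReal)) := fun hf =>
    ((hf.molD hκ 0).memLp_mu _).integrable_sq
  have qle : ∀ {f : ℝ × ℝ → ℝ}, IsDatum f →
      ∫ x, molD κ 0 f x ^ 2 ∂mu (Z : EReal) ≤ ∫ x, f x ^ 2 := fun hf =>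
    (setIntegral_le_integral (hf.molD hκ 0).memLp.integrable_sq
      (Eventually.of_forall fun x => sq_nonneg _)).trans
        (integral_mol_sq_le hκ hf.meas hf.memLp hκ0 hκ1)
  have qd := ((((((q hp).add (q hΨ)).add (q ha)).add (q hb)).add (q hc)).add (q hd))
  have e2 : ∀ x : ℝ × ℝ, ‖(χ x.1 * θ x.2) ^ 2‖ ≤ 1 := fun x => by
    rw [norm_pow, norm_mul]
    exact pow_le_one₀ (by positivity) (mul_le_one₀ (hχ1 _) (norm_nonneg _) (hθ1 _))
  have wM : ∀ {f : ℝ × ℝ → ℝ}, MemLp f 2 (mu (Z : EReal)) →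
      MemLp (fun x => (χ x.1 * θ x.2) ^ 2 * f x) 2 (mu (Z : EReal)) := fun hf => by
    have hcont : Continuous fun x : ℝ × ℝ => (χ x.1 * θ x.2) ^ 2 := by fun_prop
    refine hf.mono (hcont.aestronglyMeasurable.mul hf.1) (Eventually.of_forall fun x => ?_)
    rw [norm_mul]
    exact mul_le_of_le_one_left (norm_nonneg _) (e2 x)
  have il : Integrable (fun x => ((χ x.1 * θ x.2) ^ 2 * molD κ 2 p x) ^ 2
      + ((χ x.1 * θ x.2) ^ 2 * molD κ 2 Ψ x) ^ 2) (mu (Z : EReal)) :=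
    (wM (P 2)).integrable_sq.add (wM (S 2)).integrable_sq
  have key : ∫ x, (1 / 4 * (((χ x.1 * θ x.2) ^ 2 * molD κ 2 p x) ^ 2
        + ((χ x.1 * θ x.2) ^ 2 * molD κ 2 Ψ x) ^ 2)
      - 20 * coefConst B Z ^ 2 * (molD κ 0 p x ^ 2 + molD κ 0 Ψ x ^ 2 + molD κ 0 a x ^ 2
        + molD κ 0 b x ^ 2 + molD κ 0 c x ^ 2 + molD κ 0 d x ^ 2)) ∂mu (Z : EReal)
      ≤ ∫ x, (E₁ x + E₂ x) ∂mu (Z : EReal) := by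
    refine integral_mono_ae ((il.const_mul _).sub (qd.const_mul _)) (i₁.add i₂) ?_
    filter_upwards [ae_mem_Icc Z] with x hx
    refine (energy_form_coercive (e := χ x.1 * θ x.2) (q := deriv χ x.1 * θ x.2)
      (r := deriv (deriv χ) x.1 * θ x.2) (m := χ x.1 * deriv θ x.2) (z := x.2)
      (u := χ x.1 * θ x.2 * molD κ 1 p x) (v := χ x.1 * θ x.2 * molD κ 1 Ψ x) hB ?_ ?_ ?_ ?_
      hx.1 hx.2).trans (le_of_eq
        (energy_identity_integrand x.2 (χ x.1) (deriv χ x.1) (deriv (deriv χ) x.1) (θ x.2)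
          (deriv θ x.2) K (molD κ 0 p x) (molD κ 1 p x) (molD κ 2 p x) (molD κ 3 p x)
          (molD κ 0 Ψ x) (molD κ 1 Ψ x) (molD κ 2 Ψ x) (molD κ 3 Ψ x) (molD κ 4 Ψ x)
          (molD κ 0 a x) (molD κ 0 b x) (molD κ 1 b x) (molD κ 0 c x) (molD κ 0 d x) (molD κ 1 d x)
          (molD κ 2 d x)).symm)
    · rw [abs_mul]; exact mul_le_one₀ (hχ1 _) (abs_nonneg _) (hθ1 _)
    · rw [abs_mul]; exact (mul_le_of_le_one_right (abs_nonneg _) (hθ1 _)).trans (hχB _)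
    · rw [abs_mul]; exact (mul_le_of_le_one_right (abs_nonneg _) (hθ1 _)).trans (hχB' _)
    · rw [abs_mul]; exact (mul_le_of_le_one_left (abs_nonneg _) (hχ1 _)).trans (hθB _)
  rw [integral_add i₁ i₂, z₁, z₂, add_zero] at key
  have k1 := integral_sub (il.const_mul (1 / 4)) (qd.const_mul (20 * coefConst B Z ^ 2))
  simp only [Pi.add_apply] at k1
  rw [k1, integral_const_mul, integral_const_mul] at key
  have s1 := integral_add (q hp) (q hΨ)
  have s2 := integral_add ((q hp).add (q hΨ)) (q ha)
  have s3 := integral_add (((q hp).add (q hΨ)).add (q ha)) (q hb)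
  have s4 := integral_add ((((q hp).add (q hΨ)).add (q ha)).add (q hb)) (q hc)
  have s5 := integral_add (((((q hp).add (q hΨ)).add (q ha)).add (q hb)).add (q hc)) (q hd)
  simp only [Pi.add_apply] at s1 s2 s3 s4 s5
  rw [s5, s4, s3, s2, s1] at key
  have hM : 0 ≤ coefConst B Z ^ 2 := sq_nonneg _
  have hsum := mul_le_mul_of_nonneg_left (add_le_add (add_le_add (add_le_add (add_le_add
    (add_le_add (qle hp) (qle hΨ)) (qle ha)) (qle hb)) (qle hc)) (qle hd))
    (mul_nonneg (by norm_num : (0 : ℝ) ≤ 80) hM)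
  linarith

end

section

/-! ### Cut-off functions and kernels -/

theorem exists_smoothTransition_bound : ∃ b : ℝ, 0 ≤ b ∧
    (∀ x, |deriv Real.smoothTransition x| ≤ b) ∧
    ∀ x, |deriv (deriv Real.smoothTransition) x| ≤ b := by
  have h0 : ContDiff ℝ ∞ Real.smoothTransition := Real.smoothTransition.contDiff
  have h1 : ContDiff ℝ ∞ (deriv Real.smoothTransition) := (contDiff_infty_iff_deriv.1 h0).2
  have h2 : ContDiff ℝ ∞ (deriv (deriv Real.smoothTransition)) := (contDiff_infty_iff_deriv.1 h1).2
  have hz : ∀ x, x ∉ Icc (0 : ℝ) 1 → deriv Real.smoothTransition x = 0 := by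
    intro x hx
    by_cases hx0 : x < 0
    · have : Real.smoothTransition =ᶠ[𝓝 x] fun _ => 0 := by
        filter_upwards [Iio_mem_nhds hx0] with y hy
        exact Real.smoothTransition.zero_of_nonpos (le_of_lt hy)
      rw [this.deriv_eq]; simp
    · have hx1 : 1 < x := not_le.1 fun h => hx ⟨not_lt.1 hx0, h⟩
      have : Real.smoothTransition =ᶠ[𝓝 x] fun _ => 1 := by
        filter_upwards [Ioi_mem_nhds hx1] with y hy
        exact Real.smoothTransition.one_of_one_le (le_of_lt hy)
      rw [this.deriv_eq]; simp
  have hc : HasCompactSupport (deriv Real.smoothTransition) :=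
    HasCompactSupport.intro isCompact_Icc hz
  obtain ⟨b₁, hb₁⟩ := hc.exists_bound_of_continuous h1.continuous
  obtain ⟨b₂, hb₂⟩ := hc.deriv.exists_bound_of_continuous h2.continuous
  exact ⟨max b₁ b₂, ((norm_nonneg _).trans (hb₁ 0)).trans (le_max_left _ _),
    fun x => (hb₁ x).trans (le_max_left _ _), fun x => (hb₂ x).trans (le_max_right _ _)⟩

/-- A function that equals `1` on `[y₀, R]` and is supported in a compact subset of `(0, ∞)`, with
bounds for its derivatives that do not depend on `R`. -/
theorem exists_cutoff {y₀ : ℝ} (hy₀ : 0 < y₀) : ∃ B : ℝ, ∀ R : ℝ, ∃ χ : ℝ → ℝ, ∃ α β : ℝ, 0 < α ∧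
    ContDiff ℝ ∞ χ ∧ (∀ y, y ∉ Icc α β → χ y = 0) ∧ (∀ y, |χ y| ≤ 1) ∧ (∀ y, |deriv χ y| ≤ B) ∧
    (∀ y, |deriv (deriv χ) y| ≤ B) ∧ ∀ y ∈ Icc y₀ R, χ y = 1 := by
  obtain ⟨b, hb0, hb1, hb2⟩ := exists_smoothTransition_bound
  set σ := Real.smoothTransition with hσ
  have hσs : ContDiff ℝ ∞ σ := Real.smoothTransition.contDiff
  have hσs' : ContDiff ℝ ∞ (deriv σ) := (contDiff_infty_iff_deriv.1 hσs).2
  have hσ1 : ∀ x, |σ x| ≤ 1 := fun x => by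
    rw [abs_of_nonneg (Real.smoothTransition.nonneg x)]; exact Real.smoothTransition.le_one x
  set m := 2 / y₀ with hm
  have hm0 : 0 < m := by positivity
  have d0 : ∀ (k n y : ℝ), HasDerivAt (fun y => σ (k * y + n)) (k * deriv σ (k * y + n)) y := by
    intro k n y
    have h1 : HasDerivAt (fun y : ℝ => k * y + n) k y := by
      simpa using ((hasDerivAt_id y).const_mul k).add_const n
    have := ((hσs.differentiable (by simp)) (k * y + n)).hasDerivAt.comp y h1
    exact this.congr_deriv (mul_comm _ _)
  have d1 : ∀ (k n y : ℝ), HasDerivAt (fun y => k * deriv σ (k * y + n))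
      (k * (k * deriv (deriv σ) (k * y + n))) y := by
    intro k n y
    have h1 : HasDerivAt (fun y : ℝ => k * y + n) k y := by
      simpa using ((hasDerivAt_id y).const_mul k).add_const n
    have := (((hσs'.differentiable (by simp)) (k * y + n)).hasDerivAt.comp y h1).const_mul k
    exact this.congr_deriv (by ring)
  refine ⟨(m + 1) * b + (m * m * b + 2 * (m * b * b) + b), fun R => ?_⟩
  have hB1 : 0 ≤ (m + 1) * b := by positivity
  have hB2 : 0 ≤ m * m * b + 2 * (m * b * b) + b := by positivity
  let χ : ℝ → ℝ := fun y => σ (m * y + -1) * σ (-1 * y + (R + 1))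
  have e1 : ∀ y, HasDerivAt χ (m * deriv σ (m * y + -1) * σ (-1 * y + (R + 1))
      + σ (m * y + -1) * (-1 * deriv σ (-1 * y + (R + 1)))) y := fun y =>
    (d0 m (-1) y).fun_mul (d0 (-1) (R + 1) y)
  have e1' : deriv χ = fun y => m * deriv σ (m * y + -1) * σ (-1 * y + (R + 1))
      + σ (m * y + -1) * (-1 * deriv σ (-1 * y + (R + 1))) := funext fun y => (e1 y).deriv
  have e2 : ∀ y, deriv (deriv χ) y = m * (m * deriv (deriv σ) (m * y + -1)) * σ (-1 * y + (R + 1))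
      + 2 * (m * deriv σ (m * y + -1) * (-1 * deriv σ (-1 * y + (R + 1))))
      + σ (m * y + -1) * (-1 * (-1 * deriv (deriv σ) (-1 * y + (R + 1)))) := fun y => by
    rw [e1']
    have := ((d1 m (-1) y).fun_mul (d0 (-1) (R + 1) y)).fun_add
      ((d0 m (-1) y).fun_mul (d1 (-1) (R + 1) y))
    rw [this.deriv]; ring
  have mulB : ∀ {s t S T : ℝ}, |s| ≤ S → |t| ≤ T → |s * t| ≤ S * T := fun {s t S T} hs ht => by
    rw [abs_mul]
    exact mul_le_mul hs ht (abs_nonneg _) ((abs_nonneg _).trans hs)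
  have cm : |m| ≤ m := (abs_of_pos hm0).le
  have c1 : |(-1 : ℝ)| ≤ 1 := by norm_num
  refine ⟨χ, y₀ / 2, R + 1, by positivity, ?_, ?_, ?_, ?_, ?_, ?_⟩
  · exact (hσs.comp (by fun_prop)).mul (hσs.comp (by fun_prop))
  · intro y hy
    simp only [χ]
    by_cases h1 : y₀ / 2 ≤ y
    · have : R + 1 < y := not_le.1 fun h => hy ⟨h1, h⟩
      rw [show σ (-1 * y + (R + 1)) = 0 from
        Real.smoothTransition.zero_of_nonpos (by linarith), mul_zero]
    · rw [show σ (m * y + -1) = 0 from Real.smoothTransition.zero_of_nonpos ?_, zero_mul]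
      have : m * y ≤ m * (y₀ / 2) := by gcongr; exact (not_le.1 h1).le
      have e : m * (y₀ / 2) = 1 := by rw [hm]; field_simp
      linarith
  · exact fun y => (mulB (hσ1 _) (hσ1 _)).trans (by norm_num)
  · intro y
    rw [e1']
    refine (abs_add_le _ _).trans ((add_le_add (mulB (mulB cm (hb1 _)) (hσ1 _))
      (mulB (hσ1 _) (mulB c1 (hb1 _)))).trans ?_)
    linarith
  · intro y
    rw [e2]
    have t1 := mulB (mulB cm (mulB cm (hb2 (m * y + -1)))) (hσ1 (-1 * y + (R + 1)))
    have t2 := mulB (show |(2 : ℝ)| ≤ 2 by norm_num) (mulB (mulB cm (hb1 (m * y + -1)))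
      (mulB c1 (hb1 (-1 * y + (R + 1)))))
    have t3 := mulB (hσ1 (m * y + -1)) (mulB c1 (mulB c1 (hb2 (-1 * y + (R + 1)))))
    refine (abs_add_le _ _).trans ((add_le_add ((abs_add_le _ _).trans (add_le_add t1 t2))
      t3).trans ?_)
    linarith
  · intro y hy
    simp only [χ]
    have : m * y₀ ≤ m * y := by gcongr; exact hy.1
    have e : m * y₀ = 2 := by rw [hm]; field_simp
    rw [show σ (m * y + -1) = 1 from Real.smoothTransition.one_of_one_le (by linarith),
      show σ (-1 * y + (R + 1)) = 1 from Real.smoothTransition.one_of_one_le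
        (by linarith [hy.2]), one_mul]

/-- A function of `z` that equals `1` for `z ≤ z₁` and vanishes for `z ≥ z₂`. -/
theorem exists_cutoff_top {z₁ z₂ : ℝ} (hz : z₁ < z₂) : ∃ B : ℝ, ∃ θ : ℝ → ℝ, ContDiff ℝ ∞ θ ∧
    (∀ z, z₂ ≤ z → θ z = 0) ∧ (∀ z, |θ z| ≤ 1) ∧ (∀ z, |deriv θ z| ≤ B) ∧ ∀ z ≤ z₁, θ z = 1 := by
  obtain ⟨b, hb0, hb1, -⟩ := exists_smoothTransition_bound
  have hpos : 0 < z₂ - z₁ := sub_pos.2 hz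
  have hσs : ContDiff ℝ ∞ Real.smoothTransition := Real.smoothTransition.contDiff
  refine ⟨b * (1 / (z₂ - z₁)), fun z => Real.smoothTransition ((z₂ - z) / (z₂ - z₁)),
    hσs.comp (by fun_prop), fun z h => ?_, fun z => ?_, fun z => ?_, fun z h => ?_⟩
  · exact Real.smoothTransition.zero_of_nonpos
      (div_nonpos_of_nonpos_of_nonneg (by linarith) hpos.le)
  · rw [abs_of_nonneg (Real.smoothTransition.nonneg _)]
    exact Real.smoothTransition.le_one _
  · have h1 : HasDerivAt (fun z : ℝ => (z₂ - z) / (z₂ - z₁)) (-1 / (z₂ - z₁)) z :=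
      ((hasDerivAt_id' z).const_sub z₂).div_const _
    have h2 := ((hσs.differentiable (by simp)) ((z₂ - z) / (z₂ - z₁))).hasDerivAt.comp z h1
    have h3 : deriv (fun z => Real.smoothTransition ((z₂ - z) / (z₂ - z₁))) z = _ := h2.deriv
    rw [h3, abs_mul, abs_div, abs_neg, abs_one, abs_of_pos hpos]
    gcongr
    exact hb1 _
  · exact Real.smoothTransition.one_of_one_le ((one_le_div hpos).2 (by linarith))

/-- One-sided mollifying kernels: they are supported in `t < 0`. -/
theorem exists_kernel {ε : ℝ} (hε : 0 < ε) : ∃ κ : ℝ → ℝ, IsTest (Iio 0) κ ∧ (∀ t, 0 ≤ κ t) ∧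
    ∫ t, κ t = 1 ∧ ∀ t, κ t ≠ 0 → |t| < ε := by
  let f : ContDiffBump (-(ε / 2)) := ⟨ε / 8, ε / 4, by positivity, by linarith⟩
  have hsupp : ∀ t, f.normed volume t ≠ 0 → |t - -(ε / 2)| < ε / 4 := fun t ht => by
    have : t ∈ Function.support (f.normed volume) := ht
    rwa [f.support_normed_eq, Metric.mem_ball, Real.dist_eq] at this
  refine ⟨f.normed volume, ⟨f.contDiff_normed, f.hasCompactSupport_normed, ?_⟩,
    fun t => f.nonneg_normed t, f.integral_normed, fun t ht => ?_⟩
  · rw [f.tsupport_normed_eq]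
    intro t ht
    rw [Metric.mem_closedBall, Real.dist_eq] at ht
    have := (abs_le.1 ht).2
    simp only [f] at this
    simp only [mem_Iio]
    linarith
  · have := abs_lt.1 (hsupp t ht)
    rw [abs_lt]
    constructor <;> linarith

theorem continuousAt_integral_shift {f G : ℝ × ℝ → ℝ} (hf : IsDatum f) {Q : Set (ℝ × ℝ)}
    (hG : IsTest Q G) :
    ContinuousAt (fun t : ℝ => ∫ x : ℝ × ℝ, f x * G (x.1 + t, x.2)) 0 := by
  obtain ⟨M, hM⟩ := hG.compact.exists_bound_of_continuous hG.continuous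
  obtain ⟨R, hR⟩ := hG.compact.isCompact.isBounded.subset_closedBall (0 : ℝ × ℝ)
  let K := Metric.closedBall (0 : ℝ × ℝ) (R + 1)
  have hK : IsCompact K := isCompact_closedBall _ _
  have hfK : IntegrableOn f K :=
    (hf.memLp.locallyIntegrable (by norm_num)).integrableOn_isCompact hK
  refine continuousAt_of_dominated (bound := K.indicator fun x => ‖f x‖ * M) ?_ ?_ ?_ ?_
  · exact Eventually.of_forall fun t => hf.memLp.1.mul
      (hG.continuous.comp (by fun_prop)).aestronglyMeasurable
  · filter_upwards [Metric.ball_mem_nhds (0 : ℝ) one_pos] with t ht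
    refine Eventually.of_forall fun x => ?_
    by_cases hx : x ∈ K
    · rw [indicator_of_mem hx, norm_mul]
      exact mul_le_mul_of_nonneg_left (hM _) (norm_nonneg _)
    · have : G (x.1 + t, x.2) = 0 := by
        refine image_eq_zero_of_notMem_tsupport fun hmem => hx ?_
        have h1 := hR hmem
        rw [shift_add_eq, mem_closedBall_zero_iff] at h1
        have h2 : ‖((t, 0) : ℝ × ℝ)‖ ≤ 1 := by
          rw [Prod.norm_mk]
          rw [norm_zero, max_eq_left (norm_nonneg t)]
          exact (mem_ball_zero_iff.1 ht).le
        rw [mem_closedBall_zero_iff]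
        calc ‖x‖ = ‖x + (t, 0) - (t, 0)‖ := by rw [add_sub_cancel_right]
          _ ≤ ‖x + (t, 0)‖ + ‖((t, 0) : ℝ × ℝ)‖ := norm_sub_le _ _
          _ ≤ R + 1 := add_le_add h1 h2
      rw [indicator_of_notMem hx, this, mul_zero, norm_zero]
  · exact (integrable_indicator_iff hK.measurableSet).2 (hfK.norm.mul_const M)
  · refine Eventually.of_forall fun x => ContinuousAt.mul continuousAt_const ?_
    exact (hG.continuous.comp (by fun_prop : Continuous fun t : ℝ => (x.1 + t, x.2))).continuousAt

/-- Mollifications converge weakly. -/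
theorem exists_kernel_integral_close {f G : ℝ × ℝ → ℝ} (hf : IsDatum f) {Q : Set (ℝ × ℝ)}
    (hG : IsTest Q G) {δ : ℝ} (hδ : 0 < δ) : ∃ κ : ℝ → ℝ, IsTest (Iio 0) κ ∧ (∀ t, 0 ≤ κ t) ∧
      ∫ t, κ t = 1 ∧ |(∫ x, mol κ f x * G x) - ∫ x, f x * G x| ≤ δ := by
  obtain ⟨ε, hε, hclose⟩ := Metric.continuousAt_iff.1 (continuousAt_integral_shift hf hG) δ hδ
  obtain ⟨κ, hκ, hκ0, hκ1, hκs⟩ := exists_kernel hε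
  refine ⟨κ, hκ, hκ0, hκ1, ?_⟩
  have hκi : Integrable κ := hκ.continuous.integrable_of_hasCompactSupport hκ.compact
  set I : ℝ → ℝ := fun t => ∫ x : ℝ × ℝ, f x * G (x.1 + t, x.2) with hI
  have hI0 : I 0 = ∫ x, f x * G x := by simp [hI]
  have hGm : StronglyMeasurable G := hG.continuous.stronglyMeasurable
  have hi := integrable_mul_integral_shift hκ hf.meas hf.memLp hGm hG.memLp_volume
  have hsub : (∫ x, mol κ f x * G x) - ∫ x, f x * G x = ∫ t, κ t * (I t - I 0) := by
    rw [integral_mol_mul hκ hf.meas hf.memLp hGm hG.memLp_volume, ← hI0]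
    have e : ∀ t, κ t * (I t - I 0) = κ t * I t - κ t * I 0 := fun t => mul_sub _ _ _
    simp only [e]
    rw [integral_sub hi (hκi.mul_const _), integral_mul_const, hκ1, one_mul]
  rw [hsub]
  calc |∫ t, κ t * (I t - I 0)| ≤ ∫ t, |κ t * (I t - I 0)| := abs_integral_le_integral_abs
    _ ≤ ∫ t, κ t * δ := by
        refine integral_mono_of_nonneg (Eventually.of_forall fun t => abs_nonneg _)
          (hκi.mul_const _) (Eventually.of_forall fun t => ?_)
        simp only
        by_cases ht : κ t = 0
        · simp [ht]
        · rw [abs_mul, abs_of_nonneg (hκ0 t)]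
          refine mul_le_mul_of_nonneg_left ?_ (hκ0 t)
          have := hclose (x := t) (by rw [Real.dist_eq, sub_zero]; exact hκs t ht)
          exact (Real.dist_eq _ _ ▸ this).le
    _ = δ := by rw [integral_mul_const, hκ1, one_mul]

end

section

/-! ### Interior regularity of the differentiated system -/

/-- A bound for the second derivatives of the mollifications, uniform in the kernel, bounds the
distributional second derivative. -/
theorem IsDatum.abs_integral_mul_dyy_le {f : ℝ × ℝ → ℝ} (hf : IsDatum f) {Z : ℝ}
    {φ : ℝ × ℝ → ℝ} (hφ : IsTest (Dom (Z : EReal)) φ) {ζ : ℝ × ℝ → ℝ} (hζ : Continuous ζ)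
    (hζb : ∀ x, |ζ x| ≤ 1) (hζ1 : ∀ x, φ x ≠ 0 → ζ x = 1) {K : ℝ}
    (hK : ∀ κ : ℝ → ℝ, IsTest (Iio 0) κ → (∀ t, 0 ≤ κ t) → ∫ t, κ t = 1 →
      ∫ x, (ζ x ^ 2 * EquatorialLayer.molD κ 2 f x) ^ 2 ∂mu (Z : EReal) ≤ K) :
    |∫ x, f x * (dy^[2] φ) x| ≤ √K * √(∫ x, φ x ^ 2) := by
  refine le_of_forall_pos_le_add fun δ hδ => ?_
  obtain ⟨κ, hκ, hκ0, hκ1, hclose⟩ := exists_kernel_integral_close hf (hφ.dy_iter 2) hδ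
  have e1 := hf.integral_molD_mul_dy hκ hφ 2
  rw [neg_one_sq, one_mul] at e1
  have e2 : ∫ x, EquatorialLayer.molD κ 2 f x * φ x
      = ∫ x, ζ x ^ 2 * EquatorialLayer.molD κ 2 f x * φ x ∂mu (Z : EReal) := by
    rw [integral_eq_integral_mu (Z := Z)
      (fun y z h => by rw [(hf.molD hκ 2).zero y z h, zero_mul])
      (fun y z h => by
        rw [hφ.eq_zero fun hx => h ⟨hx.1, EReal.coe_lt_coe_iff.1 hx.2.2⟩, mul_zero])]
    refine integral_congr_ae (Eventually.of_forall fun x => ?_)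
    by_cases hx : φ x = 0
    · simp [hx]
    · simp [hζ1 x hx]
  have hm : MemLp (fun x => ζ x ^ 2 * EquatorialLayer.molD κ 2 f x) 2 (mu (Z : EReal)) := by
    have h0 := (hf.molD hκ 2).memLp_mu (Z : EReal)
    refine h0.of_le ((hζ.pow 2).aestronglyMeasurable.mul h0.1) (Eventually.of_forall fun x => ?_)
    rw [norm_mul, norm_pow, Real.norm_eq_abs]
    exact mul_le_of_le_one_left (norm_nonneg _) (pow_le_one₀ (abs_nonneg _) (hζb x))
  have e3 := abs_integral_mul_le hm (hφ.memLp_mu (Z : EReal))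
  have e4 : ∫ x, φ x ^ 2 ∂mu (Z : EReal) ≤ ∫ x, φ x ^ 2 :=
    setIntegral_le_integral hφ.memLp.integrable_sq (Eventually.of_forall fun x => sq_nonneg _)
  have e5 : |∫ x, EquatorialLayer.mol κ f x * (dy^[2] φ) x| ≤ √K * √(∫ x, φ x ^ 2) := by
    rw [e1, e2]
    exact e3.trans (mul_le_mul (Real.sqrt_le_sqrt (hK κ hκ hκ0 hκ1)) (Real.sqrt_le_sqrt e4)
      (Real.sqrt_nonneg _) (Real.sqrt_nonneg _))
  have h1 := abs_sub_abs_le_abs_sub (∫ x, f x * (dy^[2] φ) x)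
    (∫ x, EquatorialLayer.mol κ f x * (dy^[2] φ) x)
  rw [abs_sub_comm] at h1
  linarith

/-- The test functions of `Q`. -/
def testSpace (Q : Set (ℝ × ℝ)) : Submodule ℝ (ℝ × ℝ → ℝ) where
  carrier := {φ | IsTest Q φ}
  add_mem' := fun h1 h2 => h1.add h2
  zero_mem' := IsTest.zero
  smul_mem' := fun r _ h => h.const_mul r

/-- A distributional second derivative that is bounded in `L²` is a function, by the Riesz
representation theorem. -/
theorem IsDatum.exists_dyy {f : ℝ × ℝ → ℝ} (hf : IsDatum f) {Q : Set (ℝ × ℝ)} {K : ℝ}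
    (hK : ∀ φ, IsTest Q φ → |∫ x, f x * (dy^[2] φ) x| ≤ √K * √(∫ x, φ x ^ 2)) :
    ∃ g : ℝ × ℝ → ℝ, MemLp g 2 (volume.restrict Q) ∧ ∫ x in Q, g x ^ 2 ≤ √K ^ 2 ∧
      ∀ φ, IsTest Q φ → ∫ x, f x * (dy^[2] φ) x = ∫ x in Q, g x * φ x := by
  have hm : ∀ φ : testSpace Q, MemLp φ.1 2 (volume.restrict Q) := fun φ => φ.2.memLp.restrict _
  let R : testSpace Q →ₗ[ℝ] Lp ℝ 2 (volume.restrict Q) :=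
    { toFun := fun φ => (hm φ).toLp φ.1
      map_add' := fun _ _ => rfl
      map_smul' := fun _ _ => rfl }
  have hd : ∀ φ : ℝ × ℝ → ℝ, dy^[2] φ = dy (dy φ) := fun _ => rfl
  let S : testSpace Q →ₗ[ℝ] ℝ :=
    { toFun := fun φ => ∫ x, f x * (dy^[2] φ.1) x
      map_add' := fun φ φ' => by
        rw [← integral_add (hf.integrable_mul_test (φ.2.dy_iter 2))
          (hf.integrable_mul_test (φ'.2.dy_iter 2))]
        have e : dy^[2] (φ + φ' : testSpace Q).1
            = fun x => dy (dy φ.1) x + dy (dy φ'.1) x := by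
          rw [hd, ← dy_add φ.2.dy.differentiable φ'.2.dy.differentiable,
            ← dy_add φ.2.differentiable φ'.2.differentiable]
          rfl
        simp only [e, hd, mul_add]
      map_smul' := fun r φ => by
        have e : dy^[2] (r • φ : testSpace Q).1 = fun x => r * dy (dy φ.1) x := by
          rw [hd, ← dy_const_mul φ.2.dy.differentiable, ← dy_const_mul φ.2.differentiable]
          rfl
        simp only [e, hd, RingHom.id_apply, smul_eq_mul]
        rw [← integral_const_mul]
        refine integral_congr_ae (Eventually.of_forall fun x => ?_)
        simp only; ring }
  have hR : ∀ φ : testSpace Q, ‖R φ‖ = √(∫ x, φ.1 x ^ 2) := fun φ => by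
    have e : ‖R φ‖ ^ 2 = ∫ x, φ.1 x ^ 2 := by
      rw [← real_inner_self_eq_norm_sq, L2.inner_def,
        ← setIntegral_eq_integral_of_forall_compl_eq_zero (s := Q) (f := fun x => φ.1 x ^ 2)
        (fun x hx => by rw [φ.2.eq_zero hx]; ring)]
      refine integral_congr_ae ?_
      filter_upwards [(hm φ).coeFn_toLp] with x hx
      change inner ℝ ((hm φ).toLp φ.1 x) ((hm φ).toLp φ.1 x) = _
      rw [hx]; simp [sq]
    rw [← e, Real.sqrt_sq (norm_nonneg _)]
  obtain ⟨g, hg, hgS⟩ := exists_inner_eq_of_le R S (Real.sqrt_nonneg K)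
    fun φ => by rw [hR]; exact hK φ.1 φ.2
  refine ⟨g, Lp.memLp g, ?_, fun φ hφ => ?_⟩
  · have e : ‖g‖ ^ 2 = ∫ x in Q, g x ^ 2 := by
      rw [← real_inner_self_eq_norm_sq, L2.inner_def]
      exact integral_congr_ae (Eventually.of_forall fun x => by simp [sq])
    rw [← e]
    exact pow_le_pow_left₀ (norm_nonneg _) hg 2
  · refine (hgS ⟨φ, hφ⟩).trans ?_
    rw [L2.inner_def]
    refine integral_congr_ae ?_
    filter_upwards [(hm ⟨φ, hφ⟩).coeFn_toLp] with x hx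
    change inner ℝ (g x) ((hm ⟨φ, hφ⟩).toLp φ x) = _
    rw [hx]; simp [mul_comm]

/-- Interior regularity for the differentiated system: `∂_y² p` and `∂_y² Ψ` are square integrable
for `y > y₀`, `z < z₁`. -/
theorem WeakSystem.exists_dyy {y₀ z₁ z₂ : ℝ} (hy₀ : 0 < y₀) (hz₁ : 0 < z₁) (hz : z₁ < z₂) :
    ∃ C : ℝ, 0 ≤ C ∧ ∀ {h : EReal} {p Ψ a b c d : ℝ × ℝ → ℝ}, (z₂ : EReal) ≤ h →
      WeakSystem h p Ψ a b c d → IsDatum p → IsDatum Ψ → IsDatum a → IsDatum b → IsDatum c →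
      IsDatum d → ∀ f, f = p ∨ f = Ψ → ∃ g : ℝ × ℝ → ℝ,
        MemLp g 2 (volume.restrict (Ioi y₀ ×ˢ Ioo 0 z₁)) ∧
        ∫ x in Ioi y₀ ×ˢ Ioo 0 z₁, g x ^ 2 ≤ C * ((∫ x, p x ^ 2) + (∫ x, Ψ x ^ 2)
          + (∫ x, a x ^ 2) + (∫ x, b x ^ 2) + (∫ x, c x ^ 2) + ∫ x, d x ^ 2) ∧
        ∀ φ, IsTest (Ioi y₀ ×ˢ Ioo 0 z₁) φ →
          ∫ x, f x * (dy^[2] φ) x = ∫ x in Ioi y₀ ×ˢ Ioo 0 z₁, g x * φ x := by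
  obtain ⟨B₁, hB₁⟩ := exists_cutoff hy₀
  obtain ⟨B₂, θ, hθ, hθs, hθ1, hθB, hθe⟩ := exists_cutoff_top hz
  set B := max B₁ B₂ with hB
  refine ⟨80 * coefConst B z₂ ^ 2, by positivity, ?_⟩
  intro h p Ψ a b c d hZ hs hp hΨ ha hb hc hd f hf
  set N := (∫ x, p x ^ 2) + (∫ x, Ψ x ^ 2) + (∫ x, a x ^ 2) + (∫ x, b x ^ 2) + (∫ x, c x ^ 2)
    + ∫ x, d x ^ 2 with hN
  have hN0 : 0 ≤ N := by positivity
  have hfd : IsDatum f := by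
    rcases hf with rfl | rfl <;> assumption
  have key : ∀ φ, IsTest (Ioi y₀ ×ˢ Ioo 0 z₁) φ → |∫ x, f x * (dy^[2] φ) x|
      ≤ √(80 * coefConst B z₂ ^ 2 * N) * √(∫ x, φ x ^ 2) := by
    intro φ hφ
    obtain ⟨R, hR⟩ := hφ.compact.isCompact.isBounded.subset_closedBall (0 : ℝ × ℝ)
    obtain ⟨χ, α, β, hα, hχ, hχs, hχ1, hχB, hχB', hχe⟩ := hB₁ R
    have hsub : Ioi y₀ ×ˢ Ioo 0 z₁ ⊆ Dom (z₂ : EReal) := fun x hx =>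
      ⟨hy₀.trans hx.1, hx.2.1, EReal.coe_lt_coe_iff.2 (hx.2.2.trans hz)⟩
    refine hfd.abs_integral_mul_dyy_le (hφ.mono hsub) (ζ := fun x => χ x.1 * θ x.2)
      ((hχ.continuous.comp continuous_fst).mul (hθ.continuous.comp continuous_snd))
      (fun x => ?_) (fun x hx => ?_) fun κ hκ hκ0 hκ1 => ?_
    · rw [abs_mul]
      exact mul_le_one₀ (hχ1 _) (abs_nonneg _) (hθ1 _)
    · have hxs : x ∈ tsupport φ := subset_tsupport _ hx
      have hxQ := hφ.supp hxs
      have hx1 : x.1 ≤ R := by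
        have := mem_closedBall_zero_iff.1 (hR hxs)
        exact (le_abs_self _).trans ((norm_fst_le x).trans this)
      rw [hχe _ ⟨(mem_Ioi.1 hxQ.1).le, hx1⟩, hθe _ hxQ.2.2.le, one_mul]
    · have := hs.energy_estimate hp hΨ ha hb hc hd hκ hκ0 hκ1 (hz₁.trans hz) hZ hα hχ hχs hχ1
        (fun y => (hχB y).trans (le_max_left _ _)) (fun y => (hχB' y).trans (le_max_left _ _))
        hθ hθs hθ1 (fun z => (hθB z).trans (le_max_right _ _))
      refine le_trans ?_ this
      have hζ : ∀ {q : ℝ × ℝ → ℝ}, IsDatum q → Integrable (fun x : ℝ × ℝ =>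
          ((χ x.1 * θ x.2) ^ 2 * molD κ 2 q x) ^ 2) (mu (z₂ : EReal)) := fun {q} hq => by
        have h0 := (hq.molD hκ 2).memLp_mu (z₂ : EReal)
        have hc : Continuous fun x : ℝ × ℝ => χ x.1 * θ x.2 :=
          (hχ.continuous.comp continuous_fst).mul (hθ.continuous.comp continuous_snd)
        refine MemLp.integrable_sq (h0.of_le ((hc.pow 2).aestronglyMeasurable.mul h0.1)
          (Eventually.of_forall fun x => ?_))
        rw [norm_mul, norm_pow, Real.norm_eq_abs, abs_mul]
        exact mul_le_of_le_one_left (norm_nonneg _) (pow_le_one₀ (by positivity)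
          (mul_le_one₀ (hχ1 _) (abs_nonneg _) (hθ1 _)))
      refine integral_mono ?_ ((hζ hp).fun_add (hζ hΨ)) fun x => ?_
      · exact hζ hfd
      · rcases hf with rfl | rfl
        · exact le_add_of_nonneg_right (sq_nonneg _)
        · exact le_add_of_nonneg_left (sq_nonneg _)
  obtain ⟨g, hg, hgK, hgφ⟩ := hfd.exists_dyy key
  exact ⟨g, hg, by rwa [Real.sq_sqrt (by positivity)] at hgK, hgφ⟩

end

section

/-! ### The differentiated system of a weak solution -/

variable {h : EReal}

/-- Extension by zero from `Dom h` to the plane. -/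
def zeroExt (h : EReal) (f : ℝ × ℝ → ℝ) : ℝ × ℝ → ℝ := (Dom h).indicator f

theorem isDatum_zeroExt {f : ℝ × ℝ → ℝ} (hm : StronglyMeasurable f) (hf : MemLp f 2 (mu h)) :
    IsDatum (zeroExt h f) where
  meas := hm.indicator (measurableSet_dom h)
  memLp := (memLp_indicator_iff_restrict (measurableSet_dom h)).2 hf
  zero := fun _ _ hz => indicator_of_notMem (fun hx => absurd hx.2.1 (not_lt.2 hz)) _

theorem integral_zeroExt_mul (f G : ℝ × ℝ → ℝ) :
    ∫ x, zeroExt h f x * G x = ∫ x, f x * G x ∂mu h := by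
  rw [mu, ← integral_indicator (measurableSet_dom h)]
  refine integral_congr_ae (Eventually.of_forall fun x => ?_)
  by_cases hx : x ∈ Dom h <;> simp [zeroExt, hx]

theorem integral_zeroExt_sq (f : ℝ × ℝ → ℝ) :
    ∫ x, zeroExt h f x ^ 2 = ∫ x, f x ^ 2 ∂mu h := by
  rw [mu, ← integral_indicator (measurableSet_dom h)]
  refine integral_congr_ae (Eventually.of_forall fun x => ?_)
  by_cases hx : x ∈ Dom h <;> simp [zeroExt, hx]

theorem integral_zeroExt_lp_sq (X : Lp ℝ 2 (mu h)) : ∫ x, zeroExt h X x ^ 2 = ‖X‖ ^ 2 := by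
  rw [integral_zeroExt_sq, norm_sq_lp]

/-- Division by a weight that is at least `1`. -/
theorem isDatum_zeroExt_div (X : Lp ℝ 2 (mu h)) {m : ℝ × ℝ → ℝ} (hm : Continuous m)
    (hm1 : ∀ x ∈ Dom h, 1 ≤ m x) : IsDatum (zeroExt h fun x => X x / m x) ∧
      ∫ x, zeroExt h (fun x => X x / m x) x ^ 2 ≤ ‖X‖ ^ 2 := by
  have hX := Lp.memLp X
  have hs : StronglyMeasurable fun x => X x / m x :=
    ((Lp.stronglyMeasurable X).measurable.div hm.measurable).stronglyMeasurable
  have hle : ∀ᵐ x ∂mu h, ‖X x / m x‖ ≤ ‖X x‖ := by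
    filter_upwards [ae_mem_dom h] with x hx
    rw [norm_div]
    exact div_le_self (norm_nonneg _) ((hm1 x hx).trans (le_abs_self _))
  have hL : MemLp (fun x => X x / m x) 2 (mu h) := hX.of_le hs.aestronglyMeasurable hle
  refine ⟨isDatum_zeroExt hs hL, ?_⟩
  rw [integral_zeroExt_sq, norm_sq_lp]
  refine integral_mono_ae hL.integrable_sq hX.integrable_sq ?_
  filter_upwards [hle] with x hx
  exact sq_le_sq.2 hx

/-- The weak derivative `∂_y²ψ` may be tested by functions that do not vanish at `z = 0`, since it
involves no derivative across that boundary. -/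
theorem Energy.integral_psi_mul_dyy {c : ℝ} (u : Energy c h) {W : ℝ × ℝ → ℝ}
    (hW : IsTest {p : ℝ × ℝ | 0 < p.1 ∧ (p.2 : EReal) < h} W) :
    ∫ x, psiOf u x * dy (dy W) x ∂mu h = ∫ x, u.1 3 x * W x ∂mu h := by
  -- cut-off functions of `z` that vanish near the bottom and tend to `1`
  let σ : ℕ → ℝ → ℝ := fun n z => Real.smoothTransition (n * z - 1)
  have hσs : ∀ n, ContDiff ℝ ∞ (σ n) := fun n =>
    Real.smoothTransition.contDiff.comp (by fun_prop)
  have hσb : ∀ n z, |σ n z| ≤ 1 := fun n z => by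
    rw [abs_of_nonneg (Real.smoothTransition.nonneg _)]
    exact Real.smoothTransition.le_one _
  have hσ0 : ∀ (n : ℕ) (z : ℝ), n * z < 1 → σ n z = 0 := fun n z hz =>
    Real.smoothTransition.zero_of_nonpos (by linarith)
  have hσ1 : ∀ z : ℝ, 0 < z → Tendsto (fun n => σ n z) atTop (𝓝 1) := fun z hz => by
    have h1 : Tendsto (fun n : ℕ => (n : ℝ) * z) atTop atTop :=
      tendsto_natCast_atTop_atTop.atTop_mul_const hz
    refine tendsto_const_nhds.congr' ?_
    filter_upwards [h1.eventually_ge_atTop 2] with n hn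
    exact (Real.smoothTransition.one_of_one_le (by linarith)).symm
  have key : ∀ {F : ℝ × ℝ → ℝ}, Integrable F (mu h) →
      Tendsto (fun n => ∫ x, σ n x.2 * F x ∂mu h) atTop (𝓝 (∫ x, F x ∂mu h)) := fun {F} hF => by
    refine tendsto_integral_of_dominated_convergence (fun x => ‖F x‖) (fun n => ?_) hF.norm
      (fun n => Eventually.of_forall fun x => ?_) ?_
    · exact ((hσs n).continuous.comp continuous_snd).aestronglyMeasurable.mul hF.1
    · rw [norm_mul, Real.norm_eq_abs]
      exact mul_le_of_le_one_left (norm_nonneg _) (hσb n _)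
    · filter_upwards [ae_mem_dom h] with x hx
      simpa using (hσ1 x.2 hx.2.1).mul_const (F x)
  have h1 := key (psiOf_mul_integrable u hW.dy.dy)
  have h2 := key (integrable_mul_test (u.memLp 3) hW)
  refine tendsto_nhds_unique h1 (h2.congr fun n => ?_)
  have hWn : IsTest (Dom h) fun x => σ n x.2 * W x := by
    have h0 := hW.mul_left (g := fun x : ℝ × ℝ => σ n x.2) ((hσs n).comp contDiff_snd)
    refine ⟨h0.smooth, h0.compact, fun x hx => ⟨(h0.supp hx).1, ?_, (h0.supp hx).2⟩⟩
    by_contra hz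
    refine notMem_tsupport_iff_eventuallyEq.2 ?_ hx
    have : ∀ᶠ x' : ℝ × ℝ in 𝓝 x, (n : ℝ) * x'.2 < 1 := by
      refine (isOpen_lt (by fun_prop) continuous_const).mem_nhds ?_
      exact (mul_nonpos_of_nonneg_of_nonpos n.cast_nonneg (not_lt.1 hz)).trans_lt one_pos
    filter_upwards [this] with x' hx'
    simp [hσ0 n _ hx']
  have := u.hasWeakDy_psi _ hWn
  change ∫ x, psiOf u x * dy (dy _) x ∂mu h = (-1) ^ 2 * ∫ x, _ ∂mu h at this
  rw [dy_snd_mul hW.differentiable (σ n) ((hσs n).differentiable (by simp)),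
    dy_snd_mul hW.dy.differentiable (σ n) ((hσs n).differentiable (by simp)), neg_one_sq,
    one_mul] at this
  simp only [dyypsiOf] at this
  calc ∫ x, σ n x.2 * (u.1 3 x * W x) ∂mu h = ∫ x, u.1 3 x * (σ n x.2 * W x) ∂mu h :=
        integral_congr_ae (Eventually.of_forall fun x => by simp only; ring)
    _ = ∫ x, psiOf u x * (σ n x.2 * dy (dy W) x) ∂mu h := this.symm
    _ = _ := integral_congr_ae (Eventually.of_forall fun x => by simp only; ring)

variable {P : Problem} {s : StrongDual ℝ (E1 P.height)} {l : StrongDual ℝ (E0 P.height)}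
  {u : E0 P.height}

/-- The weak formulation, differentiated twice in `y`. The pair `(∂_y² w, ∂_y² φ)` is admissible in
both problems, as it vanishes at the upper boundary. -/
theorem Problem.IsWeakSolution.weakForm_dyy (hu : P.IsWeakSolution s u) (hl : IsDyyOfSource s l)
    {w φ : ℝ × ℝ → ℝ} (hw : IsTest {p : ℝ × ℝ | 0 < p.1 ∧ (p.2 : EReal) < P.height} w)
    (hφ : IsTest (Dom P.height) φ) :
    weakForm u (dy (dy w)) (dy (dy φ))
      = l (testEnergy zero_le_one P.height (hw.mono fun _ hx => hx.1) hφ.half) := by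
  obtain ⟨x, e, hx, he, hse⟩ := hl w φ hw hφ
  have hp : P.IsTestPair (dy (dy w)) (dy (dy φ)) := by
    refine ⟨hw.dy.dy.mono fun _ hx => hx.1, hφ.dy.dy.mono fun _ hx => ⟨hx.1, hx.2.1⟩, ?_⟩
    cases P with
    | quarterPlane => trivial
    | strip H hH Λ hΛ =>
      have e1 : ∀ y, dy (dy w) (y, H) = 0 := fun y => hw.dy.dy.eq_zero fun hx => lt_irrefl _ hx.2
      have e2 : ∀ y, dy (dy φ) (y, H) = 0 := fun y => hφ.dy.dy.eq_zero fun hx => lt_irrefl _ hx.2.2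
      simp only [Problem.TopCondition, e1, e2, neg_zero]
      exact AdjointEq.zero Λ
  rw [weakForm_eq_apply hu hp hx, hse, he.unique zero_le_one (represents_testEnergy _ _ _)]

/-- `p = ∂_y v` and `Ψ = ∂_y²ψ` solve the differentiated system; the data are the components of the
element of `E_0` that represents `ℓ`. -/
theorem Problem.IsWeakSolution.weakSystem (hu : P.IsWeakSolution s u) (hl : IsDyyOfSource s l) :
    WeakSystem P.height (zeroExt P.height (u.1 1)) (zeroExt P.height (u.1 3))
      (zeroExt P.height fun x =>
        ((InnerProductSpace.toDual ℝ (E0 P.height)).symm l).1 0 x / (1 + x.1))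
      (zeroExt P.height (((InnerProductSpace.toDual ℝ (E0 P.height)).symm l).1 1))
      (zeroExt P.height fun x =>
        ((InnerProductSpace.toDual ℝ (E0 P.height)).symm l).1 2 x / (1 + x.1 ^ 2))
      (zeroExt P.height (((InnerProductSpace.toDual ℝ (E0 P.height)).symm l).1 3)) := by
  set e := (InnerProductSpace.toDual ℝ (E0 P.height)).symm l with he
  have hle : ∀ e', l e' = inner ℝ e e' := fun e' => by
    rw [he, InnerProductSpace.toDual_symm_apply]
  have div : ∀ X G m : ℝ × ℝ → ℝ, ∫ x, X x / m x * G x ∂mu P.height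
      = ∫ x, X x * (G x / m x) ∂mu P.height := fun X G m =>
    integral_congr_ae (Eventually.of_forall fun x => by simp only; ring)
  constructor
  · intro φ hφ
    have key := hu.weakForm_dyy hl IsTest.zero hφ
    simp only [dy_zero] at key
    rw [weakForm_eq _ IsTest.zero hφ.dy.dy.half, hle, inner_testEnergy, transport_zero,
      dy_zero] at key
    have e1 := u.hasWeakDy_v _ hφ.dy.transport
    change ∫ x, vOf u x * dy _ x ∂mu P.height = (-1) ^ 1 * ∫ x, u.1 1 x * _ ∂mu P.height at e1
    rw [dy_transport hφ.dy.smooth] at e1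
    rw [e1] at key
    simp only [integral_zeroExt_mul, div]
    simp only [mul_zero, zero_div, integral_zero] at key
    change _ - 1 / 2 * (∫ x, u.1 3 x * dy (dy (dy (dy φ))) x ∂mu P.height)
      = _ + ∫ x, e.1 3 x * dy (dy φ) x ∂mu P.height
    linear_combination key
  · intro w hw
    have hwh : HalfTest w := hw.mono fun _ hx => hx.1
    have key := hu.weakForm_dyy hl hw IsTest.zero
    simp only [dy_zero] at key
    rw [weakForm_eq _ hwh.dy.dy IsTest.zero, hle, inner_testEnergy, transport_zero,
      dy_zero] at key
    have e1 := u.integral_psi_mul_dyy hw.transport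
    rw [dy_transport hw.smooth, dy_transport hw.dy.smooth] at e1
    rw [e1] at key
    simp only [integral_zeroExt_mul, div]
    simp only [mul_zero, zero_div, dy_zero, integral_zero] at key
    change _ - 1 / 2 * (∫ x, u.1 1 x * dy (dy (dy w)) x ∂mu P.height) = _
    linear_combination key

theorem exists_interior_regularity {y₀ z₁ z₂ : ℝ} (hy₀ : 0 < y₀) (hz₁ : 0 < z₁) (hz : z₁ < z₂) :
    ∃ C : ℝ, 0 < C ∧ ∀ P : Problem, (z₂ : EReal) ≤ P.height →
      ∀ (s : StrongDual ℝ (E1 P.height)) (l : StrongDual ℝ (E0 P.height)) (u : E0 P.height),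
        P.IsWeakSolution s u → IsDyyOfSource s l →
        ∃ ψ₄ v₃ : ℝ × ℝ → ℝ,
          HasWeakDy 4 (Ioi y₀ ×ˢ Ioo 0 z₁) (psiOf u) ψ₄ ∧
          HasWeakDy 3 (Ioi y₀ ×ˢ Ioo 0 z₁) (vOf u) v₃ ∧
          MemLp ψ₄ 2 (volume.restrict (Ioi y₀ ×ˢ Ioo 0 z₁)) ∧
          MemLp v₃ 2 (volume.restrict (Ioi y₀ ×ˢ Ioo 0 z₁)) ∧
          ∫ p in Ioi y₀ ×ˢ Ioo 0 z₁, (ψ₄ p ^ 2 + v₃ p ^ 2) ≤ C * (‖u‖ ^ 2 + ‖l‖ ^ 2) := by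
  obtain ⟨C, hC, hreg⟩ := WeakSystem.exists_dyy hy₀ hz₁ hz
  refine ⟨2 * C + 1, by positivity, fun P hP s l u hu hl => ?_⟩
  have hs := hu.weakSystem hl
  set e := (InnerProductSpace.toDual ℝ (E0 P.height)).symm l with he
  have hel : ‖e‖ = ‖l‖ := by rw [he, LinearIsometryEquiv.norm_map]
  have hD : ∀ X : Lp ℝ 2 (mu P.height), IsDatum (zeroExt P.height X) := fun X =>
    isDatum_zeroExt (Lp.stronglyMeasurable X) (Lp.memLp X)
  obtain ⟨ha, ha'⟩ := isDatum_zeroExt_div (e.1 0) (m := fun x => 1 + x.1) (by fun_prop)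
    fun x hx => by linarith [hx.1]
  obtain ⟨hc, hc'⟩ := isDatum_zeroExt_div (e.1 2) (m := fun x => 1 + x.1 ^ 2) (by fun_prop)
    fun x _ => by linarith [sq_nonneg x.1]
  have hN := hreg hP hs (hD _) (hD _) ha (hD _) hc (hD _)
  obtain ⟨v₃, hv, hvn, hvφ⟩ := hN _ (Or.inl rfl)
  obtain ⟨ψ₄, hψ, hψn, hψφ⟩ := hN _ (Or.inr rfl)
  have hQ : Ioi y₀ ×ˢ Ioo 0 z₁ ⊆ Dom P.height := fun x hx =>
    ⟨hy₀.trans hx.1, hx.2.1, (EReal.coe_lt_coe_iff.2 (hx.2.2.trans hz)).trans_le hP⟩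
  have toMu : ∀ {F φ : ℝ × ℝ → ℝ}, IsTest (Ioi y₀ ×ˢ Ioo 0 z₁) φ →
      ∫ x in Ioi y₀ ×ˢ Ioo 0 z₁, F x * φ x = ∫ x, F x * φ x ∂mu P.height := fun {F φ} hφ => by
    refine (setIntegral_eq_of_subset_of_forall_sdiff_eq_zero (measurableSet_dom _) hQ
      fun x hx => ?_).symm
    rw [hφ.eq_zero hx.2, mul_zero]
  refine ⟨ψ₄, v₃, fun φ hφ => ?_, fun φ hφ => ?_, hψ, hv, ?_⟩
  · rw [toMu (hφ.dy_iter 4), ← hψφ φ hφ, integral_zeroExt_mul]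
    have := u.hasWeakDy_psi _ ((hφ.mono hQ).dy_iter 2)
    change ∫ x, psiOf u x * (dy^[4] φ) x ∂mu P.height
      = (-1) ^ 2 * ∫ x, u.1 3 x * (dy^[2] φ) x ∂mu P.height at this
    rw [this]; norm_num
  · rw [toMu (hφ.dy_iter 3), ← hvφ φ hφ, integral_zeroExt_mul]
    have := u.hasWeakDy_v _ ((hφ.mono hQ).dy_iter 2)
    change ∫ x, vOf u x * (dy^[3] φ) x ∂mu P.height
      = (-1) ^ 1 * ∫ x, u.1 1 x * (dy^[2] φ) x ∂mu P.height at this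
    rw [this]; norm_num
  · rw [integral_add hψ.integrable_sq hv.integrable_sq]
    have n1 := u.norm_sq
    have n2 := e.norm_sq
    rw [Fin.sum_univ_four] at n1 n2
    simp only [integral_zeroExt_lp_sq] at hvn hψn
    have hle : ‖u.1 1‖ ^ 2 + ‖u.1 3‖ ^ 2
        + (∫ x, zeroExt P.height (fun x => e.1 0 x / (1 + x.1)) x ^ 2) + ‖e.1 1‖ ^ 2
        + (∫ x, zeroExt P.height (fun x => e.1 2 x / (1 + x.1 ^ 2)) x ^ 2) + ‖e.1 3‖ ^ 2
        ≤ ‖u‖ ^ 2 + ‖l‖ ^ 2 := by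
      rw [← hel]
      linarith [sq_nonneg ‖u.1 0‖, sq_nonneg ‖u.1 2‖]
    have := mul_le_mul_of_nonneg_left hle hC
    nlinarith [sq_nonneg ‖u‖, sq_nonneg ‖l‖]

end

end EquatorialLayer

end

theorem theorem2 :
    -- (i) existence, with a numerical constant
    (∃ C : ℝ, 0 < C ∧ ∀ (P : Problem) (s : StrongDual ℝ (E1 P.height)),
      ∃ u : E00 P.height, P.IsWeakSolution s u ∧ ‖u‖ ≤ C * ‖s‖) ∧
    -- (ii) boundary condition at the bottom, in both cases
    (∀ (P : Problem) (s : StrongDual ℝ (E1 P.height)) (u : E0 P.height),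
      P.IsRegularSource s → P.IsWeakSolution s u →
      H2Loc P.height (vOf u) → H2Loc P.height (psiOf u) →
      HasTrace P.height (psiOf u) 0 (fun _ => 0)) ∧
    -- (ii) boundary condition at the top, in case (II)
    (∀ (H : ℝ) (hH : 0 < H) (Λ : HHalf →L[ℝ] StrongDual ℝ HHalf) (hΛ : ∀ f, Λ f f ≤ 0)
      (s : StrongDual ℝ (E1 (Problem.strip H hH Λ hΛ).height))
      (u : E0 (Problem.strip H hH Λ hΛ).height),
      (Problem.strip H hH Λ hΛ).IsRegularSource s →
      (Problem.strip H hH Λ hΛ).IsWeakSolution s u →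
      H2Loc (H : EReal) (vOf u) → H2Loc (H : EReal) (psiOf u) →
      ∃ vH ψH : ℝ → ℝ,
        HasTrace (H : EReal) (vOf u) H vH ∧ HasTrace (H : EReal) (psiOf u) H ψH ∧
        ∀ g k : ℝ → ℝ, IsTest (Set.Ioi 0) g → IsTest (Set.Ioi 0) k → AdjointEq Λ g k →
          (∫ y in Set.Ioi (0 : ℝ), ψH y * g y) = (∫ y in Set.Ioi (0 : ℝ), vH y * k y) ∧
          ∀ V G : HHalf, HIs V vH → HIs G g →
            (∫ y in Set.Ioi (0 : ℝ), ψH y * g y) = Λ V G) ∧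
    -- (iii) interior regularity
    (∀ y₀ z₁ z₂ : ℝ, 0 < y₀ → 0 < z₁ → z₁ < z₂ → ∃ C : ℝ, 0 < C ∧
      ∀ P : Problem, (z₂ : EReal) ≤ P.height →
      ∀ (s : StrongDual ℝ (E1 P.height)) (l : StrongDual ℝ (E0 P.height)) (u : E0 P.height),
        P.IsWeakSolution s u → IsDyyOfSource s l →
        ∃ ψ₄ v₃ : ℝ × ℝ → ℝ,
          HasWeakDy 4 (Set.Ioi y₀ ×ˢ Set.Ioo 0 z₁) (psiOf u) ψ₄ ∧
          HasWeakDy 3 (Set.Ioi y₀ ×ˢ Set.Ioo 0 z₁) (vOf u) v₃ ∧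
          MeasureTheory.MemLp ψ₄ 2
            (MeasureTheory.volume.restrict (Set.Ioi y₀ ×ˢ Set.Ioo 0 z₁)) ∧
          MeasureTheory.MemLp v₃ 2
            (MeasureTheory.volume.restrict (Set.Ioi y₀ ×ˢ Set.Ioo 0 z₁)) ∧
          ∫ p in Set.Ioi y₀ ×ˢ Set.Ioo 0 z₁, (ψ₄ p ^ 2 + v₃ p ^ 2)
            ≤ C * (‖u‖ ^ 2 + ‖l‖ ^ 2)) := by
  exact ⟨⟨21, by norm_num, fun P s => exists_weakSolution P s⟩,
    fun P s u hs hu hv hψ => hs.trace_bottom hu hv hψ,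
    fun H hH Λ hΛ s u hs hu hv hψ => exists_trace_top hs hu hv hψ,
    fun y₀ z₁ z₂ hy₀ hz₁ hz => exists_interior_regularity hy₀ hz₁ hz⟩
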